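/- Let $\mathbb{k}$ be a field, $H$ a Hopf algebra over $\mathbb{k}$, and $R$ a Hopf algebra in the category ${}^H_H\mathcal{YD}$ of left-left Yetter–Drinfeld modules over $H$, with coaction $r\mapsto r_{(-1)}\otimes r_{(0)}$. For an $H$-module $Y$ let $c_{R,Y}:R\otimes Y\to Y\otimes R$, $c(r\otimes y)=r_{(-1)}\cdot y\otimes r_{(0)}$. Let $\mathscr{H}=R\# H$ be the bosonization: the Hopf algebra on $R\otimes H$ with multiplication $(r\otimes h)(r'\otimes h')=r(h_{(1)}\cdot r')\otimes h_{(2)}h'$ and comultiplication $\Delta(r\otimes h)=(r_{(1)}\otimes r_{(2)(-1)}h_{(1)})\otimes(r_{(2)(0)}\otimes h_{(2)})$. Cocycles. For a Hopf algebra $A$ over $\mathbb{k}$ let $Z(A)$ be the set of two-cocycles, i.e. convolution invertible linear maps $\sigma:A\otimes A\to\mathbb{k}$ with $\sigma(x_{(1)},y_{(1)})\,\sigma(x_{(2)}y_{(2)},z)=\sigma(y_{(1)},z_{(1)})\,\sigma(x,y_{(2)}z_{(2)})$ and $\sigma(1,1)=1$. Let $Z(R)$ be the set of $H$-linear maps $\pi:R\otimes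 R\to\mathbb{k}$ that are convolution invertible among the $H$-linear maps, satisfy $\pi(1,1)=1$, and satisfy $\pi(\hat\pi\otimes\mathrm{id})=\pi(\mathrm{id}\otimes\hat\pi)$ with $\hat\pi=(\pi\otimes\mu_R)\Delta_{R\otimes R}$, where $\Delta_{R\otimes R}=(\mathrm{id}\otimes c_{R,R}\otimes\mathrm{id})(\Delta_R\otimes\Delta_R)$ also defines the convolution. Let $Z'(\mathscr{H})$ be the set of $\sigma\in Z(\mathscr{H})$ with $\sigma(r\otimes h,r'\otimes h')=\sigma(r\otimes1,h\cdot r'\otimes1)\,\varepsilon_H(h')$ for all $r,r'\in R$, $h,h'\in H$. Cleft objects. An $A$-cleft object with section is a pair $(E,\gamma)$ of a right $A$-comodule algebra $E$ whose coinvariants are exactly $\mathbb{k}1_E$, with $1_E\neq0$, and a convolution invertible comodule map $\gamma:A\to E$ with $\gamma(1)=1_E$. An $R$-cleft object with section in $H$-mod is a pair $(\mathscr{E},\gamma)$ defined in the same way within the category of $H$-modules: all structure maps, $\gamma$ and its convolution inverse are $H$-linear, and the coaction $\mathscr{E}\to\mathscr{E}\otimes R$ is multiplicative for the product $(\mu_{\mathscr{E}}\otimes\mu_R)(\mathrm{id}\otimes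 c_{R,\mathscr{E}}\otimes\mathrm{id})$ on $\mathscr{E}\otimes R$. Let $\mathrm{C}(A)$, respectively $\mathrm{C}(R)$, be the set of isomorphism classes of such pairs, where an isomorphism is an isomorphism of comodule algebras (in $H$-mod in the case of $R$) that carries one section to the other. Let $\mathrm{C}'(\mathscr{H})$ be the set of $[(E,\gamma)]\in\mathrm{C}(\mathscr{H})$ with $\gamma((1\otimes h)(r\otimes h')(1\otimes h''))=\gamma(1\otimes h)\,\gamma(r\otimes h')\,\gamma(1\otimes h'')$ for all $r\in R$, $h,h',h''\in H$. For $\pi\in Z(R)$ let $\mathbb{k}\#_\pi R$ be $R$ with multiplication $\hat\pi$, unit $1$ and coaction $\Delta_R$, and for $\sigma\in Z(A)$ let $\mathbb{k}\#_\sigma A$ be $A$ with multiplication $x\cdot_\sigma y=\sigma(x_{(1)},y_{(1)})\,x_{(2)}y_{(2)}$, unit $1$ and coaction $\Delta_A$. Put $\alpha_R(\pi)=[(\mathbb{k}\#_\pi R,\mathrm{id})]$ and $\alpha_A(\sigma)=[(\mathbb{k}\#_\sigma A,\mathrm{id})]$. Then the following maps are well defined bijections: $$\Phi:Z(R)\to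 Z'(\mathscr{H}),\qquad \Phi(\pi)(r\otimes h,r'\otimes h')=\pi(r,h\cdot r')\,\varepsilon_H(h'),$$ $$\Psi:\mathrm{C}(R)\to\mathrm{C}'(\mathscr{H}),\qquad \Psi([(\mathscr{E},\gamma)])=[(\mathscr{E}\#H,\gamma\otimes\mathrm{id})],$$ where $\mathscr{E}\#H$ is $\mathscr{E}\otimes H$ with the smash product multiplication $(e\otimes h)(e'\otimes h')=e(h_{(1)}\cdot e')\otimes h_{(2)}h'$ and the $\mathscr{H}$-coaction $e\otimes h\mapsto(e_{(0)}\otimes e_{(1)(-1)}h_{(1)})\otimes(e_{(1)(0)}\otimes h_{(2)})$. The maps $\alpha_R:Z(R)\to\mathrm{C}(R)$ and $\alpha_{\mathscr{H}}:Z(\mathscr{H})\to\mathrm{C}(\mathscr{H})$ are well defined bijections, $\alpha_{\mathscr{H}}$ restricts to a bijection $Z'(\mathscr{H})\to\mathrm{C}'(\mathscr{H})$, and $\Psi\circ\alpha_R=\alpha_{\mathscr{H}}\circ\Phi$ on $Z(R)$. -/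

import Mathlib

open TensorProduct

universe u v w

namespace YDCleft

noncomputable section

section Tensor

variable {k : Type*} [Field k]
variable {A B A' B' C D : Type*}
  [AddCommGroup A] [Module k A] [AddCommGroup B] [Module k B]
  [AddCommGroup A'] [Module k A'] [AddCommGroup B'] [Module k B']
  [AddCommGroup C] [Module k C] [AddCommGroup D] [Module k D]

/-- `id ⊗ τ ⊗ id : A ⊗ B ⊗ A' ⊗ B' → A ⊗ A' ⊗ B ⊗ B'` for `τ : B ⊗ A' → A' ⊗ B`. -/
def mid (τ : B ⊗[k] A' →ₗ[k] A' ⊗[k] B) :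
    (A ⊗[k] B) ⊗[k] (A' ⊗[k] B') →ₗ[k] (A ⊗[k] A') ⊗[k] (B ⊗[k] B') :=
  (TensorProduct.assoc k A A' (B ⊗[k] B')).symm.toLinearMap ∘ₗ
    LinearMap.lTensor A
      ((TensorProduct.assoc k A' B B').toLinearMap ∘ₗ LinearMap.rTensor B' τ ∘ₗ
        (TensorProduct.assoc k B A' B').symm.toLinearMap) ∘ₗ
    (TensorProduct.assoc k A B (A' ⊗[k] B')).toLinearMap

/-- The convolution product `m ∘ (f ⊗ g) ∘ Δ`. -/
def convProd (Δ : C →ₗ[k] C ⊗[k] C) (m : D ⊗[k] D →ₗ[k] D) (f g : C →ₗ[k] D) : C →ₗ[k] D :=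
  m ∘ₗ TensorProduct.map f g ∘ₗ Δ

/-- `g` is a two-sided convolution inverse of `f`; the unit of the convolution product is
`c ↦ ε c • u`. -/
structure IsConvInverse (Δ : C →ₗ[k] C ⊗[k] C) (ε : C →ₗ[k] k) (m : D ⊗[k] D →ₗ[k] D) (u : D)
    (f g : C →ₗ[k] D) : Prop where
  right : ∀ c, convProd Δ m f g c = ε c • u
  left : ∀ c, convProd Δ m g f c = ε c • u

end Tensor

section HMod

variable (k : Type*) (H : Type*) [Field k] [Ring H] [HopfAlgebra k H]
variable (M N : Type*)
  [AddCommGroup M] [Module k M] [Module H M] [IsScalarTower k H M]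
  [AddCommGroup N] [Module k N] [Module H N] [IsScalarTower k H N]

/-- The action `H ⊗ M → M`, `h ⊗ m ↦ h • m`. -/
def act : H ⊗[k] M →ₗ[k] M := TensorProduct.lift (Algebra.lsmul k k M).toLinearMap

@[simp] theorem act_tmul (h : H) (m : M) : act k H M (h ⊗ₜ m) = h • m := rfl

/-- `H ⊗ M → M ⊗ H`, `h ⊗ m ↦ h₍₁₎ • m ⊗ h₍₂₎`. -/
def twist : H ⊗[k] M →ₗ[k] M ⊗[k] H :=
  LinearMap.rTensor H (act k H M) ∘ₗ
    (TensorProduct.assoc k H M H).symm.toLinearMap ∘ₗ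
    LinearMap.lTensor H (TensorProduct.comm k H M).toLinearMap ∘ₗ
    (TensorProduct.assoc k H H M).toLinearMap ∘ₗ
    LinearMap.rTensor M Coalgebra.comul

/-- The diagonal action of `h : H` on `M ⊗ N`: `h • (m ⊗ n) = h₍₁₎ • m ⊗ h₍₂₎ • n`. -/
def diagAct (h : H) : M ⊗[k] N →ₗ[k] M ⊗[k] N :=
  TensorProduct.map (act k H M) (act k H N) ∘ₗ
    (TensorProduct.tensorTensorTensorComm k H H M N).toLinearMap ∘ₗ
    TensorProduct.mk k (H ⊗[k] H) (M ⊗[k] N) (Coalgebra.comul h)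

end HMod

/-- A left-left Yetter–Drinfeld module over `H`: a left `H`-module `V` with a left `H`-coaction
`v ↦ v₍₋₁₎ ⊗ v₍₀₎` such that
`h₍₁₎ v₍₋₁₎ ⊗ h₍₂₎ • v₍₀₎ = (h₍₁₎ • v)₍₋₁₎ h₍₂₎ ⊗ (h₍₁₎ • v)₍₀₎`. -/
class YetterDrinfeld (k : Type*) (H : Type*) (V : Type*) [Field k] [Ring H] [HopfAlgebra k H]
    [AddCommGroup V] [Module k V] [Module H V] [IsScalarTower k H V] where
  coact : V →ₗ[k] H ⊗[k] V
  coassoc : ∀ v, TensorProduct.assoc k H H V (LinearMap.rTensor V Coalgebra.comul (coact v)) =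
    LinearMap.lTensor H coact (coact v)
  counit_coact : ∀ v, TensorProduct.lid k V (LinearMap.rTensor V Coalgebra.counit (coact v)) = v
  compat : ∀ (h : H) (v : V), diagAct k H H V h (coact v) =
    (LinearMap.rTensor V (LinearMap.mul' k H) ∘ₗ
      (TensorProduct.assoc k H H V).symm.toLinearMap ∘ₗ
      LinearMap.lTensor H (TensorProduct.comm k V H).toLinearMap ∘ₗ
      (TensorProduct.assoc k H V H).toLinearMap ∘ₗ
      LinearMap.rTensor H coact ∘ₗ twist k H V) (h ⊗ₜ v)

section Braid

variable (k : Type*) (H : Type*) [Field k] [Ring H] [HopfAlgebra k H]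
variable (V : Type*) [AddCommGroup V] [Module k V] [Module H V] [IsScalarTower k H V]
  [YetterDrinfeld k H V]
variable (W : Type*) [AddCommGroup W] [Module k W] [Module H W] [IsScalarTower k H W]

/-- The braiding `c : V ⊗ W → W ⊗ V`, `v ⊗ w ↦ v₍₋₁₎ • w ⊗ v₍₀₎`, of a Yetter–Drinfeld module `V`
with an `H`-module `W`. -/
def braid : V ⊗[k] W →ₗ[k] W ⊗[k] V :=
  LinearMap.rTensor V (act k H W) ∘ₗ
    (TensorProduct.assoc k H W V).symm.toLinearMap ∘ₗ
    LinearMap.lTensor H (TensorProduct.comm k V W).toLinearMap ∘ₗ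
    (TensorProduct.assoc k H V W).toLinearMap ∘ₗ
    LinearMap.rTensor W (YetterDrinfeld.coact (k := k) (H := H) (V := V))

end Braid

/-- The codiagonal coaction `v ⊗ w ↦ v₍₋₁₎ w₍₋₁₎ ⊗ v₍₀₎ ⊗ w₍₀₎` on `V ⊗ W`. -/
def codiag (k : Type*) (H : Type*) [Field k] [Ring H] [HopfAlgebra k H]
    (V : Type*) [AddCommGroup V] [Module k V] [Module H V] [IsScalarTower k H V]
    [YetterDrinfeld k H V]
    (W : Type*) [AddCommGroup W] [Module k W] [Module H W] [IsScalarTower k H W]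
    [YetterDrinfeld k H W] : V ⊗[k] W →ₗ[k] H ⊗[k] (V ⊗[k] W) :=
  LinearMap.rTensor (V ⊗[k] W) (LinearMap.mul' k H) ∘ₗ
    (TensorProduct.tensorTensorTensorComm k H V H W).toLinearMap ∘ₗ
    TensorProduct.map YetterDrinfeld.coact YetterDrinfeld.coact

/-- The comultiplication `r ⊗ s ↦ (r₍₁₎ ⊗ r₍₂₎₍₋₁₎ • s₍₁₎) ⊗ (r₍₂₎₍₀₎ ⊗ s₍₂₎)` of `R ⊗ R`. -/
def comulSq (k : Type*) (H : Type*) [Field k] [Ring H] [HopfAlgebra k H]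
    (R : Type*) [AddCommGroup R] [Module k R] [Module H R] [IsScalarTower k H R]
    [YetterDrinfeld k H R] [Coalgebra k R] :
    R ⊗[k] R →ₗ[k] (R ⊗[k] R) ⊗[k] (R ⊗[k] R) :=
  mid (braid k H R R) ∘ₗ TensorProduct.map Coalgebra.comul Coalgebra.comul

/-- The counit `ε ⊗ ε` of `C ⊗ C`. -/
def counitSq (k : Type*) [Field k] (C : Type*) [AddCommGroup C] [Module k C] [Coalgebra k C] :
    C ⊗[k] C →ₗ[k] k :=
  LinearMap.mul' k k ∘ₗ TensorProduct.map Coalgebra.counit Coalgebra.counit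

/-- The multiplication `(a ⊗ r)(b ⊗ s) = a (r₍₋₁₎ • b) ⊗ r₍₀₎ s` of `A ⊗ R`, where `m` is the
multiplication of `A`. -/
def braidedMul (k : Type*) (H : Type*) [Field k] [Ring H] [HopfAlgebra k H]
    (R : Type*) [Ring R] [Algebra k R] [Module H R] [IsScalarTower k H R] [YetterDrinfeld k H R]
    {A : Type*} [AddCommGroup A] [Module k A] [Module H A] [IsScalarTower k H A]
    (m : A ⊗[k] A →ₗ[k] A) : (A ⊗[k] R) ⊗[k] (A ⊗[k] R) →ₗ[k] A ⊗[k] R :=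
  TensorProduct.map m (LinearMap.mul' k R) ∘ₗ mid (braid k H R A)

/-- A Hopf algebra in the category of left-left Yetter–Drinfeld modules over `H`: all structure maps
are `H`-linear and `H`-colinear, and `comul`, `counit` are multiplicative with respect to
the braided multiplication of `R ⊗ R`. -/
class YDHopf (k : Type*) (H : Type*) (R : Type*) [Field k] [Ring H] [HopfAlgebra k H]
    [Ring R] [Algebra k R] [Coalgebra k R] [Module H R] [IsScalarTower k H R]
    [YetterDrinfeld k H R] where
  smul_mul : ∀ (h : H) (x : R ⊗[k] R),
    h • LinearMap.mul' k R x = LinearMap.mul' k R (diagAct k H R R h x)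
  smul_one : ∀ h : H, h • (1 : R) = Coalgebra.counit (R := k) h • (1 : R)
  comul_smul : ∀ (h : H) (r : R), Coalgebra.comul (R := k) (h • r) =
    diagAct k H R R h (Coalgebra.comul r)
  counit_smul : ∀ (h : H) (r : R), Coalgebra.counit (R := k) (h • r) =
    Coalgebra.counit (R := k) h * Coalgebra.counit (R := k) r
  coact_mul : ∀ x : R ⊗[k] R, YetterDrinfeld.coact (k := k) (H := H) (LinearMap.mul' k R x) =
    LinearMap.lTensor H (LinearMap.mul' k R) (codiag k H R R x)
  coact_one : YetterDrinfeld.coact (k := k) (1 : R) = (1 : H) ⊗ₜ[k] (1 : R)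
  comul_coact : ∀ r : R, LinearMap.lTensor H Coalgebra.comul (YetterDrinfeld.coact (k := k) r) =
    codiag k H R R (Coalgebra.comul r)
  counit_coact : ∀ r : R, LinearMap.lTensor H Coalgebra.counit (YetterDrinfeld.coact (k := k) r) =
    (1 : H) ⊗ₜ[k] Coalgebra.counit (R := k) r
  comul_mul : ∀ r s : R, Coalgebra.comul (R := k) (r * s) =
    braidedMul k H R (LinearMap.mul' k R) (Coalgebra.comul r ⊗ₜ Coalgebra.comul s)
  comul_one : Coalgebra.comul (R := k) (1 : R) = 1 ⊗ₜ 1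
  counit_mul : ∀ r s : R, Coalgebra.counit (R := k) (r * s) =
    Coalgebra.counit (R := k) r * Coalgebra.counit (R := k) s
  counit_one : Coalgebra.counit (R := k) (1 : R) = 1
  antipode : R →ₗ[k] R
  antipode_smul : ∀ (h : H) (r : R), antipode (h • r) = h • antipode r
  antipode_coact : ∀ r : R, YetterDrinfeld.coact (k := k) (antipode r) =
    LinearMap.lTensor H antipode (YetterDrinfeld.coact (k := k) r)
  antipode_inv : IsConvInverse Coalgebra.comul Coalgebra.counit (LinearMap.mul' k R) 1
    LinearMap.id antipode


section Lemmas

variable {k : Type*} {H : Type*} [Field k] [Ring H] [HopfAlgebra k H]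

@[simp] theorem mid_tmul {A B A' B' : Type*}
    [AddCommGroup A] [Module k A] [AddCommGroup B] [Module k B]
    [AddCommGroup A'] [Module k A'] [AddCommGroup B'] [Module k B']
    (τ : B ⊗[k] A' →ₗ[k] A' ⊗[k] B) (a : A) (b : B) (a' : A') (b' : B') :
    mid τ ((a ⊗ₜ b) ⊗ₜ (a' ⊗ₜ b')) =
      TensorProduct.map (TensorProduct.mk k A A' a) ((TensorProduct.mk k B B').flip b')
        (τ (b ⊗ₜ a')) := by
  simp only [mid, LinearMap.comp_apply, LinearEquiv.coe_coe, TensorProduct.assoc_tmul,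
    LinearMap.lTensor_tmul, TensorProduct.assoc_symm_tmul, LinearMap.rTensor_tmul]
  induction τ (b ⊗ₜ a') using TensorProduct.induction_on with
  | zero => simp
  | add x y hx hy => simp only [map_add, add_tmul, tmul_add, hx, hy]
  | tmul x y => simp

theorem twist_tmul {M : Type*}
    [AddCommGroup M] [Module k M] [Module H M] [IsScalarTower k H M] (h : H) (m : M) :
    twist k H M (h ⊗ₜ m) =
      LinearMap.rTensor H ((Algebra.lsmul k k M).toLinearMap.flip m) (Coalgebra.comul h) := by
  simp only [twist, LinearMap.comp_apply, LinearEquiv.coe_coe, LinearMap.rTensor_tmul]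
  induction (Coalgebra.comul (R := k) h) using TensorProduct.induction_on with
  | zero => simp
  | add x y hx hy => simp only [map_add, add_tmul, hx, hy]
  | tmul x y => simp

theorem diagAct_eq {M N : Type*}
    [AddCommGroup M] [Module k M] [Module H M] [IsScalarTower k H M]
    [AddCommGroup N] [Module k N] [Module H N] [IsScalarTower k H N] (h : H) (m : M) (n : N) :
    diagAct k H M N h (m ⊗ₜ n) =
      TensorProduct.map ((Algebra.lsmul k k M).toLinearMap.flip m)
        ((Algebra.lsmul k k N).toLinearMap.flip n) (Coalgebra.comul h) := by
  simp only [diagAct, LinearMap.comp_apply, LinearEquiv.coe_coe, TensorProduct.mk_apply]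
  induction (Coalgebra.comul (R := k) h) using TensorProduct.induction_on with
  | zero => simp
  | add x y hx hy => simp only [map_add, add_tmul, hx, hy]
  | tmul x y => simp

theorem braid_tmul {V W : Type*} [AddCommGroup V] [Module k V] [Module H V] [IsScalarTower k H V]
    [YetterDrinfeld k H V] [AddCommGroup W] [Module k W] [Module H W] [IsScalarTower k H W]
    (v : V) (w : W) :
    braid k H V W (v ⊗ₜ w) =
      LinearMap.rTensor V ((Algebra.lsmul k k W).toLinearMap.flip w)
        (YetterDrinfeld.coact (k := k) (H := H) v) := by
  simp only [braid, LinearMap.comp_apply, LinearEquiv.coe_coe, LinearMap.rTensor_tmul]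
  induction (YetterDrinfeld.coact (k := k) (H := H) v) using TensorProduct.induction_on with
  | zero => simp
  | add x y hx hy => simp only [map_add, add_tmul, hx, hy]
  | tmul x y => simp

/-- The multiplication `(e ⊗ h)(e' ⊗ h') = e (h₍₁₎ • e') ⊗ h₍₂₎ h'` of `E ⊗ H`, where `m` is the
multiplication of `E`. -/
def smashMul (k : Type*) (H : Type*) [Field k] [Ring H] [HopfAlgebra k H]
    {E : Type*} [AddCommGroup E] [Module k E] [Module H E] [IsScalarTower k H E]
    (m : E ⊗[k] E →ₗ[k] E) : (E ⊗[k] H) ⊗[k] (E ⊗[k] H) →ₗ[k] E ⊗[k] H :=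
  TensorProduct.map m (LinearMap.mul' k H) ∘ₗ mid (twist k H E)

section
variable {E : Type*} [AddCommGroup E] [Module k E] [Module H E] [IsScalarTower k H E]
    (m : E ⊗[k] E →ₗ[k] E)

theorem smashMul_tmul (e e' : E) (h h' : H) :
    smashMul k H m ((e ⊗ₜ h) ⊗ₜ (e' ⊗ₜ h')) =
      TensorProduct.map (m ∘ₗ TensorProduct.mk k E E e ∘ₗ (Algebra.lsmul k k E).toLinearMap.flip e')
        ((LinearMap.mul k H).flip h') (Coalgebra.comul h) := by
  simp only [smashMul, LinearMap.comp_apply, mid_tmul, twist_tmul]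
  induction (Coalgebra.comul (R := k) h) using TensorProduct.induction_on with
  | zero => simp
  | add x y hx hy => simp only [map_add, hx, hy]
  | tmul x y => simp

theorem smashMul_assoc
    (hm : ∀ a b c, m (m (a ⊗ₜ b) ⊗ₜ c) = m (a ⊗ₜ m (b ⊗ₜ c)))
    (hs : ∀ (h : H) (x : E ⊗[k] E), h • m x = m (diagAct k H E E h x)) (x y z : E ⊗[k] H) :
    smashMul k H m (smashMul k H m (x ⊗ₜ y) ⊗ₜ z) =
      smashMul k H m (x ⊗ₜ smashMul k H m (y ⊗ₜ z)) := by
  induction x using TensorProduct.induction_on with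
  | zero => simp
  | add x x' hx hy => simp only [map_add, add_tmul, hx, hy]
  | tmul e h =>
  induction y using TensorProduct.induction_on with
  | zero => simp
  | add x x' hx hy => simp only [map_add, add_tmul, tmul_add, hx, hy]
  | tmul e' h' =>
  induction z using TensorProduct.induction_on with
  | zero => simp
  | add x x' hx hy => simp only [map_add, tmul_add, hx, hy]
  | tmul e'' h'' =>
  rw [smashMul_tmul, smashMul_tmul]
  generalize hY : Coalgebra.comul (R := k) h' = Y
  trans ((TensorProduct.map (m ∘ₗ TensorProduct.map
        (m ∘ₗ TensorProduct.mk k E E e ∘ₗ (Algebra.lsmul k k E).toLinearMap.flip e')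
        ((Algebra.lsmul k k E).toLinearMap.flip e'')) ((LinearMap.mul k H).flip h'') ∘ₗ
        (TensorProduct.assoc k H H H).symm.toLinearMap))
      (LinearMap.lTensor H Coalgebra.comul (Coalgebra.comul h) * ((1 : H) ⊗ₜ[k] Y))
  · generalize Coalgebra.comul (R := k) h = X
    induction X using TensorProduct.induction_on with
    | zero => simp
    | add x y hx hy => simp only [map_add, add_tmul, add_mul, hx, hy]
    | tmul a b =>
      simp only [TensorProduct.map_tmul, smashMul_tmul, LinearMap.lTensor_tmul, LinearMap.flip_apply,
        LinearMap.mul_apply', Bialgebra.comul_mul, hY, Algebra.TensorProduct.tmul_mul_tmul, mul_one]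
      generalize Coalgebra.comul (R := k) b * Y = Z
      induction Z using TensorProduct.induction_on with
      | zero => simp
      | add x y hx hy => simp only [map_add, tmul_add, hx, hy]
      | tmul p q => simp
  · rw [← Coalgebra.coassoc_apply]
    clear hY
    induction Y using TensorProduct.induction_on with
    | zero => simp
    | add Y Y' hx hy => simp only [map_add, tmul_add, mul_add, hx, hy]
    | tmul p q =>
      simp only [TensorProduct.map_tmul, smashMul_tmul]
      generalize Coalgebra.comul (R := k) h = X
      induction X using TensorProduct.induction_on with
      | zero => simp
      | add x y hx hy => simp only [map_add, add_mul, hx, hy]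
      | tmul a b =>
        simp only [TensorProduct.map_tmul, LinearMap.rTensor_tmul, LinearMap.comp_apply,
          LinearMap.flip_apply, TensorProduct.mk_apply, AlgHom.toLinearMap_apply,
          Algebra.lsmul_coe, hs, diagAct_eq]
        generalize Coalgebra.comul (R := k) a = Z
        induction Z using TensorProduct.induction_on with
        | zero => simp
        | add x y hx hy => simp only [map_add, add_tmul, tmul_add, add_mul, hx, hy]
        | tmul c d => simp [hm, mul_assoc]


theorem one_smashMul (u : E) (hu : ∀ e, m (u ⊗ₜ e) = e) (x : E ⊗[k] H) :
    smashMul k H m ((u ⊗ₜ 1) ⊗ₜ x) = x := by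
  induction x using TensorProduct.induction_on with
  | zero => simp
  | add x x' hx hy => simp only [map_add, tmul_add, hx, hy]
  | tmul e h => simp [smashMul_tmul, Bialgebra.comul_one, Algebra.TensorProduct.one_def, hu]

theorem smashMul_one (u : E) (hu : ∀ e, m (e ⊗ₜ u) = e)
    (hs : ∀ h : H, h • u = Coalgebra.counit (R := k) h • u) (x : E ⊗[k] H) :
    smashMul k H m (x ⊗ₜ (u ⊗ₜ 1)) = x := by
  induction x using TensorProduct.induction_on with
  | zero => simp
  | add x x' hx hy => simp only [map_add, add_tmul, hx, hy]
  | tmul e h =>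
    rw [smashMul_tmul]
    trans TensorProduct.map ((LinearMap.id (R := k) (M := k)).smulRight e) LinearMap.id
      (LinearMap.rTensor H Coalgebra.counit (Coalgebra.comul (R := k) h))
    · generalize Coalgebra.comul (R := k) h = X
      induction X using TensorProduct.induction_on with
      | zero => simp
      | add x y hx hy => simp only [map_add, hx, hy]
      | tmul a b => simp [hs, hu]
    · simp

end

/-- The map `E ⊗ H → (E ⊗ H) ⊗ (R ⊗ H)`,
`e ⊗ h ↦ (e₍₀₎ ⊗ e₍₁₎₍₋₁₎ h₍₁₎) ⊗ (e₍₁₎₍₀₎ ⊗ h₍₂₎)`, where `ρ e = e₍₀₎ ⊗ e₍₁₎`. -/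
def smashCoact (k : Type*) (H : Type*) [Field k] [Ring H] [HopfAlgebra k H]
    {R : Type*} [AddCommGroup R] [Module k R] [Module H R] [IsScalarTower k H R]
    [YetterDrinfeld k H R] {E : Type*} [AddCommGroup E] [Module k E]
    (ρ : E →ₗ[k] E ⊗[k] R) : E ⊗[k] H →ₗ[k] (E ⊗[k] H) ⊗[k] (R ⊗[k] H) :=
  mid (braid k H R H) ∘ₗ TensorProduct.map ρ Coalgebra.comul

section

variable {R : Type*} [AddCommGroup R] [Module k R] [Module H R] [IsScalarTower k H R]
    [YetterDrinfeld k H R] {E : Type*} [AddCommGroup E] [Module k E]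
    (ρ : E →ₗ[k] E ⊗[k] R)

theorem smashCoact_tmul (e : E) (h : H) :
    smashCoact k H ρ (e ⊗ₜ h) = mid (braid k H R H) (ρ e ⊗ₜ Coalgebra.comul h) := rfl

theorem smashCoact_coassoc [Coalgebra k R]
    (hρ : ∀ e, TensorProduct.assoc k E R R (LinearMap.rTensor R ρ (ρ e)) =
      LinearMap.lTensor E Coalgebra.comul (ρ e))
    (hΔ : ∀ r : R, LinearMap.lTensor H Coalgebra.comul (YetterDrinfeld.coact (k := k) r) =
      codiag k H R R (Coalgebra.comul r)) (x : E ⊗[k] H) :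
    TensorProduct.assoc k (E ⊗[k] H) (R ⊗[k] H) (R ⊗[k] H)
      (LinearMap.rTensor (R ⊗[k] H) (smashCoact k H ρ) (smashCoact k H ρ x)) =
    LinearMap.lTensor (E ⊗[k] H) (smashCoact k H Coalgebra.comul) (smashCoact k H ρ x) := by
  induction x using TensorProduct.induction_on with
  | zero => simp
  | add x x' hx hy => simp only [map_add, hx, hy]
  | tmul e h =>
  let τ : (R ⊗[k] R) ⊗[k] H →ₗ[k] H ⊗[k] (R ⊗[k] R) :=
    LinearMap.rTensor (R ⊗[k] R) (LinearMap.mul' k H) ∘ₗ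
    (TensorProduct.assoc k H H (R ⊗[k] R)).symm.toLinearMap ∘ₗ
    LinearMap.lTensor H (TensorProduct.comm k (R ⊗[k] R) H).toLinearMap ∘ₗ
    (TensorProduct.assoc k H (R ⊗[k] R) H).toLinearMap ∘ₗ
    LinearMap.rTensor H (codiag k H R R)
  have hτ : ∀ X h, τ (X ⊗ₜ h) = LinearMap.rTensor _ ((LinearMap.mul k H).flip h)
      (codiag k H R R X) := by
    intro X h
    simp only [τ, LinearMap.comp_apply, LinearEquiv.coe_coe, LinearMap.rTensor_tmul]
    induction codiag k H R R X using TensorProduct.induction_on with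
    | zero => simp
    | add x y hx hy => simp only [map_add, add_tmul, hx, hy]
    | tmul x y => simp
  have key : ∀ (X : E ⊗[k] R) (Y : H ⊗[k] H),
      LinearMap.lTensor (E ⊗[k] H) (smashCoact k H Coalgebra.comul)
        (mid (braid k H R H) (X ⊗ₜ Y)) =
      LinearMap.lTensor (E ⊗[k] H) (mid (braid k H R H)) (mid τ
        (LinearMap.lTensor E Coalgebra.comul X ⊗ₜ LinearMap.lTensor H Coalgebra.comul Y)) := by
    intro X Y
    induction X using TensorProduct.induction_on with
    | zero => simp
    | add x x' hx hy => simp only [map_add, add_tmul, hx, hy]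
    | tmul a c =>
    induction Y using TensorProduct.induction_on with
    | zero => simp
    | add x x' hx hy => simp only [map_add, tmul_add, hx, hy]
    | tmul x z =>
    simp only [mid_tmul, LinearMap.lTensor_tmul, hτ, ← hΔ, braid_tmul]
    generalize YetterDrinfeld.coact (k := k) (H := H) c = Z
    induction Z using TensorProduct.induction_on with
    | zero => simp
    | add x x' hx hy => simp only [map_add, hx, hy]
    | tmul p q => simp [smashCoact_tmul]
  rw [smashCoact_tmul, key, ← hρ, ← Coalgebra.coassoc_apply]
  generalize ρ e = X
  generalize Coalgebra.comul (R := k) h = Y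
  induction X using TensorProduct.induction_on with
  | zero => simp
  | add x x' hx hy => simp only [map_add, add_tmul, hx, hy]
  | tmul a c =>
  induction Y using TensorProduct.induction_on with
  | zero => simp
  | add x x' hx hy => simp only [map_add, tmul_add, hx, hy]
  | tmul x z =>
  simp only [LinearMap.rTensor_tmul, mid_tmul, braid_tmul]
  generalize hS : ρ a = S
  generalize hX : Coalgebra.comul (R := k) x = X
  trans (TensorProduct.assoc k (E ⊗[k] H) (R ⊗[k] H) (R ⊗[k] H))
    (TensorProduct.map (mid (braid k H R H) ∘ₗ TensorProduct.mk k _ _ S ∘ₗ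
      (LinearMap.mul k (H ⊗[k] H)).flip X) ((TensorProduct.mk k R H).flip z)
      (LinearMap.rTensor R Coalgebra.comul (YetterDrinfeld.coact (k := k) (H := H) c)))
  · generalize YetterDrinfeld.coact (k := k) (H := H) c = Z
    induction Z using TensorProduct.induction_on with
    | zero => simp
    | add x x' hx hy => simp only [map_add, hx, hy]
    | tmul p q => simp [smashCoact_tmul, Bialgebra.comul_mul, hS, hX]
  · rw [← LinearEquiv.symm_apply_eq _ |>.mpr (YetterDrinfeld.coassoc c).symm]
    clear hS hX
    induction S using TensorProduct.induction_on with
    | zero => simp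
    | add x x' hx hy =>
      simp only [map_add, add_tmul, LinearMap.comp_add, LinearMap.add_comp, LinearMap.add_apply,
        TensorProduct.map_add_left, hx, hy]
    | tmul s t =>
    induction X using TensorProduct.induction_on with
    | zero => simp
    | add x x' hx hy =>
      simp only [map_add, add_tmul, tmul_add, LinearMap.comp_add, LinearMap.add_comp,
        LinearMap.add_apply, TensorProduct.map_add_left, hx, hy]
    | tmul y y' =>
    simp only [TensorProduct.assoc_tmul, mid_tmul, hτ, codiag, LinearMap.comp_apply,
      TensorProduct.map_tmul, LinearEquiv.coe_coe]
    generalize YetterDrinfeld.coact (k := k) (H := H) c = Z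
    induction Z using TensorProduct.induction_on with
    | zero => simp
    | add x x' hx hy => simp only [map_add, tmul_add, hx, hy]
    | tmul p q =>
    simp only [LinearMap.lTensor_tmul]
    obtain ⟨T, hT⟩ := TensorProduct.exists_finset (YetterDrinfeld.coact (k := k) (H := H) t)
    obtain ⟨Q, hQ⟩ := TensorProduct.exists_finset (YetterDrinfeld.coact (k := k) (H := H) q)
    simp only [hT, hQ, map_sum, tmul_sum, sum_tmul, TensorProduct.assoc_symm_tmul,
      TensorProduct.map_tmul, LinearMap.comp_apply, TensorProduct.mk_apply, LinearMap.flip_apply,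
      LinearMap.mul_apply', Algebra.TensorProduct.tmul_mul_tmul, mid_tmul, braid_tmul,
      LinearMap.rTensor_tmul, AlgHom.toLinearMap_apply, Algebra.lsmul_coe, smul_eq_mul,
      TensorProduct.assoc_tmul, LinearMap.lTensor_tmul, TensorProduct.tensorTensorTensorComm_tmul,
      LinearMap.mul'_apply, mul_assoc]
    rw [Finset.sum_comm]

end

end Lemmas

section

variable (k : Type*) (H : Type*) (R : Type*) [Field k] [Ring H] [HopfAlgebra k H]
    [Ring R] [Algebra k R] [Coalgebra k R] [Module H R] [IsScalarTower k H R]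
    [YetterDrinfeld k H R]

/-- The bosonization `R # H`. Its underlying vector space is `R ⊗ H`. -/
def Bosonization (k : Type*) (H : Type*) (R : Type*) [Field k] [Ring H] [HopfAlgebra k H]
    [Ring R] [Algebra k R] : Type _ := R ⊗[k] H

namespace Bosonization

instance : AddCommGroup (Bosonization k H R) := inferInstanceAs (AddCommGroup (R ⊗[k] H))

instance : Module k (Bosonization k H R) := inferInstanceAs (Module k (R ⊗[k] H))

/-- The element `r ⊗ h` of `R # H`. -/
def tmul {k : Type*} {H : Type*} {R : Type*} [Field k] [Ring H] [HopfAlgebra k H]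
    [Ring R] [Algebra k R] (r : R) (h : H) : Bosonization k H R := r ⊗ₜ[k] h

instance : CoalgebraStruct k (Bosonization k H R) where
  comul := smashCoact k H (Coalgebra.comul (R := k) (A := R))
  counit := LinearMap.mul' k k ∘ₗ
    TensorProduct.map (Coalgebra.counit (R := k) (A := R)) (Coalgebra.counit (R := k) (A := H))

theorem comul_def : Coalgebra.comul (R := k) (A := Bosonization k H R) =
    smashCoact k H (Coalgebra.comul (R := k) (A := R)) := rfl

theorem counit_tmul (r : R) (h : H) : Coalgebra.counit (R := k) (tmul (k := k) r h) =
    Coalgebra.counit (R := k) r * Coalgebra.counit (R := k) h := rfl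

variable [YDHopf k H R]

instance : Ring (Bosonization k H R) :=
  { (inferInstance : AddCommGroup (Bosonization k H R)) with
    mul := fun x y => smashMul k H (LinearMap.mul' k R) (x ⊗ₜ[k] y)
    one := tmul 1 1
    left_distrib := (by simp [tmul_add] : ∀ x y z : R ⊗[k] H,
      smashMul k H (LinearMap.mul' k R) (x ⊗ₜ[k] (y + z)) =
        smashMul k H (LinearMap.mul' k R) (x ⊗ₜ[k] y) +
          smashMul k H (LinearMap.mul' k R) (x ⊗ₜ[k] z))
    right_distrib := (by simp [add_tmul] : ∀ x y z : R ⊗[k] H,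
      smashMul k H (LinearMap.mul' k R) ((x + y) ⊗ₜ[k] z) =
        smashMul k H (LinearMap.mul' k R) (x ⊗ₜ[k] z) +
          smashMul k H (LinearMap.mul' k R) (y ⊗ₜ[k] z))
    zero_mul := (by simp : ∀ x : R ⊗[k] H, smashMul k H (LinearMap.mul' k R) (0 ⊗ₜ[k] x) = 0)
    mul_zero := (by simp : ∀ x : R ⊗[k] H, smashMul k H (LinearMap.mul' k R) (x ⊗ₜ[k] 0) = 0)
    mul_assoc := smashMul_assoc _ (by simp [mul_assoc]) YDHopf.smul_mul
    one_mul := one_smashMul _ 1 (by simp)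
    mul_one := smashMul_one _ 1 (by simp) YDHopf.smul_one }

theorem mul_def (x y : Bosonization k H R) :
    x * y = smashMul k H (LinearMap.mul' k R) (x ⊗ₜ[k] y) := rfl

theorem one_def : (1 : Bosonization k H R) = tmul 1 1 := rfl

instance : Algebra k (Bosonization k H R) :=
  Algebra.ofModule
    (fun a => (fun x y => by rw [← smul_tmul', map_smul] : ∀ x y : R ⊗[k] H,
      smashMul k H (LinearMap.mul' k R) ((a • x) ⊗ₜ[k] y) =
        a • smashMul k H (LinearMap.mul' k R) (x ⊗ₜ[k] y)))
    (fun a => (fun x y => by rw [tmul_smul, map_smul] : ∀ x y : R ⊗[k] H,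
      smashMul k H (LinearMap.mul' k R) (x ⊗ₜ[k] (a • y)) =
        a • smashMul k H (LinearMap.mul' k R) (x ⊗ₜ[k] y)))

theorem counit_left (X : R ⊗[k] R) (Y : H ⊗[k] H) :
    LinearMap.rTensor (R ⊗[k] H) (LinearMap.mul' k k ∘ₗ TensorProduct.map
      (Coalgebra.counit (R := k) (A := R)) (Coalgebra.counit (R := k) (A := H)))
      (mid (braid k H R H) (X ⊗ₜ Y)) =
    TensorProduct.mk k k (R ⊗[k] H) 1
      (TensorProduct.lid k R (LinearMap.rTensor R Coalgebra.counit X) ⊗ₜ[k]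
        TensorProduct.lid k H (LinearMap.rTensor H Coalgebra.counit Y)) := by
  induction X using TensorProduct.induction_on with
  | zero => simp
  | add x x' hx hy => simp only [map_add, add_tmul, hx, hy]
  | tmul a c =>
  induction Y using TensorProduct.induction_on with
  | zero => simp
  | add x x' hx hy => simp only [map_add, tmul_add, hx, hy]
  | tmul x z =>
  have hc := YetterDrinfeld.counit_coact (k := k) (H := H) c
  obtain ⟨T, hT⟩ := TensorProduct.exists_finset (YetterDrinfeld.coact (k := k) (H := H) c)
  simp only [hT, map_sum, LinearMap.rTensor_tmul, TensorProduct.lid_tmul] at hc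
  simp only [mid_tmul, braid_tmul, hT, map_sum, LinearMap.rTensor_tmul, TensorProduct.map_tmul,
    LinearMap.comp_apply, TensorProduct.mk_apply, LinearMap.flip_apply, AlgHom.toLinearMap_apply,
    Algebra.lsmul_coe, smul_eq_mul, LinearMap.mul'_apply, Bialgebra.counit_mul,
    TensorProduct.lid_tmul]
  conv_rhs => rw [← hc]
  simp only [Finset.smul_sum, sum_tmul, tmul_sum]
  refine Finset.sum_congr rfl fun i _ => ?_
  simp only [smul_tmul', tmul_smul, smul_smul]
  rw [← mul_one (_ * _), ← smul_eq_mul, ← smul_tmul', ← tmul_smul, smul_tmul']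
  congr 3
  ring_nf

theorem counit_right (X : R ⊗[k] R) (Y : H ⊗[k] H) :
    LinearMap.lTensor (R ⊗[k] H) (LinearMap.mul' k k ∘ₗ TensorProduct.map
      (Coalgebra.counit (R := k) (A := R)) (Coalgebra.counit (R := k) (A := H)))
      (mid (braid k H R H) (X ⊗ₜ Y)) =
    (TensorProduct.mk k (R ⊗[k] H) k).flip 1
      (TensorProduct.rid k R (LinearMap.lTensor R Coalgebra.counit X) ⊗ₜ[k]
        TensorProduct.rid k H (LinearMap.lTensor H Coalgebra.counit Y)) := by
  induction X using TensorProduct.induction_on with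
  | zero => simp
  | add x x' hx hy => simp only [map_add, add_tmul, hx, hy]
  | tmul a c =>
  induction Y using TensorProduct.induction_on with
  | zero => simp
  | add x x' hx hy => simp only [map_add, tmul_add, hx, hy]
  | tmul x z =>
  have hc := congr(TensorProduct.rid k H $(YDHopf.counit_coact (k := k) (H := H) c))
  obtain ⟨T, hT⟩ := TensorProduct.exists_finset (YetterDrinfeld.coact (k := k) (H := H) c)
  simp only [hT, map_sum, LinearMap.lTensor_tmul, TensorProduct.rid_tmul] at hc
  simp only [mid_tmul, braid_tmul, hT, map_sum, LinearMap.rTensor_tmul, LinearMap.lTensor_tmul,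
    TensorProduct.map_tmul,
    LinearMap.comp_apply, TensorProduct.mk_apply, LinearMap.flip_apply, AlgHom.toLinearMap_apply,
    Algebra.lsmul_coe, smul_eq_mul, LinearMap.mul'_apply,
    TensorProduct.rid_tmul]
  have hc2 : (∑ i ∈ T, Coalgebra.counit (R := k) i.2 • i.1) * x =
    Coalgebra.counit (R := k) c • x := by rw [hc, smul_mul_assoc, one_mul]
  rw [smul_tmul, smul_smul, mul_comm, ← smul_smul, ← hc2, Finset.sum_mul]
  simp only [Finset.smul_sum, sum_tmul, tmul_sum]
  refine Finset.sum_congr rfl fun i _ => ?_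
  simp only [smul_tmul', tmul_smul, smul_smul, smul_mul_assoc]
  rw [mul_comm, show (Coalgebra.counit z * Coalgebra.counit i.2 : k) =
    (Coalgebra.counit z * Coalgebra.counit i.2 : k) • (1 : k) by simp, tmul_smul, smul_tmul']
  simp only [smul_tmul', smul_eq_mul, mul_one]

instance : Coalgebra k (Bosonization k H R) where
  coassoc := LinearMap.ext (smashCoact_coassoc (k := k) (H := H) (E := R) (R := R)
    Coalgebra.comul Coalgebra.coassoc_apply YDHopf.comul_coact)
  rTensor_counit_comp_comul := by
    refine TensorProduct.ext' fun r h => ?_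
    refine (counit_left k H R _ _).trans ?_
    simp; rfl
  lTensor_counit_comp_comul := by
    refine TensorProduct.ext' fun r h => ?_
    refine (counit_right k H R _ _).trans ?_
    simp; rfl

end Bosonization
end

namespace Bosonization

theorem quad {k : Type*} {H : Type*} [Field k] [Ring H] [HopfAlgebra k H] (h : H) : TensorProduct.assoc k H H (H ⊗[k] H)
    (TensorProduct.map Coalgebra.comul Coalgebra.comul (Coalgebra.comul (R := k) h)) =
    LinearMap.lTensor H ((TensorProduct.assoc k H H H).toLinearMap ∘ₗ
      LinearMap.rTensor H Coalgebra.comul) (LinearMap.lTensor H Coalgebra.comul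
        (Coalgebra.comul (R := k) h)) := by
  rw [← LinearMap.comp_apply (LinearMap.lTensor H _), ← LinearMap.lTensor_comp,
    LinearMap.comp_assoc, Coalgebra.coassoc, LinearMap.lTensor_comp, LinearMap.comp_apply,
    ← Coalgebra.coassoc_apply]
  generalize Coalgebra.comul (R := k) h = X
  induction X using TensorProduct.induction_on with
  | zero => simp
  | add x x' hx hy => simp only [map_add, hx, hy]
  | tmul a b =>
  simp only [TensorProduct.map_tmul, LinearMap.rTensor_tmul]
  generalize Coalgebra.comul (R := k) a = Y
  induction Y using TensorProduct.induction_on with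
  | zero => simp
  | add x x' hx hy => simp only [map_add, add_tmul, hx, hy]
  | tmul c d => simp

section

variable (k : Type*) (H : Type*) (R : Type*) [Field k] [Ring H] [HopfAlgebra k H]
    [Ring R] [Algebra k R] [Coalgebra k R] [Module H R] [IsScalarTower k H R]
    [YetterDrinfeld k H R]

/-- The factorwise multiplication of `(R # H) ⊗ (R # H)`. -/
def mulSq : ((R ⊗[k] H) ⊗[k] (R ⊗[k] H)) ⊗[k] ((R ⊗[k] H) ⊗[k] (R ⊗[k] H)) →ₗ[k]
    (R ⊗[k] H) ⊗[k] (R ⊗[k] H) :=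
  TensorProduct.map (smashMul k H (LinearMap.mul' k R)) (smashMul k H (LinearMap.mul' k R)) ∘ₗ
    (TensorProduct.tensorTensorTensorComm k (R ⊗[k] H) (R ⊗[k] H) (R ⊗[k] H)
      (R ⊗[k] H)).toLinearMap

theorem mulSq_tmul (a b c d : R ⊗[k] H) : mulSq k H R ((a ⊗ₜ b) ⊗ₜ (c ⊗ₜ d)) =
    smashMul k H (LinearMap.mul' k R) (a ⊗ₜ c) ⊗ₜ smashMul k H (LinearMap.mul' k R) (b ⊗ₜ d) := rfl

theorem coassoc_symm (c : R) : LinearMap.rTensor R Coalgebra.comul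
      (YetterDrinfeld.coact (k := k) (H := H) c) =
    (TensorProduct.assoc k H H R).symm (LinearMap.lTensor H YetterDrinfeld.coact
      (YetterDrinfeld.coact (k := k) c)) := by
  rw [LinearEquiv.eq_symm_apply, YetterDrinfeld.coassoc]

variable [YDHopf k H R]

theorem comul_mul_left_aux (X Y : R ⊗[k] R) (Z : H ⊗[k] H) :
    mid (braid k H R H) (braidedMul k H R (LinearMap.mul' k R) (X ⊗ₜ Y) ⊗ₜ Z) =
      mulSq k H R (mid (braid k H R H) (X ⊗ₜ (1 ⊗ₜ 1)) ⊗ₜ mid (braid k H R H) (Y ⊗ₜ Z)) := by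
  induction X using TensorProduct.induction_on with
  | zero => simp
  | add x x' hx hy => simp only [map_add, add_tmul, hx, hy]
  | tmul s t =>
  induction Y using TensorProduct.induction_on with
  | zero => simp
  | add x x' hx hy => simp only [map_add, tmul_add, add_tmul, hx, hy]
  | tmul s' t' =>
  induction Z using TensorProduct.induction_on with
  | zero => simp
  | add x x' hx hy => simp only [map_add, tmul_add, hx, hy]
  | tmul y y' =>
  obtain ⟨T, hT⟩ := TensorProduct.exists_finset (YetterDrinfeld.coact (k := k) (H := H) t')
  let J : (H ⊗[k] H) ⊗[k] R →ₗ[k] (R ⊗[k] H) ⊗[k] (R ⊗[k] H) :=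
    ∑ i ∈ T, TensorProduct.map (TensorProduct.map
      (LinearMap.mul k R s ∘ₗ (Algebra.lsmul k k R).toLinearMap.flip s')
      ((LinearMap.mul k H).flip (i.1 * y)))
      ((TensorProduct.mk k R H).flip y' ∘ₗ (LinearMap.mul k R).flip i.2)
  trans J (LinearMap.rTensor R Coalgebra.comul (YetterDrinfeld.coact (k := k) (H := H) t))
  · rw [coassoc_symm]
    simp only [braidedMul, LinearMap.comp_apply, mid_tmul, braid_tmul]
    generalize YetterDrinfeld.coact (k := k) (H := H) t = V
    induction V using TensorProduct.induction_on with
    | zero => simp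
    | add x x' hx hy => simp only [map_add, add_tmul, hx, hy]
    | tmul p q =>
    obtain ⟨Q, hQ⟩ := TensorProduct.exists_finset (YetterDrinfeld.coact (k := k) (H := H) q)
    have h1 := YDHopf.coact_mul (k := k) (H := H) (q ⊗ₜ[k] t')
    simp only [LinearMap.mul'_apply, codiag, LinearMap.comp_apply, TensorProduct.map_tmul, hT, hQ,
      sum_tmul, tmul_sum, map_sum, LinearEquiv.coe_coe,
      TensorProduct.tensorTensorTensorComm_tmul, LinearMap.rTensor_tmul, LinearMap.lTensor_tmul]
      at h1
    simp [h1, hQ, J, map_sum, tmul_sum, braid_tmul]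
    try rw [Finset.sum_comm]
  · simp only [mid_tmul, braid_tmul]
    generalize YetterDrinfeld.coact (k := k) (H := H) t = V
    induction V using TensorProduct.induction_on with
    | zero => simp
    | add x x' hx hy => simp only [map_add, add_tmul, hx, hy]
    | tmul p q =>
    simp only [hT, map_sum, tmul_sum, LinearMap.sum_apply, J, LinearMap.rTensor_tmul,
      TensorProduct.map_tmul, TensorProduct.mk_apply, LinearMap.flip_apply, mulSq_tmul,
      smashMul_tmul]
    refine Finset.sum_congr rfl fun i _ => ?_
    obtain ⟨Q, hQ⟩ := TensorProduct.exists_finset (Coalgebra.comul (R := k) p)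
    simp [hQ, map_sum, sum_tmul, Bialgebra.comul_one, Algebra.TensorProduct.one_def]

theorem comul_mul_left (r : R) (x : R ⊗[k] H) :
    smashCoact k H Coalgebra.comul (smashMul k H (LinearMap.mul' k R) ((r ⊗ₜ 1) ⊗ₜ x)) =
      mulSq k H R (smashCoact k H Coalgebra.comul (r ⊗ₜ 1) ⊗ₜ
        smashCoact k H Coalgebra.comul x) := by
  induction x using TensorProduct.induction_on with
  | zero => simp
  | add x x' hx hy => simp only [map_add, tmul_add, hx, hy]
  | tmul r' h' =>
  rw [smashCoact_tmul, smashCoact_tmul, Bialgebra.comul_one, Algebra.TensorProduct.one_def,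
    ← comul_mul_left_aux, ← YDHopf.comul_mul]
  simp [smashMul_tmul, Bialgebra.comul_one, Algebra.TensorProduct.one_def, smashCoact_tmul]

set_option maxHeartbeats 800000 in
theorem comul_mul_right (h : H) (x : R ⊗[k] H) :
    smashCoact k H Coalgebra.comul (smashMul k H (LinearMap.mul' k R) ((1 ⊗ₜ h) ⊗ₜ x)) =
      mulSq k H R (smashCoact k H Coalgebra.comul (1 ⊗ₜ h) ⊗ₜ
        smashCoact k H Coalgebra.comul x) := by
  induction x using TensorProduct.induction_on with
  | zero => simp
  | add x x' hx hy => simp only [map_add, tmul_add, hx, hy]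
  | tmul r' h' =>
  let A : R ⊗[k] R → H ⊗[k] H →ₗ[k] R ⊗[k] R := fun S =>
    TensorProduct.map (act k H R) (act k H R) ∘ₗ
    (TensorProduct.tensorTensorTensorComm k H H R R).toLinearMap ∘ₗ
    (TensorProduct.mk k (H ⊗[k] H) (R ⊗[k] R)).flip S
  have hA : ∀ S (a : H), diagAct k H R R a S = A S (Coalgebra.comul a) := fun _ _ => rfl
  have hA' : ∀ s t a b, A (s ⊗ₜ t) (a ⊗ₜ b) = (a • s) ⊗ₜ (b • t) := fun _ _ _ _ => rfl
  trans mid (braid k H R H) (TensorProduct.map (A (Coalgebra.comul r'))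
    ((LinearMap.mul k (H ⊗[k] H)).flip (Coalgebra.comul h'))
    (TensorProduct.map Coalgebra.comul Coalgebra.comul (Coalgebra.comul (R := k) h)))
  · rw [smashMul_tmul]
    generalize Coalgebra.comul (R := k) h = X
    induction X using TensorProduct.induction_on with
    | zero => simp
    | add x x' hx hy => simp only [map_add, hx, hy]
    | tmul a b => simp [smashCoact_tmul, YDHopf.comul_smul, hA, Bialgebra.comul_mul]
  have hX : smashCoact k H Coalgebra.comul ((1 : R) ⊗ₜ[k] h) = TensorProduct.map
      (TensorProduct.mk k R H 1) (TensorProduct.mk k R H 1) (Coalgebra.comul h) := by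
    rw [smashCoact_tmul, YDHopf.comul_one (k := k) (H := H)]
    generalize Coalgebra.comul (R := k) h = X
    induction X using TensorProduct.induction_on with
    | zero => simp
    | add x x' hx hy => simp only [map_add, tmul_add, hx, hy]
    | tmul a b => simp [braid_tmul, YDHopf.coact_one]
  rw [hX, smashCoact_tmul]
  generalize Coalgebra.comul (R := k) r' = S
  generalize Coalgebra.comul (R := k) h' = Y
  induction S using TensorProduct.induction_on with
  | zero => simp [A]
  | add x x' hx hy =>
    have : A (x + x') = A x + A x' := by simp [A, LinearMap.comp_add]
    simp only [map_add, add_tmul, tmul_add, ← hx, ← hy, this, TensorProduct.map_add_left,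
      LinearMap.add_apply]
  | tmul s' t' =>
  induction Y using TensorProduct.induction_on with
  | zero => simp
  | add x x' hx hy =>
    simp only [map_add, tmul_add, ← hx, ← hy, TensorProduct.map_add_right, LinearMap.add_apply]
  | tmul y y' =>
  let N1 : H ⊗[k] H →ₗ[k] H ⊗[k] R :=
    LinearMap.rTensor R (LinearMap.mul' k H) ∘ₗ
      (TensorProduct.assoc k H H R).symm.toLinearMap ∘ₗ
      LinearMap.lTensor H (TensorProduct.comm k R H).toLinearMap ∘ₗ
      (TensorProduct.assoc k H R H).toLinearMap ∘ₗ
      LinearMap.rTensor H YetterDrinfeld.coact ∘ₗ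
      LinearMap.rTensor H ((Algebra.lsmul k k R).toLinearMap.flip t')
  let N2 : H ⊗[k] H →ₗ[k] H ⊗[k] R :=
    TensorProduct.map (act k H H) (act k H R) ∘ₗ
    (TensorProduct.tensorTensorTensorComm k H H H R).toLinearMap ∘ₗ
    (TensorProduct.mk k (H ⊗[k] H) (H ⊗[k] R)).flip (YetterDrinfeld.coact t')
  have hN : N1 ∘ₗ Coalgebra.comul = N2 ∘ₗ Coalgebra.comul := by
    ext a
    have := YetterDrinfeld.compat (k := k) a t'
    simp only [LinearMap.comp_apply, twist_tmul] at this
    exact this.symm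
  let M : H ⊗[k] ((H ⊗[k] R) ⊗[k] H) →ₗ[k] (R ⊗[k] H) ⊗[k] (R ⊗[k] H) :=
    TensorProduct.map (TensorProduct.map ((Algebra.lsmul k k R).toLinearMap.flip s')
      ((LinearMap.mul k H).flip y)) (LinearMap.lTensor R ((LinearMap.mul k H).flip y')) ∘ₗ
      (TensorProduct.assoc k H H (R ⊗[k] H)).symm.toLinearMap ∘ₗ
      LinearMap.lTensor H (TensorProduct.assoc k H R H).toLinearMap
  let F : (H ⊗[k] H →ₗ[k] H ⊗[k] R) → H ⊗[k] (H ⊗[k] (H ⊗[k] H)) →ₗ[k]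
      (R ⊗[k] H) ⊗[k] (R ⊗[k] H) := fun N =>
    M ∘ₗ LinearMap.lTensor H (LinearMap.rTensor H N) ∘ₗ
      LinearMap.lTensor H (TensorProduct.assoc k H H H).symm.toLinearMap
  have hF : ∀ N, F N (TensorProduct.assoc k H H (H ⊗[k] H)
      (TensorProduct.map Coalgebra.comul Coalgebra.comul (Coalgebra.comul (R := k) h))) =
      M (LinearMap.lTensor H (LinearMap.rTensor H (N ∘ₗ Coalgebra.comul))
        (LinearMap.lTensor H Coalgebra.comul (Coalgebra.comul (R := k) h))) := by
    intro N
    rw [quad]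
    generalize LinearMap.lTensor H Coalgebra.comul (Coalgebra.comul (R := k) h) = W
    simp only [F, ← LinearMap.comp_apply, ← LinearMap.lTensor_comp, LinearMap.comp_assoc]
    congr 3
    ext a b
    simp
  trans F N1 (TensorProduct.assoc k H H (H ⊗[k] H)
      (TensorProduct.map Coalgebra.comul Coalgebra.comul (Coalgebra.comul (R := k) h)))
  · generalize TensorProduct.map Coalgebra.comul Coalgebra.comul (Coalgebra.comul (R := k) h) = W
    induction W using TensorProduct.induction_on with
    | zero => simp
    | add x x' hx hy => simp only [map_add, hx, hy]
    | tmul a b =>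
    induction a using TensorProduct.induction_on with
    | zero => simp
    | add x x' hx hy => simp only [map_add, add_tmul, hx, hy]
    | tmul a1 a2 =>
    induction b using TensorProduct.induction_on with
    | zero => simp
    | add x x' hx hy => simp only [map_add, tmul_add, hx, hy]
    | tmul b1 b2 =>
    obtain ⟨Q, hQ⟩ := TensorProduct.exists_finset
      (YetterDrinfeld.coact (k := k) (H := H) (a2 • t'))
    simp [hA', F, M, N1, braid_tmul, hQ, map_sum, sum_tmul, tmul_sum, mul_assoc]
  · rw [hF, hN, ← hF]
    generalize Coalgebra.comul (R := k) h = X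
    induction X using TensorProduct.induction_on with
    | zero => simp
    | add x x' hx hy => simp only [map_add, add_tmul, hx, hy]
    | tmul a b =>
    obtain ⟨Q, hQ⟩ := TensorProduct.exists_finset (YetterDrinfeld.coact (k := k) (H := H) t')
    obtain ⟨P1, hP1⟩ := TensorProduct.exists_finset (Coalgebra.comul (R := k) a)
    obtain ⟨P2, hP2⟩ := TensorProduct.exists_finset (Coalgebra.comul (R := k) b)
    have e1 : ∀ a1 a2 b1 b2, F N2 (TensorProduct.assoc k H H (H ⊗[k] H)
        ((a1 ⊗ₜ a2) ⊗ₜ (b1 ⊗ₜ b2))) = M (a1 ⊗ₜ (N2 (a2 ⊗ₜ b1) ⊗ₜ b2)) :=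
      fun _ _ _ _ => rfl
    have e2 : ∀ a2 b1, N2 (a2 ⊗ₜ b1) = ∑ i ∈ Q, (a2 * i.1) ⊗ₜ (b1 • i.2) := by
      intro a2 b1
      simp [N2, hQ]
    have e3 : ∀ a p q b, M (a ⊗ₜ ((p ⊗ₜ q) ⊗ₜ b)) =
        ((a • s') ⊗ₜ (p * y)) ⊗ₜ (q ⊗ₜ (b * y')) := fun _ _ _ _ => rfl
    clear_value F M N2
    have e4 : mid (braid k H R H) ((s' ⊗ₜ[k] t') ⊗ₜ[k] (y ⊗ₜ[k] y')) =
        ∑ i ∈ Q, (s' ⊗ₜ[k] (i.1 * y)) ⊗ₜ[k] (i.2 ⊗ₜ[k] y') := by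
      simp [braid_tmul, hQ]
    have e5 : ∀ (c : H) (P : Finset (H × H)), Coalgebra.comul (R := k) c = ∑ i ∈ P, i.1 ⊗ₜ i.2 →
        ∀ (e : R) (g : H), smashMul k H (LinearMap.mul' k R) ((1 ⊗ₜ c) ⊗ₜ (e ⊗ₜ g)) =
          ∑ i ∈ P, (i.1 • e) ⊗ₜ (i.2 * g) := by
      intro c P hc e g
      simp [smashMul_tmul, hc]
    simp only [TensorProduct.map_tmul, TensorProduct.mk_apply, e4, tmul_sum, map_sum, mulSq_tmul,
      e5 a P1 hP1, e5 b P2 hP2, hP1, hP2, sum_tmul, e1, e2, e3, mul_assoc]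
    conv_rhs => rw [Finset.sum_comm]
    refine Finset.sum_congr rfl fun i _ => ?_
    rw [Finset.sum_comm]

end

end Bosonization

namespace Bosonization

section

variable (k : Type*) (H : Type*) (R : Type*) [Field k] [Ring H] [HopfAlgebra k H]
    [Ring R] [Algebra k R] [Coalgebra k R] [Module H R] [IsScalarTower k H R]
    [YetterDrinfeld k H R] [YDHopf k H R]

theorem tensor_mul_eq (X Y : Bosonization k H R ⊗[k] Bosonization k H R) :
    X * Y = mulSq k H R (X ⊗ₜ[k] Y) := by
  have : LinearMap.mul k (Bosonization k H R ⊗[k] Bosonization k H R) =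
      TensorProduct.curry (mulSq k H R) := by
    refine TensorProduct.ext' fun a b => ?_
    refine TensorProduct.ext' fun c d => ?_
    exact Algebra.TensorProduct.tmul_mul_tmul a c b d
  exact congr($this X Y)

variable {k H R} in
@[elab_as_elim]
theorem induction {p : Bosonization k H R → Prop} (x : Bosonization k H R) (zero : p 0)
    (tmul : ∀ r h, p (tmul r h)) (add : ∀ x y, p x → p y → p (x + y)) : p x :=
  TensorProduct.induction_on x zero tmul add

theorem tmul_mul_tmul (r r' : R) (h h' : H) (P : Finset (H × H))
    (hP : Coalgebra.comul (R := k) h = ∑ i ∈ P, i.1 ⊗ₜ[k] i.2) :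
    (tmul r h * tmul r' h' : Bosonization k H R) =
      ∑ i ∈ P, (tmul (r * i.1 • r') (i.2 * h') : Bosonization k H R) := by
  change smashMul k H (LinearMap.mul' k R) ((r ⊗ₜ[k] h) ⊗ₜ[k] (r' ⊗ₜ[k] h')) =
    ∑ i ∈ P, (r * i.1 • r') ⊗ₜ[k] (i.2 * h')
  simp [smashMul_tmul, hP]

theorem tmul_mul_one_tmul (r : R) (h : H) :
    (tmul r 1 * tmul 1 h : Bosonization k H R) = tmul r h := by
  have := tmul_mul_tmul k H R r 1 1 h {(1, 1)} (by simp [Algebra.TensorProduct.one_def])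
  simpa using this

theorem comul_mul (x y : Bosonization k H R) : Coalgebra.comul (R := k) (x * y) =
    Coalgebra.comul (R := k) x * Coalgebra.comul (R := k) y := by
  induction x using Bosonization.induction with
  | zero => simp
  | add x x' hx hy => simp only [add_mul, map_add, hx, hy]
  | tmul r h =>
  have h1 : ∀ (r : R) (y : Bosonization k H R), Coalgebra.comul (R := k) (tmul r 1 * y) =
      Coalgebra.comul (R := k) (tmul r 1 : Bosonization k H R) * Coalgebra.comul (R := k) y := by
    intro r y
    rw [tensor_mul_eq]
    exact comul_mul_left k H R r y
  have h2 : ∀ (h : H) (y : Bosonization k H R), Coalgebra.comul (R := k) (tmul 1 h * y) =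
      Coalgebra.comul (R := k) (tmul 1 h : Bosonization k H R) * Coalgebra.comul (R := k) y := by
    intro h y
    rw [tensor_mul_eq]
    exact comul_mul_right k H R h y
  rw [← tmul_mul_one_tmul, mul_assoc, h1, h2, h1, mul_assoc]

theorem counit_mul (x y : Bosonization k H R) : Coalgebra.counit (R := k) (x * y) =
    Coalgebra.counit (R := k) x * Coalgebra.counit (R := k) y := by
  induction x using Bosonization.induction with
  | zero => simp
  | add x x' hx hy => simp only [add_mul, map_add, hx, hy]
  | tmul r h =>
  induction y using Bosonization.induction with
  | zero => simp
  | add x x' hx hy => simp only [mul_add, map_add, hx, hy]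
  | tmul r' h' =>
  obtain ⟨P, hP⟩ := TensorProduct.exists_finset (Coalgebra.comul (R := k) h)
  have h1 := congr(Coalgebra.counit (R := k) (TensorProduct.lid k H
    $(Coalgebra.rTensor_counit_comul (R := k) h)))
  simp only [hP, map_sum, LinearMap.rTensor_tmul, TensorProduct.lid_tmul, one_smul, map_smul,
    smul_eq_mul] at h1
  rw [tmul_mul_tmul k H R r r' h h' P hP, map_sum]
  simp only [counit_tmul, YDHopf.counit_mul (k := k) (H := H), YDHopf.counit_smul,
    Bialgebra.counit_mul]
  rw [← h1, Finset.mul_sum, Finset.sum_mul]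
  refine Finset.sum_congr rfl fun i _ => ?_
  ring

instance : Bialgebra k (Bosonization k H R) :=
  Bialgebra.mk' k (Bosonization k H R)
    (by
      rw [one_def, counit_tmul, YDHopf.counit_one (k := k) (H := H), Bialgebra.counit_one, one_mul])
    (counit_mul k H R _ _)
    (by
      change smashCoact k H Coalgebra.comul ((1 : R) ⊗ₜ[k] (1 : H)) =
        ((1 : R) ⊗ₜ[k] (1 : H)) ⊗ₜ[k] ((1 : R) ⊗ₜ[k] (1 : H))
      rw [smashCoact_tmul, YDHopf.comul_one (k := k) (H := H), Bialgebra.comul_one,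
        Algebra.TensorProduct.one_def]
      simp [braid_tmul, YDHopf.coact_one])
    (comul_mul k H R _ _)

/-- The inclusion `r ↦ r ⊗ 1`. -/
def inclR : R →ₐ[k] Bosonization k H R :=
  AlgHom.ofLinearMap ((TensorProduct.mk k R H).flip 1 : R →ₗ[k] R ⊗[k] H) rfl (by
    intro r s
    change tmul (r * s) 1 = (tmul r 1 * tmul s 1 : Bosonization k H R)
    rw [tmul_mul_tmul k H R r s 1 1 {(1, 1)} (by simp [Algebra.TensorProduct.one_def])]
    simp)

/-- The inclusion `h ↦ 1 ⊗ h`. -/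
def inclH : H →ₐ[k] Bosonization k H R :=
  AlgHom.ofLinearMap (TensorProduct.mk k R H 1 : H →ₗ[k] R ⊗[k] H) rfl (by
    intro g h
    change tmul 1 (g * h) = (tmul 1 g * tmul 1 h : Bosonization k H R)
    obtain ⟨P, hP⟩ := TensorProduct.exists_finset (Coalgebra.comul (R := k) g)
    have h1 := congr(TensorProduct.lid k H $(Coalgebra.rTensor_counit_comul (R := k) g))
    simp only [hP, map_sum, LinearMap.rTensor_tmul, TensorProduct.lid_tmul, one_smul] at h1
    rw [tmul_mul_tmul k H R 1 1 g h P hP]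
    change (1 : R) ⊗ₜ[k] (g * h) = ∑ i ∈ P, (1 * i.1 • (1 : R)) ⊗ₜ[k] (i.2 * h)
    simp only [YDHopf.smul_one (k := k), one_mul]
    rw [← h1, Finset.sum_mul, tmul_sum]
    refine Finset.sum_congr rfl fun i _ => ?_
    rw [smul_mul_assoc, tmul_smul, smul_tmul'])

/-- The projection `r ⊗ h ↦ ε h • r`. -/
def projR : Bosonization k H R →ₗc[k] R :=
  { toLinearMap := ((TensorProduct.rid k R).toLinearMap ∘ₗ
      LinearMap.lTensor R Coalgebra.counit : R ⊗[k] H →ₗ[k] R)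
    counit_comp := by
      refine TensorProduct.ext' fun r h => ?_
      change Coalgebra.counit (R := k) (Coalgebra.counit (R := k) h • r) =
        Coalgebra.counit (R := k) r * Coalgebra.counit (R := k) h
      rw [map_smul, smul_eq_mul, mul_comm]
    map_comp_comul := by
      refine TensorProduct.ext' fun r h => ?_
      change TensorProduct.map _ _ (mid (braid k H R H) (Coalgebra.comul r ⊗ₜ Coalgebra.comul h)) =
        Coalgebra.comul (R := k) (Coalgebra.counit (R := k) h • r)
      have h1 := congr(Coalgebra.counit (R := k) (TensorProduct.lid k H
        $(Coalgebra.rTensor_counit_comul (R := k) h)))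
      simp only [TensorProduct.lid_tmul, one_smul] at h1
      rw [← h1, map_smul]
      generalize Coalgebra.comul (R := k) r = X
      generalize Coalgebra.comul (R := k) h = Y
      induction X using TensorProduct.induction_on with
      | zero => simp
      | add x x' hx hy => simp only [map_add, add_tmul, smul_add, hx, hy]
      | tmul a c =>
      induction Y using TensorProduct.induction_on with
      | zero => simp
      | add x x' hx hy => simp only [map_add, tmul_add, add_smul, hx, hy]
      | tmul x z =>
      have hc := YetterDrinfeld.counit_coact (k := k) (H := H) c
      obtain ⟨T, hT⟩ := TensorProduct.exists_finset (YetterDrinfeld.coact (k := k) (H := H) c)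
      simp only [hT, map_sum, LinearMap.rTensor_tmul, TensorProduct.lid_tmul] at hc
      simp only [mid_tmul, braid_tmul, hT, map_sum, LinearMap.rTensor_tmul,
        TensorProduct.map_tmul, LinearMap.lTensor_tmul, LinearEquiv.coe_coe, TensorProduct.rid_tmul,
        LinearMap.comp_apply, TensorProduct.mk_apply, LinearMap.flip_apply,
        AlgHom.toLinearMap_apply, Algebra.lsmul_coe, smul_eq_mul, Bialgebra.counit_mul,
        TensorProduct.lid_tmul, map_smul]
      conv_rhs => rw [← hc]
      simp only [Finset.smul_sum, tmul_sum]
      refine Finset.sum_congr rfl fun i _ => ?_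
      simp only [← smul_tmul', tmul_smul, smul_smul]
      congr 1
      ring }

/-- The projection `r ⊗ h ↦ ε r • h`. -/
def projH : Bosonization k H R →ₗc[k] H :=
  { toLinearMap := ((TensorProduct.lid k H).toLinearMap ∘ₗ
      LinearMap.rTensor H Coalgebra.counit : R ⊗[k] H →ₗ[k] H)
    counit_comp := by
      refine TensorProduct.ext' fun r h => ?_
      change Coalgebra.counit (R := k) (Coalgebra.counit (R := k) r • h) =
        Coalgebra.counit (R := k) r * Coalgebra.counit (R := k) h
      rw [map_smul, smul_eq_mul]
    map_comp_comul := by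
      refine TensorProduct.ext' fun r h => ?_
      change TensorProduct.map _ _ (mid (braid k H R H) (Coalgebra.comul r ⊗ₜ Coalgebra.comul h)) =
        Coalgebra.comul (R := k) (Coalgebra.counit (R := k) r • h)
      have h1 := congr(Coalgebra.counit (R := k) (TensorProduct.lid k R
        $(Coalgebra.rTensor_counit_comul (R := k) r)))
      simp only [TensorProduct.lid_tmul, one_smul] at h1
      rw [← h1, map_smul]
      generalize Coalgebra.comul (R := k) r = X
      generalize Coalgebra.comul (R := k) h = Y
      induction X using TensorProduct.induction_on with
      | zero => simp
      | add x x' hx hy => simp only [map_add, add_tmul, add_smul, hx, hy]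
      | tmul a c =>
      induction Y using TensorProduct.induction_on with
      | zero => simp
      | add x x' hx hy => simp only [map_add, tmul_add, smul_add, hx, hy]
      | tmul x z =>
      have hc := congr(TensorProduct.rid k H $(YDHopf.counit_coact (k := k) (H := H) c))
      obtain ⟨T, hT⟩ := TensorProduct.exists_finset (YetterDrinfeld.coact (k := k) (H := H) c)
      simp only [hT, map_sum, LinearMap.lTensor_tmul, TensorProduct.rid_tmul] at hc
      have hc2 : (∑ i ∈ T, Coalgebra.counit (R := k) i.2 • i.1) * x =
        Coalgebra.counit (R := k) c • x := by rw [hc, smul_mul_assoc, one_mul]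
      simp only [mid_tmul, braid_tmul, hT, map_sum, LinearMap.rTensor_tmul,
        TensorProduct.map_tmul, LinearMap.lTensor_tmul, LinearEquiv.coe_coe,
        LinearMap.comp_apply, TensorProduct.mk_apply, LinearMap.flip_apply,
        AlgHom.toLinearMap_apply, Algebra.lsmul_coe, smul_eq_mul,
        TensorProduct.lid_tmul, map_smul]
      rw [mul_smul, smul_tmul' (Coalgebra.counit c : k), ← hc2]
      simp only [Finset.smul_sum, Finset.sum_mul, sum_tmul]
      refine Finset.sum_congr rfl fun i _ => ?_
      rw [smul_mul_assoc, ← smul_tmul' (M := H), ← smul_tmul' (M := H), tmul_smul] }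

theorem id_eq_conv : (WithConv.toConv (LinearMap.id (R := k) (M := Bosonization k H R))) =
    WithConv.toConv ((inclR k H R).toLinearMap ∘ₗ (projR k H R).toLinearMap) *
      WithConv.toConv ((inclH k H R).toLinearMap ∘ₗ (projH k H R).toLinearMap) := by
  apply WithConv.ofConv_injective
  refine TensorProduct.ext' fun r h => ?_
  change tmul r h = LinearMap.mul' k (Bosonization k H R) (TensorProduct.map _ _
    (mid (braid k H R H) (Coalgebra.comul r ⊗ₜ Coalgebra.comul h)))
  have hr : TensorProduct.rid k R (LinearMap.lTensor R Coalgebra.counit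
    (Coalgebra.comul (R := k) r)) = r := by simp
  have hh : TensorProduct.lid k H (LinearMap.rTensor H Coalgebra.counit
    (Coalgebra.comul (R := k) h)) = h := by simp
  trans tmul (TensorProduct.rid k R (LinearMap.lTensor R Coalgebra.counit
    (Coalgebra.comul (R := k) r))) (TensorProduct.lid k H (LinearMap.rTensor H Coalgebra.counit
    (Coalgebra.comul (R := k) h)))
  · rw [hr, hh]
  clear hr hh
  have t0 : ∀ h, (tmul 0 h : Bosonization k H R) = 0 := fun h => zero_tmul _ _
  have t0' : ∀ r, (tmul r 0 : Bosonization k H R) = 0 := fun h => tmul_zero _ _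
  have ta : ∀ r s h, (tmul (r + s) h : Bosonization k H R) = tmul r h + tmul s h :=
    fun _ _ _ => add_tmul _ _ _
  have ta' : ∀ r g h, (tmul r (g + h) : Bosonization k H R) = tmul r g + tmul r h :=
    fun _ _ _ => tmul_add _ _ _
  have ts : ∀ (a : k) r h, (tmul (a • r) h : Bosonization k H R) = a • tmul r h :=
    fun _ _ _ => rfl
  have ts' : ∀ (a : k) r h, (tmul r (a • h) : Bosonization k H R) = a • tmul r h :=
    fun a r h => tmul_smul (M := R) (N := H) a r h
  generalize Coalgebra.comul (R := k) r = X
  generalize Coalgebra.comul (R := k) h = Y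
  induction X using TensorProduct.induction_on with
  | zero => simp [t0]
  | add x x' hx hy => simp only [map_add, add_tmul, ta, hx, hy]
  | tmul a c =>
  induction Y using TensorProduct.induction_on with
  | zero => simp [t0']
  | add x x' hx hy => simp only [map_add, tmul_add, ta', hx, hy]
  | tmul x z =>
  have hc := congr(Coalgebra.counit (R := k)
    $(YetterDrinfeld.counit_coact (k := k) (H := H) c))
  obtain ⟨T, hT⟩ := TensorProduct.exists_finset (YetterDrinfeld.coact (k := k) (H := H) c)
  simp only [hT, map_sum, LinearMap.rTensor_tmul, TensorProduct.lid_tmul, map_smul,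
    smul_eq_mul] at hc
  simp only [mid_tmul, braid_tmul, hT, map_sum, LinearMap.rTensor_tmul,
    TensorProduct.map_tmul, TensorProduct.mk_apply, LinearMap.flip_apply,
    AlgHom.toLinearMap_apply, Algebra.lsmul_coe, smul_eq_mul]
  have e1 : ∀ r h, inclR k H R (projR k H R (tmul r h)) =
      Coalgebra.counit (R := k) h • tmul r 1 := fun _ _ => rfl
  have e2 : ∀ r h, inclH k H R (projH k H R (tmul r h)) =
      Coalgebra.counit (R := k) r • tmul 1 h := fun a b => ts' _ _ _
  trans ∑ i ∈ T, (inclR k H R (projR k H R (tmul a (i.1 * x)))) *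
    (inclH k H R (projH k H R (tmul i.2 z)))
  · simp only [e1, e2, smul_mul_smul_comm, tmul_mul_one_tmul, Bialgebra.counit_mul,
      LinearMap.lTensor_tmul, TensorProduct.rid_tmul, TensorProduct.lid_tmul, ts, ts', smul_smul,
      ← Finset.sum_smul]
    congr 1
    rw [← hc, Finset.sum_mul]
    exact Finset.sum_congr rfl fun _ _ => by ring
  · rfl

/-- The antipode of `R # H`. -/
def antipodeAux : WithConv (Bosonization k H R →ₗ[k] Bosonization k H R) :=
  WithConv.toConv ((inclH k H R).toLinearMap ∘ₗ HopfAlgebra.antipode k ∘ₗ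
    (projH k H R).toLinearMap) *
  WithConv.toConv ((inclR k H R).toLinearMap ∘ₗ YDHopf.antipode (k := k) (H := H) ∘ₗ
    (projR k H R).toLinearMap)

theorem conv_sandwich {A C A' C' : Type*} [Ring A] [Algebra k A] [AddCommGroup C] [Module k C]
    [Coalgebra k C] [Ring A'] [Algebra k A'] [AddCommGroup C'] [Module k C'] [Coalgebra k C']
    (i : A →ₐ[k] A') (p : C' →ₗc[k] C) (f g : C →ₗ[k] A)
    (h : WithConv.toConv f * WithConv.toConv g = 1) :
    WithConv.toConv (i.toLinearMap ∘ₗ f ∘ₗ p.toLinearMap) *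
      WithConv.toConv (i.toLinearMap ∘ₗ g ∘ₗ p.toLinearMap) = 1 := by
  have h1 := LinearMap.convMul_comp_coalgHom_distrib (WithConv.toConv f) (WithConv.toConv g) p
  have h2 := LinearMap.algHom_comp_convMul_distrib i (WithConv.toConv (f ∘ₗ p.toLinearMap))
    (WithConv.toConv (g ∘ₗ p.toLinearMap))
  apply WithConv.ofConv_injective
  refine h2.symm.trans ?_
  refine (congrArg (fun x => i.toLinearMap ∘ₗ x) h1.symm).trans ?_
  rw [h]
  ext c
  simp [LinearMap.convOne_def]

theorem conv_R_left :
    WithConv.toConv ((inclR k H R).toLinearMap ∘ₗ YDHopf.antipode (k := k) (H := H) ∘ₗ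
      (projR k H R).toLinearMap) *
    WithConv.toConv ((inclR k H R).toLinearMap ∘ₗ (projR k H R).toLinearMap) = 1 := by
  refine conv_sandwich k (inclR k H R) (projR k H R) (YDHopf.antipode (k := k) (H := H))
    LinearMap.id ?_
  apply WithConv.ofConv_injective
  ext c
  refine ((YDHopf.antipode_inv (k := k) (H := H) (R := R)).left c).trans ?_
  simp [LinearMap.convOne_def, Algebra.algebraMap_eq_smul_one]

theorem conv_R_right :
    WithConv.toConv ((inclR k H R).toLinearMap ∘ₗ (projR k H R).toLinearMap) *
    WithConv.toConv ((inclR k H R).toLinearMap ∘ₗ YDHopf.antipode (k := k) (H := H) ∘ₗ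
      (projR k H R).toLinearMap) = 1 := by
  refine conv_sandwich k (inclR k H R) (projR k H R) LinearMap.id
    (YDHopf.antipode (k := k) (H := H)) ?_
  apply WithConv.ofConv_injective
  ext c
  refine ((YDHopf.antipode_inv (k := k) (H := H) (R := R)).right c).trans ?_
  simp [LinearMap.convOne_def, Algebra.algebraMap_eq_smul_one]

theorem conv_H_left :
    WithConv.toConv ((inclH k H R).toLinearMap ∘ₗ HopfAlgebra.antipode k ∘ₗ
      (projH k H R).toLinearMap) *
    WithConv.toConv ((inclH k H R).toLinearMap ∘ₗ (projH k H R).toLinearMap) = 1 :=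
  conv_sandwich k (inclH k H R) (projH k H R) (HopfAlgebra.antipode k) LinearMap.id
    LinearMap.antipode_mul_id

theorem conv_H_right :
    WithConv.toConv ((inclH k H R).toLinearMap ∘ₗ (projH k H R).toLinearMap) *
    WithConv.toConv ((inclH k H R).toLinearMap ∘ₗ HopfAlgebra.antipode k ∘ₗ
      (projH k H R).toLinearMap) = 1 :=
  conv_sandwich k (inclH k H R) (projH k H R) LinearMap.id (HopfAlgebra.antipode k)
    LinearMap.id_mul_antipode

theorem antipodeAux_mul : antipodeAux k H R * WithConv.toConv LinearMap.id = 1 := by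
  rw [id_eq_conv, antipodeAux, mul_assoc, ← mul_assoc (WithConv.toConv ((inclR k H R).toLinearMap ∘ₗ
      YDHopf.antipode (k := k) (H := H) ∘ₗ (projR k H R).toLinearMap)),
    conv_R_left, one_mul, conv_H_left]

theorem mul_antipodeAux : WithConv.toConv LinearMap.id * antipodeAux k H R = 1 := by
  rw [id_eq_conv, antipodeAux, mul_assoc, ← mul_assoc (WithConv.toConv
    ((inclH k H R).toLinearMap ∘ₗ (projH k H R).toLinearMap)),
    conv_H_right, one_mul, conv_R_right]

instance : HopfAlgebra k (Bosonization k H R) where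
  antipode := (antipodeAux k H R).ofConv
  mul_antipode_rTensor_comul := congrArg WithConv.ofConv (antipodeAux_mul k H R)
  mul_antipode_lTensor_comul := congrArg WithConv.ofConv (mul_antipodeAux k H R)

end

end Bosonization

/-! Two-cocycles. -/

section Classical

variable (k : Type*) (A : Type*) [Field k] [Ring A] [Bialgebra k A]

/-- The map `x ⊗ y ↦ σ(x₍₁₎, y₍₁₎) x₍₂₎ y₍₂₎`. -/
def crossedMul (σ : A ⊗[k] A →ₗ[k] k) : A ⊗[k] A →ₗ[k] A :=
  (TensorProduct.lid k A).toLinearMap ∘ₗ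
    TensorProduct.map σ (LinearMap.mul' k A) ∘ₗ Coalgebra.comul

/-- `Z(A)`: the normalized convolution invertible maps `σ : A ⊗ A → k` such that
`σ(x₍₁₎, y₍₁₎) σ(x₍₂₎ y₍₂₎, z) = σ(y₍₁₎, z₍₁₎) σ(x, y₍₂₎ z₍₂₎)`. -/
structure IsCocycle (σ : A ⊗[k] A →ₗ[k] k) : Prop where
  invertible : ∃ σ' : A ⊗[k] A →ₗ[k] k,
    IsConvInverse Coalgebra.comul Coalgebra.counit (LinearMap.mul' k k) 1 σ σ'
  cocycle : ∀ x y z : A,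
    σ (crossedMul k A σ (x ⊗ₜ y) ⊗ₜ z) = σ (x ⊗ₜ crossedMul k A σ (y ⊗ₜ z))
  normalized : σ (1 ⊗ₜ 1) = 1

end Classical

section Braided

variable (k : Type*) (H : Type*) (R : Type*) [Field k] [Ring H] [HopfAlgebra k H]
  [Ring R] [Algebra k R] [Coalgebra k R] [Module H R] [IsScalarTower k H R]
  [YetterDrinfeld k H R]

/-- The map `x ⊗ y ↦ π((x ⊗ y)₍₁₎) m((x ⊗ y)₍₂₎)`, for the braided comultiplication of `R ⊗ R` and
the multiplication `m` of `R`. -/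
def braidedCrossedMul (π : R ⊗[k] R →ₗ[k] k) : R ⊗[k] R →ₗ[k] R :=
  (TensorProduct.lid k R).toLinearMap ∘ₗ
    TensorProduct.map π (LinearMap.mul' k R) ∘ₗ comulSq k H R

/-- `Z(R)`: the normalized `H`-linear two-cocycles `π : R ⊗ R → k`, convolution invertible among the
`H`-linear maps, for the braided comultiplication of `R ⊗ R`. -/
structure IsBraidedCocycle (π : R ⊗[k] R →ₗ[k] k) : Prop where
  linear : ∀ (h : H) x, π (diagAct k H R R h x) = Coalgebra.counit (R := k) h * π x
  invertible : ∃ π' : R ⊗[k] R →ₗ[k] k,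
    (∀ (h : H) x, π' (diagAct k H R R h x) = Coalgebra.counit (R := k) h * π' x) ∧
    IsConvInverse (comulSq k H R) (counitSq k R) (LinearMap.mul' k k) 1 π π'
  cocycle : ∀ x y z : R, π (braidedCrossedMul k H R π (x ⊗ₜ y) ⊗ₜ z) =
    π (x ⊗ₜ braidedCrossedMul k H R π (y ⊗ₜ z))
  normalized : π (1 ⊗ₜ 1) = 1

end Braided

/-! Cleft objects with a section. Isomorphism is an equivalence relation already on the underlying
data, so the isomorphism classes of cleft objects with a section form a subset of the classes of
data, and maps between them can be given on data. The carrier of a cleft object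
over `A` is isomorphic to `A` as a vector space, so it may be taken in the universe of `A`. -/

/-- The data of an `A`-comodule algebra together with a map from `A` to it. -/
structure CleftData (k : Type u) (A : Type v) [Field k] [Ring A] [Bialgebra k A] where
  carrier : Type v
  [addCommGroup : AddCommGroup carrier]
  [module : Module k carrier]
  mul : carrier ⊗[k] carrier →ₗ[k] carrier
  one : carrier
  coact : carrier →ₗ[k] carrier ⊗[k] A
  sec : A →ₗ[k] carrier

attribute [instance] CleftData.addCommGroup CleftData.module

namespace CleftData

variable {k : Type u} {A : Type v} [Field k] [Ring A] [Bialgebra k A]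

/-- `X` is an `A`-cleft object with section `X.sec`: an associative unital algebra, with
a multiplicative and unital right `A`-coaction whose coinvariants are `k`, and a convolution
invertible colinear map `A → X` that is normalized, `1 ↦ 1`. -/
structure IsCleft (X : CleftData k A) : Prop where
  mul_assoc : ∀ a b c, X.mul (X.mul (a ⊗ₜ b) ⊗ₜ c) = X.mul (a ⊗ₜ X.mul (b ⊗ₜ c))
  one_mul : ∀ a, X.mul (X.one ⊗ₜ a) = a
  mul_one : ∀ a, X.mul (a ⊗ₜ X.one) = a
  coassoc : ∀ a, TensorProduct.assoc k X.carrier A A (LinearMap.rTensor A X.coact (X.coact a)) =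
    LinearMap.lTensor X.carrier Coalgebra.comul (X.coact a)
  counit_coact : ∀ a,
    TensorProduct.rid k X.carrier (LinearMap.lTensor X.carrier Coalgebra.counit (X.coact a)) = a
  coact_mul : ∀ a b, X.coact (X.mul (a ⊗ₜ b)) =
    TensorProduct.map X.mul (LinearMap.mul' k A)
      (TensorProduct.tensorTensorTensorComm k X.carrier A X.carrier A (X.coact a ⊗ₜ X.coact b))
  coact_one : X.coact X.one = X.one ⊗ₜ 1
  one_ne_zero : X.one ≠ 0
  coinvariants : ∀ a, X.coact a = a ⊗ₜ 1 ↔ ∃ c : k, a = c • X.one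
  sec_coact : ∀ x, X.coact (X.sec x) = LinearMap.rTensor A X.sec (Coalgebra.comul x)
  sec_one : X.sec 1 = X.one
  sec_invertible : ∃ g : A →ₗ[k] X.carrier,
    IsConvInverse Coalgebra.comul Coalgebra.counit X.mul X.one X.sec g

/-- A linear isomorphism compatible with the multiplications, units, coactions and sections. -/
def Iso (X Y : CleftData k A) : Prop :=
  ∃ e : X.carrier ≃ₗ[k] Y.carrier,
    (∀ a b, e (X.mul (a ⊗ₜ b)) = Y.mul (e a ⊗ₜ e b)) ∧ e X.one = Y.one ∧
    (∀ a, Y.coact (e a) = LinearMap.rTensor A e.toLinearMap (X.coact a)) ∧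
    ∀ x, e (X.sec x) = Y.sec x

variable (k A) in
instance setoid : Setoid (CleftData k A) where
  r := Iso
  iseqv :=
    { refl := fun X => ⟨LinearEquiv.refl k _, by simp⟩
      symm := by
        rintro X Y ⟨e, h1, h2, h3, h4⟩
        refine ⟨e.symm, fun a b => ?_, ?_, fun a => ?_, fun x => ?_⟩
        · rw [LinearEquiv.symm_apply_eq, h1]; simp
        · rw [LinearEquiv.symm_apply_eq, h2]
        · obtain ⟨b, rfl⟩ := e.surjective a
          rw [h3, e.symm_apply_apply, ← LinearMap.comp_apply, ← LinearMap.rTensor_comp]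
          simp
        · rw [LinearEquiv.symm_apply_eq, h4]
      trans := by
        rintro X Y Z ⟨e, h1, h2, h3, h4⟩ ⟨f, h1', h2', h3', h4'⟩
        refine ⟨e.trans f, fun a b => ?_, ?_, fun a => ?_, fun x => ?_⟩
        · simp [h1, h1']
        · simp [h2, h2']
        · rw [LinearEquiv.trans_apply, h3', h3, ← LinearMap.comp_apply, ← LinearMap.rTensor_comp]
          rfl
        · simp [h4, h4'] }

end CleftData

/-- The data of an `R`-comodule algebra in the category of `H`-modules together with a map from `R`
to it. -/
structure BraidedCleftData (k : Type u) (H : Type v) (R : Type w) [Field k] [Ring H]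
    [HopfAlgebra k H] [Ring R] [Algebra k R] where
  carrier : Type w
  [addCommGroup : AddCommGroup carrier]
  [module : Module k carrier]
  [hmodule : Module H carrier]
  [isScalarTower : IsScalarTower k H carrier]
  mul : carrier ⊗[k] carrier →ₗ[k] carrier
  one : carrier
  coact : carrier →ₗ[k] carrier ⊗[k] R
  sec : R →ₗ[k] carrier

attribute [instance] BraidedCleftData.addCommGroup BraidedCleftData.module
  BraidedCleftData.hmodule BraidedCleftData.isScalarTower

namespace BraidedCleftData

variable {k : Type u} {H : Type v} {R : Type w} [Field k] [Ring H] [HopfAlgebra k H]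
  [Ring R] [Algebra k R]

/-- An `H`-linear isomorphism compatible with the multiplications, units, coactions and sections. -/
def Iso (X Y : BraidedCleftData k H R) : Prop :=
  ∃ e : X.carrier ≃ₗ[k] Y.carrier,
    (∀ (h : H) a, e (h • a) = h • e a) ∧
    (∀ a b, e (X.mul (a ⊗ₜ b)) = Y.mul (e a ⊗ₜ e b)) ∧ e X.one = Y.one ∧
    (∀ a, Y.coact (e a) = LinearMap.rTensor R e.toLinearMap (X.coact a)) ∧
    ∀ x, e (X.sec x) = Y.sec x

variable (k H R) in
instance setoid : Setoid (BraidedCleftData k H R) where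
  r := Iso
  iseqv :=
    { refl := fun X => ⟨LinearEquiv.refl k _, by simp⟩
      symm := by
        rintro X Y ⟨e, h0, h1, h2, h3, h4⟩
        refine ⟨e.symm, fun h a => ?_, fun a b => ?_, ?_, fun a => ?_, fun x => ?_⟩
        · rw [LinearEquiv.symm_apply_eq, h0]; simp
        · rw [LinearEquiv.symm_apply_eq, h1]; simp
        · rw [LinearEquiv.symm_apply_eq, h2]
        · obtain ⟨b, rfl⟩ := e.surjective a
          rw [h3, e.symm_apply_apply, ← LinearMap.comp_apply, ← LinearMap.rTensor_comp]
          simp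
        · rw [LinearEquiv.symm_apply_eq, h4]
      trans := by
        rintro X Y Z ⟨e, h0, h1, h2, h3, h4⟩ ⟨f, h0', h1', h2', h3', h4'⟩
        refine ⟨e.trans f, fun h a => ?_, fun a b => ?_, ?_, fun a => ?_, fun x => ?_⟩
        · simp [h0, h0']
        · simp [h1, h1']
        · simp [h2, h2']
        · rw [LinearEquiv.trans_apply, h3', h3, ← LinearMap.comp_apply, ← LinearMap.rTensor_comp]
          rfl
        · simp [h4, h4'] }

variable [Coalgebra k R] [Module H R] [IsScalarTower k H R] [YetterDrinfeld k H R]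

/-- `X` is an `R`-cleft object in the category of `H`-modules with section `X.sec`:
all maps are `H`-linear, `X` is an associative unital algebra, with a unital right `R`-coaction
that is multiplicative for the braided multiplication of `X ⊗ R`, whose coinvariants
are `k`, and the map `R → X` is colinear, convolution invertible among the `H`-linear maps, and
normalized, `1 ↦ 1`. -/
structure IsCleft (X : BraidedCleftData k H R) : Prop where
  smul_mul : ∀ (h : H) x, h • X.mul x = X.mul (diagAct k H X.carrier X.carrier h x)
  smul_one : ∀ h : H, h • X.one = Coalgebra.counit (R := k) h • X.one
  coact_smul : ∀ (h : H) a, X.coact (h • a) = diagAct k H X.carrier R h (X.coact a)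
  sec_smul : ∀ (h : H) x, X.sec (h • x) = h • X.sec x
  mul_assoc : ∀ a b c, X.mul (X.mul (a ⊗ₜ b) ⊗ₜ c) = X.mul (a ⊗ₜ X.mul (b ⊗ₜ c))
  one_mul : ∀ a, X.mul (X.one ⊗ₜ a) = a
  mul_one : ∀ a, X.mul (a ⊗ₜ X.one) = a
  coassoc : ∀ a, TensorProduct.assoc k X.carrier R R (LinearMap.rTensor R X.coact (X.coact a)) =
    LinearMap.lTensor X.carrier Coalgebra.comul (X.coact a)
  counit_coact : ∀ a,
    TensorProduct.rid k X.carrier (LinearMap.lTensor X.carrier Coalgebra.counit (X.coact a)) = a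
  coact_mul : ∀ a b, X.coact (X.mul (a ⊗ₜ b)) = braidedMul k H R X.mul (X.coact a ⊗ₜ X.coact b)
  coact_one : X.coact X.one = X.one ⊗ₜ 1
  one_ne_zero : X.one ≠ 0
  coinvariants : ∀ a, X.coact a = a ⊗ₜ 1 ↔ ∃ c : k, a = c • X.one
  sec_coact : ∀ x, X.coact (X.sec x) = LinearMap.rTensor R X.sec (Coalgebra.comul x)
  sec_one : X.sec 1 = X.one
  sec_invertible : ∃ g : R →ₗ[k] X.carrier, (∀ (h : H) x, g (h • x) = h • g x) ∧
    IsConvInverse Coalgebra.comul Coalgebra.counit X.mul X.one X.sec g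

variable [YDHopf k H R]

/-- The smash product `X # H` with coaction
`e ⊗ h ↦ (e₍₀₎ ⊗ e₍₁₎₍₋₁₎ h₍₁₎) ⊗ (e₍₁₎₍₀₎ ⊗ h₍₂₎)` and section `γ ⊗ id`. -/
def smash (X : BraidedCleftData k H R) : CleftData k (Bosonization k H R) where
  carrier := X.carrier ⊗[k] H
  mul := smashMul k H X.mul
  one := X.one ⊗ₜ 1
  coact := (smashCoact k H X.coact : X.carrier ⊗[k] H →ₗ[k] (X.carrier ⊗[k] H) ⊗[k] (R ⊗[k] H))
  sec := (LinearMap.rTensor H X.sec : R ⊗[k] H →ₗ[k] X.carrier ⊗[k] H)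

theorem smash_iso (X Y : BraidedCleftData k H R) (hXY : X ≈ Y) : smash X ≈ smash Y := by
  obtain ⟨e, h0, h1, h2, h3, h4⟩ := hXY
  refine ⟨TensorProduct.congr e (LinearEquiv.refl k H), fun a b => ?_, ?_, fun a => ?_,
    fun x => ?_⟩
  · change X.carrier ⊗[k] H at a
    change X.carrier ⊗[k] H at b
    change TensorProduct.congr e (LinearEquiv.refl k H) (smashMul k H X.mul (a ⊗ₜ b)) =
      smashMul k H Y.mul (TensorProduct.congr e (LinearEquiv.refl k H) a ⊗ₜ
        TensorProduct.congr e (LinearEquiv.refl k H) b)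
    induction a using TensorProduct.induction_on with
    | zero => simp
    | add x x' hx hy => simp only [map_add, add_tmul, hx, hy]
    | tmul a g =>
    induction b using TensorProduct.induction_on with
    | zero => simp
    | add x x' hx hy => simp only [map_add, tmul_add, hx, hy]
    | tmul b g' =>
    simp only [TensorProduct.congr_tmul, smashMul_tmul, LinearEquiv.refl_apply]
    generalize Coalgebra.comul (R := k) g = Z
    induction Z using TensorProduct.induction_on with
    | zero => simp
    | add x x' hx hy => simp only [map_add, hx, hy]
    | tmul p q => simp [h0, h1]
  · change TensorProduct.congr e (LinearEquiv.refl k H) (X.one ⊗ₜ 1) = Y.one ⊗ₜ 1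
    simp [h2]
  · change X.carrier ⊗[k] H at a
    change smashCoact k H Y.coact (TensorProduct.congr e (LinearEquiv.refl k H) a) =
      LinearMap.rTensor (R ⊗[k] H) (TensorProduct.congr e (LinearEquiv.refl k H)).toLinearMap
        (smashCoact k H X.coact a)
    induction a using TensorProduct.induction_on with
    | zero => simp
    | add x x' hx hy => simp only [map_add, hx, hy]
    | tmul a g =>
    simp only [TensorProduct.congr_tmul, smashCoact_tmul, h3, LinearEquiv.refl_apply]
    generalize X.coact a = U
    generalize Coalgebra.comul (R := k) g = Z
    induction U using TensorProduct.induction_on with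
    | zero => simp
    | add x x' hx hy => simp only [map_add, add_tmul, hx, hy]
    | tmul c d =>
    induction Z using TensorProduct.induction_on with
    | zero => simp
    | add x x' hx hy => simp only [map_add, tmul_add, hx, hy]
    | tmul p q =>
    simp only [LinearMap.rTensor_tmul, mid_tmul]
    generalize braid k H R H (d ⊗ₜ p) = V
    induction V using TensorProduct.induction_on with
    | zero => simp
    | add x x' hx hy => simp only [map_add, hx, hy]
    | tmul p q => simp
  · change R ⊗[k] H at x
    change TensorProduct.congr e (LinearEquiv.refl k H) (LinearMap.rTensor H X.sec x) =
      LinearMap.rTensor H Y.sec x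
    induction x using TensorProduct.induction_on with
    | zero => simp
    | add x x' hx hy => simp only [map_add, hx, hy]
    | tmul p q => simp [h4]

end BraidedCleftData

section Main

variable (k : Type u) (H : Type v) (R : Type w) [Field k] [Ring H] [HopfAlgebra k H]
  [Ring R] [Algebra k R] [Coalgebra k R] [Module H R] [IsScalarTower k H R]
  [YetterDrinfeld k H R]

/-- `C(R)`: isomorphism classes of `R`-cleft objects with a section. -/
def BraidedCleftClasses : Set (Quotient (BraidedCleftData.setoid k H R)) :=
  {c | ∃ X : BraidedCleftData k H R, X.IsCleft ∧ ⟦X⟧ = c}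

/-- `C(A)`: isomorphism classes of `A`-cleft objects with a section. -/
def CleftClasses (k : Type u) (A : Type v) [Field k] [Ring A] [Bialgebra k A] :
    Set (Quotient (CleftData.setoid k A)) :=
  {c | ∃ X : CleftData k A, X.IsCleft ∧ ⟦X⟧ = c}

/-- The class of `(k #_π R, id)`. -/
def braidedAlpha (π : R ⊗[k] R →ₗ[k] k) : Quotient (BraidedCleftData.setoid k H R) :=
  ⟦{ carrier := R
     mul := braidedCrossedMul k H R π
     one := 1
     coact := Coalgebra.comul
     sec := LinearMap.id }⟧

/-- The class of `(k #_σ A, id)`. -/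
def alpha (k : Type u) (A : Type v) [Field k] [Ring A] [Bialgebra k A] (σ : A ⊗[k] A →ₗ[k] k) :
    Quotient (CleftData.setoid k A) :=
  ⟦{ carrier := A
     mul := crossedMul k A σ
     one := 1
     coact := Coalgebra.comul
     sec := LinearMap.id }⟧

variable [YDHopf k H R]

/-- `Z'(R # H)`: the cocycles such that `σ(r ⊗ h, r' ⊗ h') = σ(r ⊗ 1, h • r' ⊗ 1) ε(h')`. -/
def CocyclesPrime : Set (Bosonization k H R ⊗[k] Bosonization k H R →ₗ[k] k) :=
  {σ | IsCocycle k (Bosonization k H R) σ ∧ ∀ (r r' : R) (h h' : H),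
    σ (Bosonization.tmul r h ⊗ₜ Bosonization.tmul r' h') =
      σ (Bosonization.tmul r 1 ⊗ₜ Bosonization.tmul (h • r') 1) * Coalgebra.counit (R := k) h'}

/-- `C'(R # H)`: the classes of cleft objects with a section `γ` such that
`γ((1 ⊗ h)(r ⊗ h')(1 ⊗ h'')) = γ(1 ⊗ h) γ(r ⊗ h') γ(1 ⊗ h'')`. -/
def CleftClassesPrime : Set (Quotient (CleftData.setoid k (Bosonization k H R))) :=
  {c | ∃ X : CleftData k (Bosonization k H R), X.IsCleft ∧
    (∀ (r : R) (h h' h'' : H),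
      X.sec (Bosonization.tmul 1 h * Bosonization.tmul r h' * Bosonization.tmul 1 h'') =
        X.mul (X.mul (X.sec (Bosonization.tmul 1 h) ⊗ₜ X.sec (Bosonization.tmul r h')) ⊗ₜ
          X.sec (Bosonization.tmul 1 h''))) ∧ ⟦X⟧ = c}

/-- `Φ(π)(r ⊗ h, r' ⊗ h') = π(r, h • r') ε(h')`. -/
def Phi (π : R ⊗[k] R →ₗ[k] k) : Bosonization k H R ⊗[k] Bosonization k H R →ₗ[k] k :=
  (π ∘ₗ LinearMap.lTensor R (act k H R ∘ₗ LinearMap.lTensor H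
      ((TensorProduct.rid k R).toLinearMap ∘ₗ LinearMap.lTensor R Coalgebra.counit)) ∘ₗ
    (TensorProduct.assoc k R H (R ⊗[k] H)).toLinearMap :
      (R ⊗[k] H) ⊗[k] (R ⊗[k] H) →ₗ[k] k)

theorem Phi_tmul (π : R ⊗[k] R →ₗ[k] k) (r r' : R) (h h' : H) :
    Phi k H R π (Bosonization.tmul r h ⊗ₜ Bosonization.tmul r' h') =
      π (r ⊗ₜ (h • r')) * Coalgebra.counit (R := k) h' := by
  change π (r ⊗ₜ (h • (Coalgebra.counit (R := k) h' • r'))) = _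
  rw [smul_comm, tmul_smul, map_smul, smul_eq_mul, mul_comm]

/-- `Ψ[(X, γ)] = [(X # H, γ ⊗ id)]`. -/
def Psi : Quotient (BraidedCleftData.setoid k H R) →
    Quotient (CleftData.setoid k (Bosonization k H R)) :=
  Quotient.map BraidedCleftData.smash BraidedCleftData.smash_iso

end Main

end

end YDCleft

/-! The core is the commutative square `Ψ ∘ α_R = α ∘ Φ`, with `α` taken over `R # H`. It commutes
because the product of `R # H` deformed by `Φ(π)` is the smash product of `H` with `R` deformed by
`π` (`crossedMul_Phi`). Once `Φ`, `α_R` and `α` on `Z'` are known to be bijections, `Ψ` is one too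
(`Psi_bijOn`); that `X # H` is cleft need not be checked directly.

Both maps `α` are handled by one argument, in which the flip or the braiding is a parameter `τ`. A
map `γ : C → B` into a unital associative algebra is convolution invertible exactly when its Galois
map `b ⊗ c ↦ b γ(c₍₁₎) ⊗ c₍₂₎` is bijective (`gal_bijective`, `exists_isConvInverse`). For a cleft
object this, together with the triviality of the coinvariants, makes the section bijective
(`section_bijective`), so the product of the object can be transported to a product `m'` on `A`.
Colinearity forces `m'(x, y) = σ(x₍₁₎, y₍₁₎) x₍₂₎ y₍₂₎` (up to `τ`) with `σ = ε ∘ m'`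
(`exists_deform`). The Galois map of `m'` is that of the undeformed product, bijective because of
the antipode, composed with `c ↦ σ(c₍₁₎) c₍₂₎` (`gal_deform`). Read in one direction, this shows
that a deformation by an invertible cocycle is cleft; in the other, that the functional of a cleft
object is invertible. Injectivity of `α` holds because the counit of the deformed product is the
functional.

For `Φ`, one has `Φ(π) = π ∘ fold`, where `fold` is a surjective coalgebra map from the ordinary
square of `R # H` to the braided square of `R` (`comul_fold`). It transports the coalgebra axioms
and convolution inverses. A functional comes from `R ⊗ R` when it is balanced over `H` in the middle
and right invariant (`Phi_restrictR`). Linearity of `π` over `H` is left invariance of `Φ(π)`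
(`Phi_mul_left_iff`), and for a cocycle this follows from the cocycle identity
(`IsCocycle.inclH_mul`). The same invariances say that products with `1 ⊗ h` are not deformed, which
is the condition defining `C'`. -/

namespace YDCleft

noncomputable section

/-! ### Galois maps and convolution inverses -/

section Galois

variable {k : Type*} [Field k] {B C D : Type*} [AddCommGroup B] [Module k B]
  [AddCommGroup C] [Module k C] [AddCommGroup D] [Module k D]
  (m : B ⊗[k] B →ₗ[k] B) (u : B) (f g : C →ₗ[k] B)

theorem convProd_comp {ΔC : C →ₗ[k] C ⊗[k] C} {ΔD : D →ₗ[k] D ⊗[k] D} (φ : D →ₗ[k] C)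
    (hΔ : ∀ d, TensorProduct.map φ φ (ΔD d) = ΔC (φ d)) (d : D) :
    convProd ΔD m (f ∘ₗ φ) (g ∘ₗ φ) d = convProd ΔC m f g (φ d) := by
  simp only [convProd, LinearMap.comp_apply, TensorProduct.map_comp, hΔ]

variable {m u f g} in
-- Convolution is natural in the coalgebra. The comultiplications are explicit maps, not instances,
-- so that the braided comultiplication of `R ⊗ R` is covered.
theorem IsConvInverse.comp {ΔC : C →ₗ[k] C ⊗[k] C} {εC : C →ₗ[k] k}
    {ΔD : D →ₗ[k] D ⊗[k] D} {εD : D →ₗ[k] k} (h : IsConvInverse ΔC εC m u f g) (φ : D →ₗ[k] C)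
    (hΔ : ∀ d, TensorProduct.map φ φ (ΔD d) = ΔC (φ d)) (hε : ∀ d, εC (φ d) = εD d) :
    IsConvInverse ΔD εD m u (f ∘ₗ φ) (g ∘ₗ φ) :=
  ⟨fun d => by rw [convProd_comp m f g φ hΔ, ← hε, h.right],
    fun d => by rw [convProd_comp m g f φ hΔ, ← hε, h.left]⟩

variable [Coalgebra k C] [Coalgebra k D]

/-- The Galois map `b ⊗ c ↦ b f(c₍₁₎) ⊗ c₍₂₎` of `f : C → B`, where `m` is the multiplication
of `B`. -/
def gal (m : B ⊗[k] B →ₗ[k] B) (f : C →ₗ[k] B) : B ⊗[k] C →ₗ[k] B ⊗[k] C :=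
  LinearMap.rTensor C m ∘ₗ (TensorProduct.assoc k B B C).symm.toLinearMap ∘ₗ
    LinearMap.lTensor B (LinearMap.rTensor C f ∘ₗ Coalgebra.comul)

theorem gal_tmul (b : B) (c : C) :
    gal m f (b ⊗ₜ c) =
      LinearMap.rTensor C (m ∘ₗ TensorProduct.mk k B B b ∘ₗ f) (Coalgebra.comul c) := by
  simp only [gal, LinearMap.comp_apply, LinearMap.lTensor_tmul]
  generalize Coalgebra.comul (R := k) c = X
  induction X using TensorProduct.induction_on with
  | zero => simp
  | add x y hx hy => simp only [map_add, tmul_add, hx, hy]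
  | tmul x y => simp

/-- By coassociativity both sides are `b f(c₍₁₎) g(c₍₂₎) ⊗ c₍₃₎`. Thus `gal` turns convolution into
composition, in reversed order, and invertibility becomes a question about linear endomorphisms. -/
theorem gal_gal (hm : ∀ a b c, m (m (a ⊗ₜ b) ⊗ₜ c) = m (a ⊗ₜ m (b ⊗ₜ c))) (x : B ⊗[k] C) :
    gal m g (gal m f x) = gal m (convProd Coalgebra.comul m f g) x := by
  induction x using TensorProduct.induction_on with
  | zero => simp
  | add x y hx hy => simp only [map_add, hx, hy]
  | tmul b c =>
  let F : (C ⊗[k] C) ⊗[k] C →ₗ[k] B ⊗[k] C :=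
    LinearMap.rTensor C (m ∘ₗ TensorProduct.mk k B B b ∘ₗ m ∘ₗ TensorProduct.map f g)
  trans F ((TensorProduct.assoc k C C C).symm
    (LinearMap.lTensor C Coalgebra.comul (Coalgebra.comul c)))
  · rw [gal_tmul]
    generalize Coalgebra.comul (R := k) c = X
    induction X using TensorProduct.induction_on with
    | zero => simp
    | add x y hx hy => simp only [map_add, hx, hy]
    | tmul x y =>
    simp only [LinearMap.rTensor_tmul, gal_tmul, LinearMap.lTensor_tmul]
    generalize Coalgebra.comul (R := k) y = Y
    induction Y using TensorProduct.induction_on with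
    | zero => simp
    | add x y hx hy => simp only [map_add, tmul_add, hx, hy]
    | tmul y z => simp [F, hm]
  · rw [Coalgebra.coassoc_symm_apply, gal_tmul, ← LinearMap.comp_apply, ← LinearMap.rTensor_comp]
    rfl

theorem gal_counit (hu : ∀ b, m (b ⊗ₜ u) = b) (hf : ∀ c, f c = Coalgebra.counit (R := k) c • u)
    (x : B ⊗[k] C) : gal m f x = x := by
  induction x using TensorProduct.induction_on with
  | zero => simp
  | add x y hx hy => simp only [map_add, hx, hy]
  | tmul b c =>
  have : m ∘ₗ TensorProduct.mk k B B b ∘ₗ f =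
      LinearMap.toSpanSingleton k B b ∘ₗ Coalgebra.counit := by
    ext c
    simp [hf, hu]
  rw [gal_tmul, this, LinearMap.rTensor_comp, LinearMap.comp_apply,
    Coalgebra.rTensor_counit_comul]
  simp

/-- The Galois map loses no information: applying the counit to its value at `u ⊗ c` gives back the
original map. -/
theorem counit_gal (hu : ∀ b, m (u ⊗ₜ b) = b) (c : C) :
    TensorProduct.rid k B (LinearMap.lTensor B Coalgebra.counit (gal m f (u ⊗ₜ c))) = f c := by
  have : m ∘ₗ TensorProduct.mk k B B u ∘ₗ f = f := by
    ext c
    simp [hu]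
  rw [gal_tmul, this, ← LinearMap.comp_apply, LinearMap.lTensor_comp_rTensor,
    ← LinearMap.rTensor_comp_lTensor, LinearMap.comp_apply, Coalgebra.lTensor_counit_comul]
  simp

theorem gal_injective_of_conv (hm : ∀ a b c, m (m (a ⊗ₜ b) ⊗ₜ c) = m (a ⊗ₜ m (b ⊗ₜ c)))
    (hu : ∀ b, m (b ⊗ₜ u) = b)
    (h : ∀ c, convProd Coalgebra.comul m f g c = Coalgebra.counit (R := k) c • u) :
    Function.LeftInverse (gal m g) (gal m f) := fun x => by
  rw [gal_gal m f g hm, gal_counit m u _ hu h]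

theorem gal_bijective (hm : ∀ a b c, m (m (a ⊗ₜ b) ⊗ₜ c) = m (a ⊗ₜ m (b ⊗ₜ c)))
    (hu : ∀ b, m (b ⊗ₜ u) = b)
    (h : IsConvInverse Coalgebra.comul Coalgebra.counit m u f g) :
    Function.Bijective (gal m f) :=
  ⟨(gal_injective_of_conv m u f g hm hu h.right).injective,
    (gal_injective_of_conv m u g f hm hu h.left).surjective⟩

variable {m u f g} in
-- The Galois maps of `g` and `g'` both invert the bijection `gal m f`, and `counit_gal` recovers
-- `g` and `g'` from them.
theorem IsConvInverse.unique
    (hm : ∀ a b c, m (m (a ⊗ₜ b) ⊗ₜ c) = m (a ⊗ₜ m (b ⊗ₜ c)))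
    (hu : ∀ b, m (b ⊗ₜ u) = b) (hu' : ∀ b, m (u ⊗ₜ b) = b) {g' : C →ₗ[k] B}
    (h : IsConvInverse Coalgebra.comul Coalgebra.counit m u f g)
    (h' : IsConvInverse Coalgebra.comul Coalgebra.counit m u f g') : g = g' := by
  ext c
  rw [← counit_gal m u g hu', ← counit_gal m u g' hu']
  congr 2
  obtain ⟨y, hy⟩ := (gal_bijective m u f g hm hu h).2 (u ⊗ₜ c)
  rw [← hy, gal_injective_of_conv m u f g hm hu h.right,
    gal_injective_of_conv m u f g' hm hu h'.right]

theorem gal_left (hm : ∀ a b c, m (m (a ⊗ₜ b) ⊗ₜ c) = m (a ⊗ₜ m (b ⊗ₜ c))) (b : B)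
    (x : B ⊗[k] C) : gal m f (LinearMap.rTensor C (m ∘ₗ TensorProduct.mk k B B b) x) =
      LinearMap.rTensor C (m ∘ₗ TensorProduct.mk k B B b) (gal m f x) := by
  induction x using TensorProduct.induction_on with
  | zero => simp
  | add x y hx hy => simp only [map_add, hx, hy]
  | tmul b' c =>
  rw [LinearMap.rTensor_tmul, gal_tmul, gal_tmul, ← LinearMap.rTensor_comp_apply]
  congr 2
  ext c
  simp [hm]

/-- Only the first leg of `c` is fed to `f`, so the right coaction of `C` on the last leg is
respected, by coassociativity. -/
theorem gal_colinear (x : B ⊗[k] C) : LinearMap.lTensor B Coalgebra.comul (gal m f x) =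
    TensorProduct.assoc k B C C (LinearMap.rTensor C (gal m f)
      ((TensorProduct.assoc k B C C).symm (LinearMap.lTensor B Coalgebra.comul x))) := by
  induction x using TensorProduct.induction_on with
  | zero => simp
  | add x y hx hy => simp only [map_add, hx, hy]
  | tmul b c =>
  rw [gal_tmul, LinearMap.lTensor_tmul]
  trans LinearMap.rTensor (C ⊗[k] C) (m ∘ₗ TensorProduct.mk k B B b ∘ₗ f)
    (LinearMap.lTensor C Coalgebra.comul (Coalgebra.comul c))
  · rw [← LinearMap.comp_apply (LinearMap.lTensor B _), LinearMap.lTensor_comp_rTensor,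
      ← LinearMap.rTensor_comp_lTensor, LinearMap.comp_apply]
  rw [← Coalgebra.coassoc_apply]
  generalize Coalgebra.comul (R := k) c = X
  induction X using TensorProduct.induction_on with
  | zero => simp
  | add x y hx hy => simp only [map_add, tmul_add, hx, hy]
  | tmul x y =>
  simp only [LinearMap.rTensor_tmul, TensorProduct.assoc_symm_tmul, gal_tmul]
  generalize Coalgebra.comul (R := k) x = X
  induction X using TensorProduct.induction_on with
  | zero => simp
  | add x y hx hy => simp only [map_add, add_tmul, hx, hy]
  | tmul x y => simp

/-- The inverse of a bijective Galois map is colinear, hence on `u ⊗ C` it is itself a Galois map,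
namely that of `g(c) = (id ⊗ ε)((gal f)⁻¹(u ⊗ c))`. Left linearity over `B` extends this to all of
`B ⊗ C`. -/
theorem exists_isConvInverse (hm : ∀ a b c, m (m (a ⊗ₜ b) ⊗ₜ c) = m (a ⊗ₜ m (b ⊗ₜ c)))
    (hu : ∀ b, m (b ⊗ₜ u) = b) (hu' : ∀ b, m (u ⊗ₜ b) = b)
    (h : Function.Bijective (gal m f)) :
    ∃ g, IsConvInverse Coalgebra.comul Coalgebra.counit m u f g := by
  let e := LinearEquiv.ofBijective (gal m f) h
  have he : ∀ x, gal m f (e.symm x) = x := e.apply_symm_apply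
  let g : C →ₗ[k] B := (TensorProduct.rid k B).toLinearMap ∘ₗ
    LinearMap.lTensor B Coalgebra.counit ∘ₗ e.symm.toLinearMap ∘ₗ TensorProduct.mk k B C u
  -- The inverse `e.symm` inherits colinearity from `gal m f`; applying the counit to the middle leg
  -- of that identity yields the claim.
  have h1 : ∀ c, gal m g (u ⊗ₜ c) = e.symm (u ⊗ₜ c) := by
    intro c
    have h2 := gal_colinear m f (e.symm (u ⊗ₜ c))
    rw [he, LinearMap.lTensor_tmul, ← LinearEquiv.symm_apply_eq] at h2
    have h3 : LinearMap.rTensor C e.symm.toLinearMap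
        ((TensorProduct.assoc k B C C).symm (u ⊗ₜ[k] Coalgebra.comul (R := k) c)) =
        (TensorProduct.assoc k B C C).symm
          (LinearMap.lTensor B Coalgebra.comul (e.symm (u ⊗ₜ c))) := by
      rw [h2, ← LinearMap.comp_apply (LinearMap.rTensor C _), ← LinearMap.rTensor_comp]
      have : e.symm.toLinearMap ∘ₗ gal m f = LinearMap.id :=
        LinearMap.ext fun x => e.symm_apply_apply x
      rw [this, LinearMap.rTensor_id, LinearMap.id_apply]
    have h4 := congr(LinearMap.rTensor C ((TensorProduct.rid k B).toLinearMap ∘ₗ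
      LinearMap.lTensor B Coalgebra.counit) $h3)
    trans LinearMap.rTensor C ((TensorProduct.rid k B).toLinearMap ∘ₗ
      LinearMap.lTensor B Coalgebra.counit) (LinearMap.rTensor C e.symm.toLinearMap
        ((TensorProduct.assoc k B C C).symm (u ⊗ₜ[k] Coalgebra.comul (R := k) c)))
    · have : m ∘ₗ TensorProduct.mk k B B u ∘ₗ g = g := by
        ext c
        simp [hu']
      rw [gal_tmul, this]
      generalize Coalgebra.comul (R := k) c = X
      induction X using TensorProduct.induction_on with
      | zero => simp
      | add x y hx hy => simp only [map_add, tmul_add, hx, hy]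
      | tmul x y => simp [g]
    rw [h4]
    generalize e.symm (u ⊗ₜ c) = Y
    induction Y using TensorProduct.induction_on with
    | zero => simp
    | add x y hx hy => simp only [map_add, hx, hy]
    | tmul b c =>
    have hc := congr(b ⊗ₜ[k] TensorProduct.lid k C $(Coalgebra.rTensor_counit_comul (R := k) c))
    rw [TensorProduct.lid_tmul, one_smul] at hc
    refine Eq.trans ?_ hc
    rw [LinearMap.lTensor_tmul]
    generalize Coalgebra.comul (R := k) c = X
    induction X using TensorProduct.induction_on with
    | zero => simp
    | add x y hx hy => simp only [map_add, tmul_add, hx, hy]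
    | tmul x y => simp [smul_tmul']
  have h2 : Function.RightInverse (gal m g) (gal m f) := by
    intro x
    induction x using TensorProduct.induction_on with
    | zero => simp
    | add x y hx hy => simp only [map_add, hx, hy]
    | tmul b c =>
    have : b ⊗ₜ[k] c = LinearMap.rTensor C (m ∘ₗ TensorProduct.mk k B B b) (u ⊗ₜ c) := by
      simp [hu]
    rw [this, gal_left m g hm, h1, gal_left m f hm, he]
  have h3 : Function.LeftInverse (gal m g) (gal m f) := h2.leftInverse_of_injective h.1
  refine ⟨g, fun c => ?_, fun c => ?_⟩
  · rw [← counit_gal m u (convProd _ m f g) hu', ← gal_gal m f g hm, h3]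
    simp
  · rw [← counit_gal m u (convProd _ m g f) hu', ← gal_gal m g f hm, h2]
    simp

/-- If two coalgebra maps agree after composition with a functional `f`, then they agree after
composition with its convolution inverse. -/
theorem IsConvInverse.comp_eq_comp {f g : C →ₗ[k] k}
    (h : IsConvInverse Coalgebra.comul Coalgebra.counit (LinearMap.mul' k k) 1 f g)
    (φ ψ : D →ₗc[k] C) (hf : ∀ d, f (φ d) = f (ψ d)) (d : D) : g (φ d) = g (ψ d) := by
  have h1 := h.comp (ΔD := Coalgebra.comul) (εD := Coalgebra.counit) φ.toLinearMap
    (fun d => CoalgHomClass.map_comp_comul_apply φ d) (fun d => CoalgHomClass.counit_comp_apply φ d)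
  have h2 := h.comp (ΔD := Coalgebra.comul) (εD := Coalgebra.counit) ψ.toLinearMap
    (fun d => CoalgHomClass.map_comp_comul_apply ψ d) (fun d => CoalgHomClass.counit_comp_apply ψ d)
  -- With this, `g ∘ φ` and `g ∘ ψ` are convolution inverses of one functional, so they coincide by
  -- uniqueness.
  have h3 : f ∘ₗ φ.toLinearMap = f ∘ₗ ψ.toLinearMap := LinearMap.ext hf
  rw [← h3] at h2
  exact congr($(h1.unique (by simp [mul_assoc]) (by simp) (by simp) h2) d)

/-- A functional is convolution invertible if `c ↦ σ(c₍₁₎) c₍₂₎` is bijective. -/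
theorem functional_exists_isConvInverse (σ : C →ₗ[k] k)
    (h : Function.Bijective ((TensorProduct.lid k C).toLinearMap ∘ₗ LinearMap.rTensor C σ ∘ₗ
      Coalgebra.comul)) :
    ∃ g, IsConvInverse Coalgebra.comul Coalgebra.counit (LinearMap.mul' k k) 1 σ g := by
  refine exists_isConvInverse (LinearMap.mul' k k) 1 σ (by simp [mul_assoc]) (by simp) (by simp) ?_
  -- For `B = k`, the identification `k ⊗ C ≅ C` turns the Galois map into `c ↦ σ(c₍₁₎) c₍₂₎`.
  have h1 : gal (LinearMap.mul' k k) σ = (TensorProduct.lid k C).symm.toLinearMap ∘ₗ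
      ((TensorProduct.lid k C).toLinearMap ∘ₗ LinearMap.rTensor C σ ∘ₗ
      Coalgebra.comul) ∘ₗ (TensorProduct.lid k C).toLinearMap := by
    ext c
    have : LinearMap.mul' k k ∘ₗ TensorProduct.mk k k k 1 = LinearMap.id := by ext; simp
    simp [gal_tmul, ← LinearMap.comp_assoc, this]
  rw [h1]
  exact (TensorProduct.lid k C).symm.bijective.comp (h.comp (TensorProduct.lid k C).bijective)

theorem functional_bijective {σ g : C →ₗ[k] k}
    (h : IsConvInverse Coalgebra.comul Coalgebra.counit (LinearMap.mul' k k) 1 σ g) :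
    Function.Bijective ((TensorProduct.lid k C).toLinearMap ∘ₗ LinearMap.rTensor C σ ∘ₗ
      Coalgebra.comul) := by
  have h1 : (TensorProduct.lid k C).toLinearMap ∘ₗ LinearMap.rTensor C σ ∘ₗ Coalgebra.comul =
      (TensorProduct.lid k C).toLinearMap ∘ₗ gal (LinearMap.mul' k k) σ ∘ₗ
        (TensorProduct.lid k C).symm.toLinearMap := by
    ext c
    have : LinearMap.mul' k k ∘ₗ TensorProduct.mk k k k 1 = LinearMap.id := by ext; simp
    simp [gal_tmul, ← LinearMap.comp_assoc, this]
  rw [h1]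
  exact (TensorProduct.lid k C).bijective.comp
    ((gal_bijective _ 1 σ g (by simp [mul_assoc]) (by simp) h).comp
      (TensorProduct.lid k C).symm.bijective)

end Galois

/-! ### Bijectivity of the section of a cleft object -/

section Section

variable {k : Type*} [Field k] {A E : Type*} [Ring A] [Algebra k A] [Coalgebra k A]
  [AddCommGroup E] [Module k E]

theorem eq_zero_of_tmul_eq_zero {V W : Type*} [AddCommGroup V] [Module k V] [AddCommGroup W]
    [Module k W] {v : V} {w : W} (hv : v ≠ 0) (h : v ⊗ₜ[k] w = 0) : w = 0 := by
  by_contra hw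
  refine hv ((Module.forall_dual_apply_eq_zero_iff k v).mp fun φ => ?_)
  have := congr(TensorProduct.lid k W (LinearMap.rTensor W φ $h))
  simpa [hw] using this

/-- The section of a cleft object is bijective. -/
theorem section_bijective (τ : A ⊗[k] E →ₗ[k] E ⊗[k] A) (m : E ⊗[k] E →ₗ[k] E) (u : E)
    (ρ : E →ₗ[k] E ⊗[k] A) (γ g : A →ₗ[k] E)
    (hm : ∀ a b c, m (m (a ⊗ₜ b) ⊗ₜ c) = m (a ⊗ₜ m (b ⊗ₜ c)))
    (hu' : ∀ b, m (u ⊗ₜ b) = b) (hu : ∀ b, m (b ⊗ₜ u) = b)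
    (hτ : ∀ a, τ (1 ⊗ₜ a) = a ⊗ₜ 1) (hτ' : ∀ r, τ (r ⊗ₜ u) = u ⊗ₜ r)
    (hM : ∀ x y z : E ⊗[k] A, (TensorProduct.map m (LinearMap.mul' k A) ∘ₗ mid τ)
      ((TensorProduct.map m (LinearMap.mul' k A) ∘ₗ mid τ) (x ⊗ₜ y) ⊗ₜ z) =
      (TensorProduct.map m (LinearMap.mul' k A) ∘ₗ mid τ)
        (x ⊗ₜ (TensorProduct.map m (LinearMap.mul' k A) ∘ₗ mid τ) (y ⊗ₜ z)))
    (hρ : ∀ a, TensorProduct.assoc k E A A (LinearMap.rTensor A ρ (ρ a)) =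
      LinearMap.lTensor E Coalgebra.comul (ρ a))
    (hε : ∀ a, TensorProduct.rid k E (LinearMap.lTensor E Coalgebra.counit (ρ a)) = a)
    (hρm : ∀ a b, ρ (m (a ⊗ₜ b)) =
      (TensorProduct.map m (LinearMap.mul' k A) ∘ₗ mid τ) (ρ a ⊗ₜ ρ b))
    (hρu : ρ u = u ⊗ₜ 1) (hne : u ≠ 0) (hco : ∀ a, ρ a = a ⊗ₜ 1 ↔ ∃ c : k, a = c • u)
    (hγ : ∀ x, ρ (γ x) = LinearMap.rTensor A γ (Coalgebra.comul x))
    (h : IsConvInverse Coalgebra.comul Coalgebra.counit m u γ g) : Function.Bijective γ := by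
  have hT : Function.Bijective (gal m γ) := gal_bijective m u γ g hm hu h
  -- This is colinearity of `γ`. It gives injectivity at once: if `γ a = 0`, then `u ⊗ a = 0`
  -- because the Galois map is injective.
  have hTu : ∀ a, gal m γ (u ⊗ₜ a) = ρ (γ a) := by
    intro a
    have : m ∘ₗ TensorProduct.mk k E E u ∘ₗ γ = γ := by
      ext c
      simp [hu']
    rw [gal_tmul, this, hγ]
  constructor
  · refine (injective_iff_map_eq_zero γ).mpr fun a ha => ?_
    have h1 : u ⊗ₜ[k] a = 0 := hT.1 (by rw [hTu, ha, map_zero, map_zero])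
    exact eq_zero_of_tmul_eq_zero hne h1
  intro e
  set M := TensorProduct.map m (LinearMap.mul' k A) ∘ₗ mid τ with hMdef
  -- Since `ρ` is multiplicative for the twisted product `M` on `E ⊗ A`, the map `ρ ∘ g` is a right
  -- convolution inverse of `ρ ∘ γ`.
  have hT' : Function.Injective (gal M (ρ ∘ₗ γ)) := by
    refine (gal_injective_of_conv M (u ⊗ₜ 1) (ρ ∘ₗ γ) (ρ ∘ₗ g) hM (fun x => ?_)
      (fun c => ?_)).injective
    · induction x using TensorProduct.induction_on with
      | zero => simp
      | add x y hx hy => simp only [map_add, add_tmul, hx, hy]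
      | tmul x y => simp [hMdef, hτ', hu]
    · rw [← hρu, ← map_smul, ← h.right]
      have : M ∘ₗ TensorProduct.map ρ ρ = ρ ∘ₗ m := by
        ext a b
        simp [hρm]
      simp only [convProd, TensorProduct.map_comp, LinearMap.comp_apply]
      exact congr($this _)
  -- `h2` and `h3` compare the two maps `ρ ⊗ id` and `(· ⊗ 1) ⊗ id` on `E ⊗ A`. After the injective
  -- Galois map over `E ⊗ A` they become `ρ ⊗ id` and `id ⊗ Δ`, which agree on `ρ e`.
  have h2 : ∀ x, gal M (ρ ∘ₗ γ) (LinearMap.rTensor A ρ x) = LinearMap.rTensor A ρ (gal m γ x) := by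
    intro x
    induction x using TensorProduct.induction_on with
    | zero => simp
    | add x y hx hy => simp only [map_add, hx, hy]
    | tmul b a =>
    rw [LinearMap.rTensor_tmul, gal_tmul, gal_tmul, ← LinearMap.rTensor_comp_apply]
    congr 2
    ext c
    simp [hρm]
  have h3 : ∀ x, gal M (ρ ∘ₗ γ) (LinearMap.rTensor A ((TensorProduct.mk k E A).flip 1) x) =
      (TensorProduct.assoc k E A A).symm (LinearMap.lTensor E Coalgebra.comul (gal m γ x)) := by
    intro x
    induction x using TensorProduct.induction_on with
    | zero => simp
    | add x y hx hy => simp only [map_add, hx, hy]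
    | tmul b a =>
    have h4 : M ∘ₗ TensorProduct.mk k _ _ ((TensorProduct.mk k E A).flip 1 b) ∘ₗ ρ ∘ₗ γ =
        LinearMap.rTensor A (m ∘ₗ TensorProduct.mk k E E b ∘ₗ γ) ∘ₗ Coalgebra.comul := by
      ext c
      simp only [LinearMap.comp_apply, hγ]
      generalize Coalgebra.comul (R := k) c = X
      induction X using TensorProduct.induction_on with
      | zero => simp
      | add x y hx hy => simp only [map_add, hx, hy]
      | tmul x y => simp [hMdef, hτ]
    rw [LinearMap.rTensor_tmul, gal_tmul, h4, LinearMap.rTensor_comp_apply,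
      ← Coalgebra.coassoc_symm_apply, gal_tmul]
    generalize Coalgebra.comul (R := k) a = X
    induction X using TensorProduct.induction_on with
    | zero => simp
    | add x y hx hy => simp only [map_add, hx, hy]
    | tmul x y =>
    simp only [LinearMap.lTensor_tmul, LinearMap.rTensor_tmul]
    generalize Coalgebra.comul (R := k) y = X
    induction X using TensorProduct.induction_on with
    | zero => simp
    | add x y hx hy => simp only [map_add, tmul_add, hx, hy]
    | tmul x y => simp
  -- Informally `w = e₍₀₎ g(e₍₁₎) ⊗ e₍₂₎`, whose first leg should be coinvariant; `h5` says that it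
  -- is.
  obtain ⟨w, hw⟩ := hT.2 (ρ e)
  have h5 : LinearMap.rTensor A (ρ - (TensorProduct.mk k E A).flip 1) w = 0 := by
    rw [LinearMap.rTensor_sub, LinearMap.sub_apply, sub_eq_zero]
    apply hT'
    rw [h2, h3, hw, ← hρ, LinearEquiv.symm_apply_apply]
  have hex : Function.Exact (LinearMap.toSpanSingleton k E u)
      (ρ - (TensorProduct.mk k E A).flip 1) := by
    intro a
    rw [LinearMap.sub_apply, sub_eq_zero]
    refine (hco a).trans ⟨?_, ?_⟩
    · rintro ⟨c, rfl⟩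
      exact ⟨c, rfl⟩
    · rintro ⟨c, rfl⟩
      exact ⟨c, rfl⟩
  -- The coinvariants are the kernel of `ρ - (· ⊗ 1)`, so by flatness `w` lies in `k u ⊗ A`. Hence
  -- `w = u ⊗ a`, and `a` is the desired preimage of `e`.
  obtain ⟨z, rfl⟩ := (Module.Flat.rTensor_exact A hex w).mp h5
  obtain ⟨a, rfl⟩ := (TensorProduct.lid k A).symm.surjective z
  refine ⟨a, ?_⟩
  have h6 : ρ (γ a) = ρ e := by
    rw [← hTu, ← hw]
    simp
  rw [← hε (γ a), h6, hε]

end Section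

/-! ### Deformation of a coalgebra map by a functional -/

section Crossed

variable {k : Type*} [Field k] {A C : Type*} [AddCommGroup A] [Module k A]
  [AddCommGroup C] [Module k C]

/-- The map `c ↦ σ(c₍₁₎) μ(c₍₂₎)`. -/
def deform (Δ : C →ₗ[k] C ⊗[k] C) (σ : C →ₗ[k] k) (μ : C →ₗ[k] A) : C →ₗ[k] A :=
  (TensorProduct.lid k A).toLinearMap ∘ₗ TensorProduct.map σ μ ∘ₗ Δ

variable [Coalgebra k A] {Δ : C →ₗ[k] C ⊗[k] C} {ε : C →ₗ[k] k} (σ : C →ₗ[k] k) {μ : C →ₗ[k] A}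

/-- Coassociativity makes both sides `σ(c₍₁₎) μ(c₍₂₎) ⊗ μ(c₍₃₎)`: for a product `μ`, the deformed
product is still compatible with the coaction given by `Δ`. -/
theorem comul_deform
    (hΔ : ∀ c, TensorProduct.assoc k C C C (LinearMap.rTensor C Δ (Δ c)) =
      LinearMap.lTensor C Δ (Δ c))
    (hμ : ∀ c, TensorProduct.map μ μ (Δ c) = Coalgebra.comul (μ c))
    (c : C) : Coalgebra.comul (deform Δ σ μ c) = TensorProduct.map (deform Δ σ μ) μ (Δ c) := by
  trans TensorProduct.map ((TensorProduct.lid k A).toLinearMap ∘ₗ TensorProduct.map σ μ) μ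
    (LinearMap.rTensor C Δ (Δ c))
  · rw [← (LinearEquiv.symm_apply_eq _).mpr (hΔ c).symm, deform, LinearMap.comp_apply,
      LinearMap.comp_apply]
    generalize Δ c = X
    induction X using TensorProduct.induction_on with
    | zero => simp
    | add x y hx hy => simp only [map_add, hx, hy]
    | tmul x y =>
    simp only [TensorProduct.map_tmul, LinearEquiv.coe_coe, TensorProduct.lid_tmul, map_smul, ← hμ,
      LinearMap.lTensor_tmul]
    generalize Δ y = X
    induction X using TensorProduct.induction_on with
    | zero => simp
    | add x y hx hy => simp only [map_add, smul_add, tmul_add, hx, hy]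
    | tmul x y => simp [smul_tmul']
  · rw [← LinearMap.comp_apply, LinearMap.map_comp_rTensor]
    rfl

/-- Reads the functional off the deformed map. This makes `α` injective and dictates the choice of
`σ` in `exists_deform`. -/
theorem counit_deform (hε : ∀ c, TensorProduct.rid k C (LinearMap.lTensor C ε (Δ c)) = c)
    (hμ : ∀ c, Coalgebra.counit (R := k) (μ c) = ε c)
    (c : C) : Coalgebra.counit (R := k) (deform Δ σ μ c) = σ c := by
  trans σ (TensorProduct.rid k C (LinearMap.lTensor C ε (Δ c)))
  · rw [deform, LinearMap.comp_apply,
      LinearMap.comp_apply]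
    generalize Δ c = X
    induction X using TensorProduct.induction_on with
    | zero => simp
    | add x y hx hy => simp only [map_add, hx, hy]
    | tmul x y => simp [hμ, mul_comm]
  · rw [hε]

end Crossed

/-! ### Deformed products on a Hopf algebra with respect to a twist `τ` -/

section CrossedSquare

variable {k : Type*} [Field k] {A E : Type*} [Ring A] [Algebra k A] [Coalgebra k A]

/-- The comultiplication of `A ⊗ A` given by `τ : A ⊗ A → A ⊗ A`. -/
def sqComul (τ : A ⊗[k] A →ₗ[k] A ⊗[k] A) : A ⊗[k] A →ₗ[k] (A ⊗[k] A) ⊗[k] (A ⊗[k] A) :=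
  mid τ ∘ₗ TensorProduct.map Coalgebra.comul Coalgebra.comul

/-- The leg of `b` kept by the Galois map is the last one and `σ` uses the first, so coassociativity
of `b` lets the two operations be separated. No property of `τ` is needed. -/
theorem gal_deform (τ : A ⊗[k] A →ₗ[k] A ⊗[k] A) (σ : A ⊗[k] A →ₗ[k] k)
    (μ : A ⊗[k] A →ₗ[k] A) :
    gal (deform (sqComul τ) σ μ) LinearMap.id = gal μ LinearMap.id ∘ₗ
      (TensorProduct.lid k (A ⊗[k] A)).toLinearMap ∘ₗ LinearMap.rTensor (A ⊗[k] A) σ ∘ₗ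
        sqComul τ := by
  refine TensorProduct.ext' fun a b => ?_
  rw [gal_tmul, deform, LinearMap.comp_id, LinearMap.comp_apply, LinearMap.comp_apply,
    LinearMap.comp_apply, sqComul]
  simp only [LinearMap.comp_apply, TensorProduct.map_tmul]
  let J : A ⊗[k] A → A ⊗[k] A →ₗ[k] A := fun X =>
    (TensorProduct.lid k A).toLinearMap ∘ₗ TensorProduct.map σ μ ∘ₗ mid τ ∘ₗ
      TensorProduct.mk k (A ⊗[k] A) (A ⊗[k] A) X
  trans LinearMap.rTensor A (J (Coalgebra.comul a))
    (LinearMap.rTensor A Coalgebra.comul (Coalgebra.comul b))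
  · rw [← LinearMap.rTensor_comp_apply]
    congr 2
  rw [← Coalgebra.coassoc_symm_apply]
  generalize Coalgebra.comul (R := k) a = X
  generalize Coalgebra.comul (R := k) b = Y
  induction X using TensorProduct.induction_on with
  | zero => simp [J]
  | add x y hx hy =>
    have : J (x + y) = J x + J y := by simp [J, LinearMap.comp_add]
    simp only [map_add, add_tmul, hx, hy, this, LinearMap.rTensor_add, LinearMap.add_apply]
  | tmul x y =>
  induction Y using TensorProduct.induction_on with
  | zero => simp
  | add x y hx hy => simp only [map_add, tmul_add, hx, hy]
  | tmul b c =>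
  simp only [LinearMap.lTensor_tmul, mid_tmul]
  have hJ : ∀ b c, J (x ⊗ₜ y) (b ⊗ₜ c) = (TensorProduct.lid k A)
      (TensorProduct.map (σ ∘ₗ TensorProduct.mk k A A x) (μ ∘ₗ (TensorProduct.mk k A A).flip c)
        (τ (y ⊗ₜ b))) := by
    intro b c
    simp only [J, LinearMap.comp_apply, TensorProduct.mk_apply, mid_tmul, LinearEquiv.coe_coe]
    rw [TensorProduct.map_map]
  generalize hZ : Coalgebra.comul (R := k) c = Z
  -- A decomposition of `Δ c` is fixed first, so that the identity becomes additive in `τ (y ⊗ b)`,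
  -- which can then be reduced to pure tensors.
  trans ∑ i ∈ (TensorProduct.exists_finset Z).choose, J (x ⊗ₜ y) (b ⊗ₜ i.1) ⊗ₜ[k] i.2
  · conv_lhs => rw [(TensorProduct.exists_finset Z).choose_spec]
    simp [tmul_sum]
  simp only [hJ]
  generalize τ (y ⊗ₜ b) = W
  induction W using TensorProduct.induction_on with
  | zero => simp
  | add x y hx hy => simp only [map_add, add_tmul, Finset.sum_add_distrib, hx, hy]
  | tmul p q =>
  simp only [TensorProduct.map_tmul, LinearMap.rTensor_tmul, TensorProduct.mk_apply,
    LinearMap.flip_apply, LinearEquiv.coe_coe, TensorProduct.lid_tmul, map_smul, gal_tmul, hZ,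
    LinearMap.comp_apply, ← smul_tmul', ← Finset.smul_sum]
  conv_rhs => rw [(TensorProduct.exists_finset Z).choose_spec]
  simp

theorem gal_mul_bijective {S : A →ₗ[k] A}
    (hS : IsConvInverse Coalgebra.comul Coalgebra.counit (LinearMap.mul' k A) 1 LinearMap.id S) :
    Function.Bijective (gal (LinearMap.mul' k A) (LinearMap.id (R := k) (M := A))) :=
  gal_bijective _ 1 _ S (by simp [mul_assoc]) (by simp) hS

variable {τ : A ⊗[k] A →ₗ[k] A ⊗[k] A} {ε : A ⊗[k] A →ₗ[k] k}

/-- By `gal_deform`, the Galois map of the identity for the deformed product is a composite of two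
bijections, one due to the antipode and one due to invertibility of `σ`. The coalgebra on `A ⊗ A` is
an existential hypothesis because the braided one differs from the standard instance. -/
theorem deform_exists_isConvInverse
    (hC : ∃ C : Coalgebra k (A ⊗[k] A), C.comul = sqComul τ ∧ C.counit = ε) {S : A →ₗ[k] A}
    (hS : IsConvInverse Coalgebra.comul Coalgebra.counit (LinearMap.mul' k A) 1 LinearMap.id S)
    {σ σ' : A ⊗[k] A →ₗ[k] k}
    (hσ : IsConvInverse (sqComul τ) ε (LinearMap.mul' k k) 1 σ σ')
    (hm : ∀ a b c, deform (sqComul τ) σ (LinearMap.mul' k A)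
        (deform (sqComul τ) σ (LinearMap.mul' k A) (a ⊗ₜ b) ⊗ₜ c) =
      deform (sqComul τ) σ (LinearMap.mul' k A)
        (a ⊗ₜ deform (sqComul τ) σ (LinearMap.mul' k A) (b ⊗ₜ c)))
    (hu : ∀ a, deform (sqComul τ) σ (LinearMap.mul' k A) (a ⊗ₜ 1) = a)
    (hu' : ∀ a, deform (sqComul τ) σ (LinearMap.mul' k A) (1 ⊗ₜ a) = a) :
    ∃ g, IsConvInverse Coalgebra.comul Coalgebra.counit
      (deform (sqComul τ) σ (LinearMap.mul' k A)) 1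
      LinearMap.id g := by
  refine exists_isConvInverse _ 1 _ hm hu hu' ?_
  rw [gal_deform]
  obtain ⟨C, hC, rfl⟩ := hC
  rw [← hC] at hσ ⊢
  exact (gal_mul_bijective hS).comp (@functional_bijective _ _ _ _ _ C _ _ hσ)

/-- A cleft object with a section is isomorphic to a deformation of `A`. -/
theorem exists_deform [AddCommGroup E] [Module k E] {τE : A ⊗[k] E →ₗ[k] E ⊗[k] A}
    {m : E ⊗[k] E →ₗ[k] E} {u : E} {ρ : E →ₗ[k] E ⊗[k] A} {γ g : A →ₗ[k] E}
    (hC : ∃ C : Coalgebra k (A ⊗[k] A), C.comul = sqComul τ ∧ C.counit = ε) {S : A →ₗ[k] A}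
    (hS : IsConvInverse Coalgebra.comul Coalgebra.counit (LinearMap.mul' k A) 1 LinearMap.id S)
    (hμ : ∀ c : A ⊗[k] A, Coalgebra.counit (R := k) (LinearMap.mul' k A c) = ε c)
    (h1 : Coalgebra.counit (R := k) (1 : A) = 1)
    (hm : ∀ a b c, m (m (a ⊗ₜ b) ⊗ₜ c) = m (a ⊗ₜ m (b ⊗ₜ c)))
    (hu : ∀ b, m (b ⊗ₜ u) = b)
    (hρm : ∀ a b, ρ (m (a ⊗ₜ b)) =
      (TensorProduct.map m (LinearMap.mul' k A) ∘ₗ mid τE) (ρ a ⊗ₜ ρ b))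
    (hγ : ∀ x, ρ (γ x) = LinearMap.rTensor A γ (Coalgebra.comul x)) (hγ1 : γ 1 = u)
    (hγτ : ∀ r b, τE (r ⊗ₜ γ b) = LinearMap.rTensor A γ (τ (r ⊗ₜ b)))
    (h : IsConvInverse Coalgebra.comul Coalgebra.counit m u γ g) (hb : Function.Bijective γ) :
    ∃ σ : A ⊗[k] A →ₗ[k] k,
      (∀ x y, γ (deform (sqComul τ) σ (LinearMap.mul' k A) (x ⊗ₜ y)) = m (γ x ⊗ₜ γ y)) ∧
      (∀ x y z, σ (deform (sqComul τ) σ (LinearMap.mul' k A) (x ⊗ₜ y) ⊗ₜ z) =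
        σ (x ⊗ₜ deform (sqComul τ) σ (LinearMap.mul' k A) (y ⊗ₜ z))) ∧
      σ (1 ⊗ₜ 1) = 1 ∧
      ∃ σ', IsConvInverse (sqComul τ) ε (LinearMap.mul' k k) 1 σ σ' := by
  let e := LinearEquiv.ofBijective γ hb
  have he : ∀ x, γ (e.symm x) = x := e.apply_symm_apply
  -- The product of `E` transported to `A` along `γ`. By `counit_deform`, the only possible cocycle
  -- is `ε ∘ m'`.
  let m' : A ⊗[k] A →ₗ[k] A := e.symm.toLinearMap ∘ₗ m ∘ₗ TensorProduct.map γ γ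
  have hγm : ∀ z, γ (m' z) = m (TensorProduct.map γ γ z) := fun z => he _
  let σ : A ⊗[k] A →ₗ[k] k := Coalgebra.counit ∘ₗ m'
  -- Multiplicativity of `ρ`, transported along the colinear map `γ`; it may be verified after the
  -- injection `γ ⊗ id`.
  have hΔ : ∀ z, Coalgebra.comul (R := k) (m' z) =
      TensorProduct.map m' (LinearMap.mul' k A) (sqComul τ z) := by
    intro z
    have hinj : Function.Injective (LinearMap.rTensor A γ) :=
      Module.Flat.rTensor_preserves_injective_linearMap γ hb.1
    apply hinj
    rw [← hγ, hγm, sqComul]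
    induction z using TensorProduct.induction_on with
    | zero => simp
    | add x y hx hy => simp only [map_add, hx, hy]
    | tmul x y =>
    rw [TensorProduct.map_tmul, hρm, hγ, hγ, LinearMap.comp_apply, LinearMap.comp_apply,
      TensorProduct.map_tmul]
    generalize Coalgebra.comul (R := k) x = X
    generalize Coalgebra.comul (R := k) y = Y
    induction X using TensorProduct.induction_on with
    | zero => simp
    | add x y hx hy => simp only [map_add, add_tmul, hx, hy]
    | tmul a b =>
    induction Y using TensorProduct.induction_on with
    | zero => simp
    | add x y hx hy => simp only [map_add, tmul_add, hx, hy]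
    | tmul c d =>
    simp only [LinearMap.rTensor_tmul, mid_tmul, hγτ]
    generalize τ (b ⊗ₜ c) = W
    induction W using TensorProduct.induction_on with
    | zero => simp
    | add x y hx hy => simp only [map_add, hx, hy]
    | tmul p q => simp [hγm]
  -- Apply `ε ⊗ id` to `hΔ`: the left side collapses to `m'` and the right side is the deformation
  -- by `ε ∘ m'`.
  have hm' : deform (sqComul τ) σ (LinearMap.mul' k A) = m' := by
    refine LinearMap.ext fun z => ?_
    have h2 := congr(TensorProduct.lid k A $(Coalgebra.rTensor_counit_comul (R := k) (m' z)))
    rw [TensorProduct.lid_tmul, one_smul, hΔ, ← LinearMap.comp_apply (LinearMap.rTensor A _),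
      LinearMap.rTensor_comp_map] at h2
    exact h2
  have hassoc : ∀ x y z, m' (m' (x ⊗ₜ y) ⊗ₜ z) = m' (x ⊗ₜ m' (y ⊗ₜ z)) := by
    intro x y z
    apply hb.1
    simp only [hγm, TensorProduct.map_tmul, hm]
  refine ⟨σ, fun x y => ?_, fun x y z => ?_, ?_, ?_⟩
  · rw [hm', hγm, TensorProduct.map_tmul]
  · rw [hm']
    exact congr(Coalgebra.counit (R := k) $(hassoc x y z))
  · have : m' (1 ⊗ₜ 1) = 1 := hb.1 (by rw [hγm, TensorProduct.map_tmul, hγ1, hu])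
    change Coalgebra.counit (R := k) (m' (1 ⊗ₜ 1)) = 1
    rw [this, h1]
  · obtain ⟨C, hC, rfl⟩ := hC
    rw [← hC]
    refine @functional_exists_isConvInverse _ _ _ _ _ C σ ?_
    rw [hC, ← Function.Bijective.of_comp_iff' (gal_mul_bijective hS), ← LinearMap.coe_comp,
      ← gal_deform, hm']
    -- The Galois map of `m'` is conjugate through `γ` to the bijection `gal m γ`. After cancelling
    -- the antipode factor in `gal_deform`, what remains is that `c ↦ σ(c₍₁₎) c₍₂₎` is bijective.
    have h3 : gal m' LinearMap.id = LinearMap.rTensor A e.symm.toLinearMap ∘ₗ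
        gal m γ ∘ₗ LinearMap.rTensor A γ := by
      refine TensorProduct.ext' fun a b => ?_
      simp only [LinearMap.comp_apply, LinearMap.rTensor_tmul, gal_tmul,
        ← LinearMap.rTensor_comp_apply]
      rfl
    rw [h3]
    exact (LinearEquiv.rTensor A e.symm).bijective.comp
      ((gal_bijective m u γ g hm hu h).comp (LinearEquiv.rTensor A e).bijective)

end CrossedSquare

/-! ### Two-cocycles on a bialgebra -/

section Classical

variable {k : Type u} {A : Type v} [Field k] [Ring A]

/-- An invertible idempotent is the identity. Idempotency is used through the Galois map of `s`,
which is injective and equals its own square. -/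
theorem eq_counit_of_convProd_self {C : Type*} [AddCommGroup C] [Module k C] [Coalgebra k C]
    {s s' : C →ₗ[k] k}
    (h : IsConvInverse Coalgebra.comul Coalgebra.counit (LinearMap.mul' k k) 1 s s')
    (hs : convProd Coalgebra.comul (LinearMap.mul' k k) s s = s) (c : C) :
    s c = Coalgebra.counit (R := k) c := by
  have h1 := (gal_bijective (LinearMap.mul' k k) 1 s s' (by simp [mul_assoc]) (by simp) h).1
  have h2 := gal_gal (LinearMap.mul' k k) s s (by simp [mul_assoc]) ((1 : k) ⊗ₜ[k] c)
  rw [hs] at h2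
  rw [← counit_gal (LinearMap.mul' k k) 1 s (by simp), h1 h2]
  simp

theorem mid_comm {B D A' B' : Type*} [AddCommGroup B] [Module k B] [AddCommGroup D] [Module k D]
    [AddCommGroup A'] [Module k A'] [AddCommGroup B'] [Module k B'] :
    mid (A := B) (B' := B') (TensorProduct.comm k D A').toLinearMap =
      (TensorProduct.tensorTensorTensorComm k B D A' B').toLinearMap := by
  ext
  simp

variable [Bialgebra k A]

theorem comul_eq_sqComul : (Coalgebra.comul : A ⊗[k] A →ₗ[k] _) =
    sqComul (TensorProduct.comm k A A).toLinearMap := by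
  rw [sqComul, mid_comm]
  rfl

theorem exists_coalgebra_comm : ∃ C : Coalgebra k (A ⊗[k] A),
    C.comul = sqComul (TensorProduct.comm k A A).toLinearMap ∧
      C.counit = Coalgebra.counit (A := A ⊗[k] A) :=
  ⟨inferInstance, comul_eq_sqComul, rfl⟩

theorem crossedMul_eq_deform (σ : A ⊗[k] A →ₗ[k] k) :
    crossedMul k A σ = deform Coalgebra.comul σ (LinearMap.mul' k A) := rfl

theorem comul_mul'_apply (c : A ⊗[k] A) :
    TensorProduct.map (LinearMap.mul' k A) (LinearMap.mul' k A) (Coalgebra.comul c) =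
      Coalgebra.comul (R := k) (LinearMap.mul' k A c) :=
  CoalgHomClass.map_comp_comul_apply (Bialgebra.mulCoalgHom k A) c

theorem counit_mul'_apply (c : A ⊗[k] A) :
    Coalgebra.counit (R := k) (LinearMap.mul' k A c) = Coalgebra.counit (R := k) c :=
  CoalgHomClass.counit_comp_apply (Bialgebra.mulCoalgHom k A) c

theorem comul_crossedMul (σ : A ⊗[k] A →ₗ[k] k) (c : A ⊗[k] A) :
    Coalgebra.comul (R := k) (crossedMul k A σ c) =
      TensorProduct.map (crossedMul k A σ) (LinearMap.mul' k A) (Coalgebra.comul c) :=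
  comul_deform σ Coalgebra.coassoc_apply comul_mul'_apply c

theorem counit_crossedMul (σ : A ⊗[k] A →ₗ[k] k) (c : A ⊗[k] A) :
    Coalgebra.counit (R := k) (crossedMul k A σ c) = σ c :=
  counit_deform (ε := Coalgebra.counit) σ (by simp) counit_mul'_apply c

variable {σ : A ⊗[k] A →ₗ[k] k}

theorem crossedMul_tmul_one (hσ : ∀ x, σ (x ⊗ₜ 1) = Coalgebra.counit (R := k) x) (x : A) :
    crossedMul k A σ (x ⊗ₜ 1) = x := by
  trans TensorProduct.lid k A (LinearMap.rTensor A Coalgebra.counit (Coalgebra.comul x))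
  · simp only [crossedMul, LinearMap.comp_apply, TensorProduct.comul_tmul,
      Bialgebra.comul_one, Algebra.TensorProduct.one_def]
    generalize Coalgebra.comul (R := k) x = X
    induction X using TensorProduct.induction_on with
    | zero => simp
    | add x y hx hy => simp only [map_add, add_tmul, hx, hy]
    | tmul x y => simp [hσ]
  · simp

theorem crossedMul_one_tmul (hσ : ∀ x, σ (1 ⊗ₜ x) = Coalgebra.counit (R := k) x) (x : A) :
    crossedMul k A σ (1 ⊗ₜ x) = x := by
  trans TensorProduct.lid k A (LinearMap.rTensor A Coalgebra.counit (Coalgebra.comul x))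
  · simp only [crossedMul, LinearMap.comp_apply, TensorProduct.comul_tmul,
      Bialgebra.comul_one, Algebra.TensorProduct.one_def]
    generalize Coalgebra.comul (R := k) x = X
    induction X using TensorProduct.induction_on with
    | zero => simp
    | add x y hx hy => simp only [map_add, tmul_add, hx, hy]
    | tmul x y => simp [hσ]
  · simp

theorem crossedMul_one_tmul_one (h : σ (1 ⊗ₜ 1) = 1) : crossedMul k A σ (1 ⊗ₜ 1) = 1 := by
  simp [crossedMul, Bialgebra.comul_one, Algebra.TensorProduct.one_def, h]

/-- The cocycle identity at `(x, 1, 1)` together with `σ(1, 1) = 1` says that `x ↦ σ(x, 1)` is a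
convolution idempotent. It is also invertible, being the restriction of `σ` along a coalgebra map.
-/
theorem IsCocycle.tmul_one (h : IsCocycle k A σ) (x : A) :
    σ (x ⊗ₜ 1) = Coalgebra.counit (R := k) x := by
  obtain ⟨σ', hσ'⟩ := h.invertible
  let i : A →ₗc[k] A ⊗[k] A :=
    { toLinearMap := (TensorProduct.mk k A A).flip 1
      counit_comp := by ext; simp
      map_comp_comul := by
        ext d
        simp only [LinearMap.comp_apply, LinearMap.flip_apply, TensorProduct.mk_apply,
          TensorProduct.comul_tmul, Bialgebra.comul_one, Algebra.TensorProduct.one_def]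
        generalize Coalgebra.comul (R := k) d = X
        induction X using TensorProduct.induction_on with
        | zero => simp
        | add x y hx hy => simp only [map_add, add_tmul, hx, hy]
        | tmul x y => simp }
  have h1 := hσ'.comp (ΔD := Coalgebra.comul) (εD := Coalgebra.counit) i.toLinearMap
    (fun d => CoalgHomClass.map_comp_comul_apply i d) (fun d => CoalgHomClass.counit_comp_apply i d)
  refine eq_counit_of_convProd_self h1 ?_ x
  ext x
  have h2 := h.cocycle x 1 1
  rw [crossedMul_one_tmul_one h.normalized] at h2
  refine Eq.trans ?_ h2
  simp only [convProd, crossedMul, LinearMap.comp_apply, TensorProduct.comul_tmul,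
    Bialgebra.comul_one, Algebra.TensorProduct.one_def]
  generalize Coalgebra.comul (R := k) x = X
  induction X using TensorProduct.induction_on with
  | zero => simp
  | add x y hx hy => simp only [map_add, add_tmul, hx, hy]
  | tmul x y => simp [i, ← smul_tmul']

theorem IsCocycle.one_tmul (h : IsCocycle k A σ) (x : A) :
    σ (1 ⊗ₜ x) = Coalgebra.counit (R := k) x := by
  obtain ⟨σ', hσ'⟩ := h.invertible
  let i : A →ₗc[k] A ⊗[k] A :=
    { toLinearMap := TensorProduct.mk k A A 1
      counit_comp := by ext; simp
      map_comp_comul := by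
        ext d
        simp only [LinearMap.comp_apply, TensorProduct.mk_apply,
          TensorProduct.comul_tmul, Bialgebra.comul_one, Algebra.TensorProduct.one_def]
        generalize Coalgebra.comul (R := k) d = X
        induction X using TensorProduct.induction_on with
        | zero => simp
        | add x y hx hy => simp only [map_add, tmul_add, hx, hy]
        | tmul x y => simp }
  have h1 := hσ'.comp (ΔD := Coalgebra.comul) (εD := Coalgebra.counit) i.toLinearMap
    (fun d => CoalgHomClass.map_comp_comul_apply i d) (fun d => CoalgHomClass.counit_comp_apply i d)
  refine eq_counit_of_convProd_self h1 ?_ x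
  ext x
  have h2 := h.cocycle 1 1 x
  rw [crossedMul_one_tmul_one h.normalized] at h2
  refine Eq.trans ?_ h2.symm
  simp only [convProd, crossedMul, LinearMap.comp_apply, TensorProduct.comul_tmul,
    Bialgebra.comul_one, Algebra.TensorProduct.one_def]
  generalize Coalgebra.comul (R := k) x = X
  induction X using TensorProduct.induction_on with
  | zero => simp
  | add x y hx hy => simp only [map_add, tmul_add, hx, hy]
  | tmul x y => simp [i]

/-- By `comul_crossedMul`, the coproduct of a deformed product has a deformed first leg and an
ordinary second leg, so the two sides differ only by the cocycle identity on first legs and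
associativity of `A` on second legs. -/
theorem crossedMul_assoc (h : ∀ x y z : A,
      σ (crossedMul k A σ (x ⊗ₜ y) ⊗ₜ z) = σ (x ⊗ₜ crossedMul k A σ (y ⊗ₜ z))) (x y z : A) :
    crossedMul k A σ (crossedMul k A σ (x ⊗ₜ y) ⊗ₜ z) =
      crossedMul k A σ (x ⊗ₜ crossedMul k A σ (y ⊗ₜ z)) := by
  have h1 : ∀ x y, crossedMul k A σ (x ⊗ₜ y) = TensorProduct.lid k A
      (TensorProduct.map σ (LinearMap.mul' k A) (TensorProduct.tensorTensorTensorComm k A A A A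
        (Coalgebra.comul x ⊗ₜ Coalgebra.comul y))) := fun _ _ => rfl
  have h2 : ∀ x y, Coalgebra.comul (R := k) (x ⊗ₜ[k] y) =
      TensorProduct.tensorTensorTensorComm k A A A A
        (Coalgebra.comul x ⊗ₜ Coalgebra.comul y) := fun _ _ => rfl
  rw [h1 (crossedMul k A σ (x ⊗ₜ y)), h1 x (crossedMul k A σ (y ⊗ₜ z)), comul_crossedMul,
    comul_crossedMul, h2, h2]
  generalize Coalgebra.comul (R := k) x = X
  generalize Coalgebra.comul (R := k) y = Y
  generalize Coalgebra.comul (R := k) z = Z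
  induction X using TensorProduct.induction_on with
  | zero => simp
  | add x y hx hy => simp only [map_add, add_tmul, hx, hy]
  | tmul x x' =>
  induction Y using TensorProduct.induction_on with
  | zero => simp
  | add x y hx hy => simp only [map_add, tmul_add, add_tmul, hx, hy]
  | tmul y y' =>
  induction Z using TensorProduct.induction_on with
  | zero => simp
  | add x y hx hy => simp only [map_add, tmul_add, hx, hy]
  | tmul z z' => simp [h, mul_assoc]

end Classical

/-! ### Coinvariants of the regular coaction -/

section Counit

variable {k : Type*} [Field k]

theorem one_ne_zero_of_counit_one {A : Type*} [Ring A] [Algebra k A] [Coalgebra k A]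
    (h : Coalgebra.counit (R := k) (1 : A) = 1) : (1 : A) ≠ 0 := fun h0 => by
  rw [h0, map_zero] at h
  exact zero_ne_one h

theorem comul_eq_tmul_one_iff {A : Type*} [Ring A] [Algebra k A] [Coalgebra k A]
    (h1 : Coalgebra.comul (R := k) (1 : A) = 1 ⊗ₜ 1) (a : A) :
    Coalgebra.comul (R := k) a = a ⊗ₜ 1 ↔ ∃ c : k, a = c • 1 := by
  refine ⟨fun h => ⟨Coalgebra.counit a, ?_⟩, ?_⟩
  · have := congr(TensorProduct.lid k A $(Coalgebra.rTensor_counit_comul (R := k) a))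
    rw [h] at this
    simpa using this.symm
  · rintro ⟨c, rfl⟩
    rw [map_smul, h1, smul_tmul']

theorem comul_eq_rTensor_id {A : Type*} [AddCommGroup A] [Module k A] [Coalgebra k A] (a : A) :
    Coalgebra.comul (R := k) a = LinearMap.rTensor A LinearMap.id (Coalgebra.comul a) := by
  simp

end Counit

/-! ### Two-cocycles and cleft objects over a Hopf algebra -/

section ClassicalCleft

variable {k : Type u} {A : Type v} [Field k] [Ring A] [HopfAlgebra k A]

theorem antipode_isConvInverse : IsConvInverse Coalgebra.comul Coalgebra.counit
    (LinearMap.mul' k A) 1 LinearMap.id (HopfAlgebra.antipode k) :=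
  ⟨fun c => (HopfAlgebra.mul_antipode_lTensor_comul_apply (R := k) c).trans
      (Algebra.algebraMap_eq_smul_one _),
    fun c => (HopfAlgebra.mul_antipode_rTensor_comul_apply (R := k) c).trans
      (Algebra.algebraMap_eq_smul_one _)⟩

/-- The cleft object `k #_σ A` with section `id`. -/
def crossedData (σ : A ⊗[k] A →ₗ[k] k) : CleftData k A where
  carrier := A
  mul := crossedMul k A σ
  one := 1
  coact := Coalgebra.comul
  sec := LinearMap.id

theorem alpha_eq (σ : A ⊗[k] A →ₗ[k] k) : alpha k A σ = ⟦crossedData σ⟧ := rfl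

theorem crossedData_isCleft {σ : A ⊗[k] A →ₗ[k] k} (h : IsCocycle k A σ) :
    (crossedData σ).IsCleft where
  mul_assoc := crossedMul_assoc (A := A) h.cocycle
  one_mul := crossedMul_one_tmul (A := A) h.one_tmul
  mul_one := crossedMul_tmul_one (A := A) h.tmul_one
  coassoc :=
    have h : ∀ a : A, TensorProduct.assoc k A A A (LinearMap.rTensor A Coalgebra.comul
      (Coalgebra.comul a)) = LinearMap.lTensor A Coalgebra.comul (Coalgebra.comul a) :=
      Coalgebra.coassoc_apply
    h
  counit_coact :=
    have h : ∀ a : A, TensorProduct.rid k A (LinearMap.lTensor A Coalgebra.counit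
      (Coalgebra.comul a)) = a := by simp
    h
  coact_mul a b := comul_crossedMul (A := A) σ (TensorProduct.tmul (M := A) (N := A) k a b)
  coact_one := Bialgebra.comul_one (A := A)
  one_ne_zero := one_ne_zero_of_counit_one (k := k) (A := A) Bialgebra.counit_one
  coinvariants := comul_eq_tmul_one_iff (A := A) Bialgebra.comul_one
  sec_coact := comul_eq_rTensor_id (A := A)
  sec_one := rfl
  sec_invertible := by
    obtain ⟨σ', hσ'⟩ := h.invertible
    have e := crossedMul_eq_deform σ
    rw [comul_eq_sqComul] at hσ' e
    have h1 := deform_exists_isConvInverse exists_coalgebra_comm antipode_isConvInverse hσ'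
    rw [← e] at h1
    exact h1 (crossedMul_assoc h.cocycle) (crossedMul_tmul_one h.tmul_one)
      (crossedMul_one_tmul h.one_tmul)

/-- An isomorphism that respects the sections `id` is the identity, so the two products agree, and
their counits are the two functionals. The cocycle condition plays no role. -/
theorem alpha_injective : Function.Injective (alpha k A) := by
  intro σ τ h
  obtain ⟨e, h1, -, -, h4⟩ := Quotient.exact h
  change A ≃ₗ[k] A at e
  replace h4 : ∀ x : A, e x = x := h4
  replace h1 : ∀ a b : A, e (crossedMul k A σ (a ⊗ₜ b)) = crossedMul k A τ (e a ⊗ₜ e b) := h1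
  refine TensorProduct.ext' fun a b => ?_
  rw [← counit_crossedMul, ← counit_crossedMul, ← h4 (crossedMul k A σ _), h1, h4, h4]

/-- The general results `section_bijective` and `exists_deform` for the flip; the section itself is
the isomorphism from `k #_σ A`. -/
theorem exists_cocycle_of_isCleft {X : CleftData k A} (h : X.IsCleft) :
    ∃ σ, IsCocycle k A σ ∧ alpha k A σ = ⟦X⟧ := by
  obtain ⟨g, hg⟩ := h.sec_invertible
  have hM := mid_comm (k := k) (B := X.carrier) (D := A) (A' := X.carrier) (B' := A)
  have hb : Function.Bijective X.sec := by
    refine section_bijective (TensorProduct.comm k A X.carrier).toLinearMap X.mul X.one X.coact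
      X.sec g h.mul_assoc h.one_mul h.mul_one (by simp) (by simp) ?_ h.coassoc h.counit_coact ?_
      h.coact_one h.one_ne_zero h.coinvariants h.sec_coact hg
    · rw [hM]
      intro x y z
      induction x using TensorProduct.induction_on with
      | zero => simp
      | add x y hx hy => simp only [map_add, add_tmul, hx, hy]
      | tmul x x' =>
      induction y using TensorProduct.induction_on with
      | zero => simp
      | add x y hx hy => simp only [map_add, tmul_add, add_tmul, hx, hy]
      | tmul y y' =>
      induction z using TensorProduct.induction_on with
      | zero => simp
      | add x y hx hy => simp only [map_add, tmul_add, hx, hy]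
      | tmul z z' => simp [h.mul_assoc, mul_assoc]
    · rw [hM]
      exact h.coact_mul
  obtain ⟨σ, h1, h2, h3, h4⟩ := exists_deform
    (τE := (TensorProduct.comm k A X.carrier).toLinearMap) (exists_coalgebra_comm (k := k) (A := A))
    antipode_isConvInverse counit_mul'_apply Bialgebra.counit_one h.mul_assoc h.mul_one
    (by rw [hM]; exact h.coact_mul) h.sec_coact h.sec_one (by simp) hg hb
  rw [← comul_eq_sqComul] at h1 h2 h4
  refine ⟨σ, ⟨h4, h2, h3⟩, ?_⟩
  rw [alpha_eq]
  exact Quotient.sound ⟨LinearEquiv.ofBijective X.sec hb, h1, h.sec_one, h.sec_coact,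
    fun _ => rfl⟩

theorem alpha_bijOn : Set.BijOn (alpha k A) {σ | IsCocycle k A σ} (CleftClasses k A) := by
  refine ⟨fun σ hσ => ⟨crossedData σ, crossedData_isCleft hσ, rfl⟩, alpha_injective.injOn, ?_⟩
  rintro _ ⟨X, hX, rfl⟩
  obtain ⟨σ, hσ, h⟩ := exists_cocycle_of_isCleft hX
  exact ⟨σ, hσ, h⟩

end ClassicalCleft

/-! ### The coalgebra map from the square of `R # H` onto the braided square of `R` -/

section Fold

variable (k : Type*) (H : Type*) (R : Type*) [Field k] [Ring H] [HopfAlgebra k H]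
  [Ring R] [Algebra k R] [Coalgebra k R] [Module H R] [IsScalarTower k H R]
  [YetterDrinfeld k H R] [YDHopf k H R]

omit [Coalgebra k R] [YDHopf k H R] in
-- The comultiplication of `R # H` puts `r₍₂₎₍₋₁₎ h₍₁₎` in the first `H`-leg. Acting with this on
-- `s₍₁₎` is the same as braiding `r₍₂₎` past `h₍₁₎ • s₍₁₎`.
theorem map_assoc_act_mid (X S : R ⊗[k] R) (Y : H ⊗[k] H) :
    TensorProduct.map (LinearMap.lTensor R (act k H R) ∘ₗ (TensorProduct.assoc k R H R).toLinearMap)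
      (LinearMap.lTensor R (act k H R) ∘ₗ (TensorProduct.assoc k R H R).toLinearMap)
      (TensorProduct.tensorTensorTensorComm k (R ⊗[k] H) (R ⊗[k] H) R R
        (mid (braid k H R H) (X ⊗ₜ Y) ⊗ₜ S)) =
    mid (braid k H R R) (X ⊗ₜ TensorProduct.map (act k H R) (act k H R)
      (TensorProduct.tensorTensorTensorComm k H H R R (Y ⊗ₜ S))) := by
  induction X using TensorProduct.induction_on with
  | zero => simp
  | add x x' hx hy => simp only [map_add, add_tmul, hx, hy]
  | tmul a c =>
  induction S using TensorProduct.induction_on with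
  | zero => simp
  | add x x' hx hy => simp only [map_add, tmul_add, hx, hy]
  | tmul s t =>
  induction Y using TensorProduct.induction_on with
  | zero => simp
  | add x x' hx hy => simp only [map_add, add_tmul, tmul_add, hx, hy]
  | tmul y z =>
  simp only [TensorProduct.map_tmul, TensorProduct.tensorTensorTensorComm_tmul, mid_tmul,
    braid_tmul]
  generalize YetterDrinfeld.coact (k := k) (H := H) c = Z
  induction Z using TensorProduct.induction_on with
  | zero => simp
  | add x x' hx hy => simp only [map_add, add_tmul, hx, hy]
  | tmul p q => simp [mul_smul]

omit [Coalgebra k R] [YDHopf k H R] in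
theorem map_rid_counit_mid (X : R ⊗[k] R) (Y : H ⊗[k] H) :
    TensorProduct.map ((TensorProduct.rid k R).toLinearMap ∘ₗ
      LinearMap.lTensor R (Coalgebra.counit (R := k) (A := H))) LinearMap.id
      (mid (braid k H R H) (X ⊗ₜ Y)) =
    LinearMap.lTensor R ((TensorProduct.mk k R H).flip
      (TensorProduct.lid k H (LinearMap.rTensor H Coalgebra.counit Y))) X := by
  induction X using TensorProduct.induction_on with
  | zero => simp
  | add x x' hx hy => simp only [map_add, add_tmul, hx, hy]
  | tmul a c =>
  induction Y using TensorProduct.induction_on with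
  | zero => simp
  | add x x' hx hy =>
    simp only [map_add, tmul_add, hx, hy, LinearMap.lTensor_add, LinearMap.add_apply]
  | tmul x z =>
  have hc := YetterDrinfeld.counit_coact (k := k) (H := H) c
  obtain ⟨T, hT⟩ := TensorProduct.exists_finset (YetterDrinfeld.coact (k := k) (H := H) c)
  simp only [hT, map_sum, LinearMap.rTensor_tmul, TensorProduct.lid_tmul] at hc
  simp only [mid_tmul, braid_tmul, hT, map_sum, LinearMap.rTensor_tmul,
    TensorProduct.map_tmul, LinearMap.lTensor_tmul, TensorProduct.mk_apply, LinearMap.flip_apply,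
    AlgHom.toLinearMap_apply, Algebra.lsmul_coe, smul_eq_mul, Bialgebra.counit_mul,
    TensorProduct.lid_tmul, LinearMap.id_apply, LinearMap.comp_apply, LinearEquiv.coe_coe,
    TensorProduct.rid_tmul]
  conv_rhs => rw [← hc]
  rw [tmul_smul, sum_tmul, Finset.smul_sum, tmul_sum]
  refine Finset.sum_congr rfl fun i _ => ?_
  simp only [← smul_tmul', tmul_smul, smul_smul, mul_comm]

/-- The map `(r ⊗ h) ⊗ s ↦ r ⊗ h • s`. -/
def foldAct : Bosonization k H R ⊗[k] R →ₗ[k] R ⊗[k] R :=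
  (LinearMap.lTensor R (act k H R) ∘ₗ (TensorProduct.assoc k R H R).toLinearMap :
    (R ⊗[k] H) ⊗[k] R →ₗ[k] R ⊗[k] R)

/-- The map `(r ⊗ h) ⊗ (s ⊗ h') ↦ r ⊗ h • s ε(h')`. -/
def fold : Bosonization k H R ⊗[k] Bosonization k H R →ₗ[k] R ⊗[k] R :=
  foldAct k H R ∘ₗ LinearMap.lTensor _ (Bosonization.projR k H R).toLinearMap

theorem foldAct_tmul (r s : R) (h : H) :
    foldAct k H R (Bosonization.tmul r h ⊗ₜ s) = r ⊗ₜ (h • s) := rfl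

theorem fold_tmul (r s : R) (h g : H) :
    fold k H R (Bosonization.tmul r h ⊗ₜ Bosonization.tmul s g) =
      Coalgebra.counit (R := k) g • (r ⊗ₜ (h • s)) := by
  change r ⊗ₜ (h • Coalgebra.counit (R := k) g • s) = _
  rw [smul_comm, tmul_smul]

/-- Reduces statements about `Φ` to the fact that `fold` is a surjective coalgebra map. -/
theorem Phi_eq (π : R ⊗[k] R →ₗ[k] k) : Phi k H R π = π ∘ₗ fold k H R := by
  refine TensorProduct.ext' fun x y => ?_
  induction x using Bosonization.induction with
  | zero => simp
  | add x x' hx hy => simp only [add_tmul, map_add, hx, hy]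
  | tmul r h =>
  induction y using Bosonization.induction with
  | zero => simp
  | add x x' hx hy => simp only [tmul_add, map_add, hx, hy]
  | tmul s g =>
  rw [Phi_tmul, LinearMap.comp_apply, fold_tmul, map_smul, smul_eq_mul, mul_comm]

theorem comul_foldAct (x : Bosonization k H R ⊗[k] R) :
    TensorProduct.map (foldAct k H R) (foldAct k H R) (Coalgebra.comul x) =
      comulSq k H R (foldAct k H R x) := by
  induction x using TensorProduct.induction_on with
  | zero => simp
  | add x x' hx hy => simp only [map_add, hx, hy]
  | tmul x s =>
  induction x using Bosonization.induction with
  | zero => simp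
  | add x x' hx hy => simp only [add_tmul, map_add, hx, hy]
  | tmul r h =>
  rw [foldAct_tmul, comulSq, LinearMap.comp_apply, TensorProduct.map_tmul,
    YDHopf.comul_smul (k := k)]
  exact map_assoc_act_mid k H R _ _ _

/-- The second argument enters only through the coalgebra map `projR`, so the claim reduces to
`foldAct`, where it is `H`-linearity of the comultiplication of `R` together with
`map_assoc_act_mid`. -/
theorem comul_fold (x : Bosonization k H R ⊗[k] Bosonization k H R) :
    TensorProduct.map (fold k H R) (fold k H R) (Coalgebra.comul x) =
      comulSq k H R (fold k H R x) := by
  have h1 := CoalgHomClass.map_comp_comul_apply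
    (Coalgebra.TensorProduct.map (CoalgHom.id k (Bosonization k H R)) (Bosonization.projR k H R)) x
  rw [fold, TensorProduct.map_comp, LinearMap.comp_apply, LinearMap.comp_apply, ← comul_foldAct]
  exact congr(TensorProduct.map (foldAct k H R) (foldAct k H R) $h1)

theorem counitSq_fold (x : Bosonization k H R ⊗[k] Bosonization k H R) :
    counitSq k R (fold k H R x) = Coalgebra.counit (R := k) x := by
  induction x using TensorProduct.induction_on with
  | zero => simp
  | add x x' hx hy => simp only [map_add, hx, hy]
  | tmul x y =>
  induction x using Bosonization.induction with
  | zero => simp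
  | add x x' hx hy => simp only [add_tmul, map_add, hx, hy]
  | tmul r h =>
  induction y using Bosonization.induction with
  | zero => simp
  | add x x' hx hy => simp only [tmul_add, map_add, hx, hy]
  | tmul s g =>
  rw [fold_tmul, TensorProduct.counit_tmul, Bosonization.counit_tmul, Bosonization.counit_tmul]
  simp only [counitSq, map_smul, LinearMap.comp_apply, TensorProduct.map_tmul,
    YDHopf.counit_smul, LinearMap.mul'_apply, smul_eq_mul]
  ring

theorem fold_surjective : Function.Surjective (fold k H R) := by
  intro x
  induction x using TensorProduct.induction_on with
  | zero => exact ⟨0, map_zero _⟩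
  | add x y hx hy =>
    obtain ⟨x, rfl⟩ := hx
    obtain ⟨y, rfl⟩ := hy
    exact ⟨x + y, map_add _ _ _⟩
  | tmul r s => exact ⟨Bosonization.tmul r 1 ⊗ₜ Bosonization.tmul s 1, by simp [fold_tmul]⟩

/-- The coalgebra `R ⊗ R` in the category of Yetter–Drinfeld modules. -/
abbrev braidedSquareCoalgebra : Coalgebra k (R ⊗[k] R) :=
  letI : CoalgebraStruct k (R ⊗[k] R) :=
    { comul := comulSq k H R
      counit := counitSq k R }
  { coassoc := by
      -- The axioms descend from the ordinary tensor square of `R # H` along the surjection `fold`;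
      -- the braiding itself is never expanded.
      refine LinearMap.ext fun x => ?_
      obtain ⟨x, rfl⟩ := fold_surjective k H R x
      change TensorProduct.assoc k _ _ _ (LinearMap.rTensor _ (comulSq k H R)
        (comulSq k H R (fold k H R x))) = LinearMap.lTensor _ (comulSq k H R)
        (comulSq k H R (fold k H R x))
      have h1 : comulSq k H R ∘ₗ fold k H R = TensorProduct.map (fold k H R) (fold k H R) ∘ₗ
          Coalgebra.comul := LinearMap.ext fun x => (comul_fold k H R x).symm
      have h2 : ∀ y, TensorProduct.assoc k _ _ _ (TensorProduct.map (TensorProduct.map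
          (fold k H R) (fold k H R)) (fold k H R) y) = TensorProduct.map (fold k H R)
          (TensorProduct.map (fold k H R) (fold k H R)) (TensorProduct.assoc k _ _ _ y) :=
        fun y => (TensorProduct.map_map_assoc ..).symm
      rw [← comul_fold, ← LinearMap.comp_apply (LinearMap.rTensor _ _),
        ← LinearMap.comp_apply (LinearMap.lTensor _ _), LinearMap.rTensor_comp_map,
        LinearMap.lTensor_comp_map, h1, ← LinearMap.map_comp_rTensor, ← LinearMap.map_comp_lTensor,
        LinearMap.comp_apply, LinearMap.comp_apply, ← Coalgebra.coassoc_apply, h2]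
    rTensor_counit_comp_comul := by
      refine LinearMap.ext fun x => ?_
      obtain ⟨x, rfl⟩ := fold_surjective k H R x
      change LinearMap.rTensor _ (counitSq k R) (comulSq k H R (fold k H R x)) = 1 ⊗ₜ fold k H R x
      have h1 : counitSq k R ∘ₗ fold k H R = Coalgebra.counit :=
        LinearMap.ext (counitSq_fold k H R)
      rw [← comul_fold, ← LinearMap.comp_apply, LinearMap.rTensor_comp_map, h1,
        ← LinearMap.lTensor_comp_rTensor, LinearMap.comp_apply, Coalgebra.rTensor_counit_comul,
        LinearMap.lTensor_tmul]
    lTensor_counit_comp_comul := by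
      refine LinearMap.ext fun x => ?_
      obtain ⟨x, rfl⟩ := fold_surjective k H R x
      change LinearMap.lTensor _ (counitSq k R) (comulSq k H R (fold k H R x)) = fold k H R x ⊗ₜ 1
      have h1 : counitSq k R ∘ₗ fold k H R = Coalgebra.counit :=
        LinearMap.ext (counitSq_fold k H R)
      rw [← comul_fold, ← LinearMap.comp_apply, LinearMap.lTensor_comp_map, h1,
        ← LinearMap.rTensor_comp_lTensor, LinearMap.comp_apply, Coalgebra.lTensor_counit_comul,
        LinearMap.rTensor_tmul] }

theorem exists_coalgebra_braided : ∃ C : Coalgebra k (R ⊗[k] R),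
    C.comul = sqComul (braid k H R R) ∧ C.counit = counitSq k R :=
  ⟨braidedSquareCoalgebra k H R, rfl, rfl⟩

/-- Convolution on `R ⊗ R` is transported to convolution on `(R # H) ⊗ (R # H)`. -/
theorem isConvInverse_Phi_iff (π π' : R ⊗[k] R →ₗ[k] k) :
    IsConvInverse Coalgebra.comul Coalgebra.counit (LinearMap.mul' k k) 1
      (Phi k H R π) (Phi k H R π') ↔
    IsConvInverse (comulSq k H R) (counitSq k R) (LinearMap.mul' k k) 1 π π' := by
  rw [Phi_eq, Phi_eq]
  refine ⟨fun h => ⟨fun c => ?_, fun c => ?_⟩,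
    fun h => h.comp _ (comul_fold k H R) (counitSq_fold k H R)⟩
  · obtain ⟨x, rfl⟩ := fold_surjective k H R c
    rw [← convProd_comp _ π π' (fold k H R) (comul_fold k H R), h.right, counitSq_fold]
  · obtain ⟨x, rfl⟩ := fold_surjective k H R c
    rw [← convProd_comp _ π' π (fold k H R) (comul_fold k H R), h.left, counitSq_fold]

/-- In the first leg the counit of `H` removes both `r₍₂₎₍₋₁₎` and `h₍₁₎`, which leaves `r₍₁₎ ⊗
(r₍₂₎ ⊗ h)`. -/
theorem projR_comul (r : R) (h : H) :
    TensorProduct.map (Bosonization.projR k H R).toLinearMap LinearMap.id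
      (Coalgebra.comul (R := k) (Bosonization.tmul r h : Bosonization k H R)) =
    LinearMap.lTensor R ((TensorProduct.mk k R H).flip h : R →ₗ[k] Bosonization k H R)
      (Coalgebra.comul r) := by
  refine (map_rid_counit_mid k H R (Coalgebra.comul r) (Coalgebra.comul h)).trans ?_
  rw [Coalgebra.rTensor_counit_comul, TensorProduct.lid_tmul, one_smul]

end Fold

/-! ### Deformation commutes with bosonization -/

section Smash

theorem map_comp_lTensor_tensorTensorTensorComm {k V W M M' N P : Type*} [Field k]
    [AddCommGroup V] [Module k V] [AddCommGroup W] [Module k W] [AddCommGroup M] [Module k M]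
    [AddCommGroup N] [Module k N] [AddCommGroup P] [Module k P]
    [AddCommGroup M'] [Module k M'] (f : V ⊗[k] W →ₗ[k] M)
    (p : P →ₗ[k] W) (g : V ⊗[k] N →ₗ[k] M') (X : V ⊗[k] V) (Y : P ⊗[k] N) :
    TensorProduct.map (f ∘ₗ LinearMap.lTensor V p) g
        (TensorProduct.tensorTensorTensorComm k V V P N (X ⊗ₜ Y)) =
      TensorProduct.map f g
        (TensorProduct.tensorTensorTensorComm k V V W N
          (X ⊗ₜ TensorProduct.map p LinearMap.id Y)) := by
  induction X using TensorProduct.induction_on with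
  | zero => simp
  | add x x' hx hy => simp only [map_add, add_tmul, hx, hy]
  | tmul a c =>
  induction Y using TensorProduct.induction_on with
  | zero => simp
  | add x x' hx hy => simp only [map_add, tmul_add, hx, hy]
  | tmul s t => simp

variable (k : Type*) (H : Type*) (R : Type*) [Field k] [Ring H] [HopfAlgebra k H]
  [Ring R] [Algebra k R] [Coalgebra k R] [Module H R] [IsScalarTower k H R]
  [YetterDrinfeld k H R]

omit [Coalgebra k R] in
set_option synthInstance.maxHeartbeats 200000 in
-- Here `h` is used in three legs: the first acts inside `π`, the second acts on the second leg of
-- `S`, the third multiplies `h'`. Coassociativity regroups the first two into the diagonal action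
-- of `h₍₁₎` on `S`.
theorem lid_map_mid_smashMul (π : R ⊗[k] R →ₗ[k] k) (X S : R ⊗[k] R) (h h' : H) :
    TensorProduct.lid k (R ⊗[k] H) (TensorProduct.map
      (π ∘ₗ LinearMap.lTensor R (act k H R) ∘ₗ (TensorProduct.assoc k R H R).toLinearMap)
      (smashMul k H (LinearMap.mul' k R)) (TensorProduct.tensorTensorTensorComm k _ _ _ _
        (mid (braid k H R H) (X ⊗ₜ Coalgebra.comul h) ⊗ₜ
          LinearMap.lTensor R ((TensorProduct.mk k R H).flip h') S))) =
    TensorProduct.map ((TensorProduct.lid k R).toLinearMap ∘ₗ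
        TensorProduct.map π (LinearMap.mul' k R) ∘ₗ mid (braid k H R R) ∘ₗ
        TensorProduct.mk k _ _ X ∘ₗ TensorProduct.map (act k H R) (act k H R) ∘ₗ
        (TensorProduct.tensorTensorTensorComm k H H R R).toLinearMap ∘ₗ
        (TensorProduct.mk k (H ⊗[k] H) (R ⊗[k] R)).flip S)
      ((LinearMap.mul k H).flip h') (LinearMap.rTensor H Coalgebra.comul
        (Coalgebra.comul (R := k) h)) := by
  rw [← Coalgebra.coassoc_symm_apply]
  induction X using TensorProduct.induction_on with
  | zero => simp
  | add x x' hx hy =>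
    simp only [map_add, add_tmul, hx, hy, LinearMap.comp_add, LinearMap.add_comp,
      TensorProduct.map_add_left, LinearMap.add_apply]
  | tmul a c =>
  induction S using TensorProduct.induction_on with
  | zero => simp
  | add x x' hx hy =>
    simp only [map_add, tmul_add, hx, hy, LinearMap.comp_add,
      TensorProduct.map_add_left, LinearMap.add_apply]
  | tmul s t =>
  generalize Coalgebra.comul (R := k) h = Y
  induction Y using TensorProduct.induction_on with
  | zero => simp
  | add x x' hx hy => simp only [map_add, add_tmul, tmul_add, hx, hy]
  | tmul y z =>
  obtain ⟨T, hT⟩ := TensorProduct.exists_finset (YetterDrinfeld.coact (k := k) (H := H) c)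
  obtain ⟨P, hP⟩ := TensorProduct.exists_finset (Coalgebra.comul (R := k) z)
  simp only [mid_tmul, braid_tmul, hT, hP, map_sum, sum_tmul, tmul_sum, LinearMap.rTensor_tmul,
    LinearMap.lTensor_tmul, TensorProduct.map_tmul, TensorProduct.tensorTensorTensorComm_tmul,
    TensorProduct.mk_apply, LinearMap.flip_apply, LinearMap.comp_apply, LinearEquiv.coe_coe,
    TensorProduct.assoc_tmul, TensorProduct.assoc_symm_tmul, act_tmul, TensorProduct.lid_tmul,
    smashMul_tmul, LinearMap.mul_apply', LinearMap.mul'_apply, AlgHom.toLinearMap_apply,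
    Algebra.lsmul_coe, smul_eq_mul, mul_smul, smul_tmul']
  rw [Finset.sum_comm]

variable [YDHopf k H R]

variable {k H R} in
theorem Bosonization.hom_ext {M : Type*} [AddCommGroup M] [Module k M]
    {f g : Bosonization k H R ⊗[k] Bosonization k H R →ₗ[k] M}
    (h : ∀ (r s : R) (a b : H), f (Bosonization.tmul r a ⊗ₜ Bosonization.tmul s b) =
      g (Bosonization.tmul r a ⊗ₜ Bosonization.tmul s b)) : f = g := by
  refine TensorProduct.ext' fun x y => ?_
  induction x using Bosonization.induction with
  | zero => simp
  | add x x' hx hy => simp only [add_tmul, map_add, hx, hy]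
  | tmul r a =>
  induction y using Bosonization.induction with
  | zero => simp
  | add x x' hx hy => simp only [tmul_add, map_add, hx, hy]
  | tmul s b => exact h r s a b

/-- The bosonization of a deformation of `R` is a deformation of the bosonization. -/
theorem crossedMul_Phi (π : R ⊗[k] R →ₗ[k] k) :
    crossedMul k (Bosonization k H R) (Phi k H R π) =
      (smashMul k H (braidedCrossedMul k H R π) : (R ⊗[k] H) ⊗[k] (R ⊗[k] H) →ₗ[k] R ⊗[k] H) := by
  refine Bosonization.hom_ext fun r s h g => ?_
  have h2 : LinearMap.mul' k (Bosonization k H R) =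
      (smashMul k H (LinearMap.mul' k R) : (R ⊗[k] H) ⊗[k] (R ⊗[k] H) →ₗ[k] R ⊗[k] H) :=
    TensorProduct.ext' fun _ _ => rfl
  -- The functional sees the first leg of `s ⊗ g` only through `projR`, so `projR_comul` lets the
  -- coproduct of `s ⊗ g` be replaced by `s₍₁₎ ⊗ (s₍₂₎ ⊗ g)`.
  have h3 := map_comp_lTensor_tensorTensorTensorComm (π ∘ₗ foldAct k H R)
    (Bosonization.projR k H R).toLinearMap (LinearMap.mul' k (Bosonization k H R))
    (Coalgebra.comul (R := k) (Bosonization.tmul r h)) (Coalgebra.comul (Bosonization.tmul s g))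
  rw [projR_comul, h2] at h3
  rw [Phi_eq, crossedMul, LinearMap.comp_apply, LinearMap.comp_apply, h2]
  refine (congrArg (TensorProduct.lid k (Bosonization k H R)) h3).trans ?_
  refine (lid_map_mid_smashMul k H R π (Coalgebra.comul r) (Coalgebra.comul s) h g).trans ?_
  refine Eq.trans ?_ (smashMul_tmul (braidedCrossedMul k H R π) r s h g).symm
  rw [← LinearMap.comp_apply, LinearMap.map_comp_rTensor]
  congr 2
  ext y
  -- Linearity of the comultiplication of `R` identifies the diagonal action on `s₍₁₎ ⊗ s₍₂₎` with
  -- the coproduct of `y • s`.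
  have h4 : Coalgebra.comul (R := k) (y • s) = TensorProduct.map (act k H R) (act k H R)
      (TensorProduct.tensorTensorTensorComm k H H R R (Coalgebra.comul y ⊗ₜ Coalgebra.comul s)) :=
    YDHopf.comul_smul y s
  change _ = TensorProduct.lid k R (TensorProduct.map π (LinearMap.mul' k R)
    (mid (braid k H R R) (Coalgebra.comul r ⊗ₜ Coalgebra.comul (y • s))))
  rw [h4]
  rfl

end Smash

/-! ### Functionals invariant or balanced along a coalgebra map `ι` -/

section Invariance

variable {k : Type*} {A H : Type*} [Field k] [Ring A] [Bialgebra k A] [AddCommGroup H] [Module k H]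
  [Coalgebra k H] (ι : H →ₗc[k] A) {σ σ' : A ⊗[k] A →ₗ[k] k}

/-- Invariance of `σ` says that it agrees after two coalgebra maps into `A ⊗ A`, so `comp_eq_comp`
passes it on to the convolution inverse. The right invariant and balanced cases below follow the
same pattern. -/
theorem IsConvInverse.mul_left
    (hσ : IsConvInverse Coalgebra.comul Coalgebra.counit (LinearMap.mul' k k) 1 σ σ')
    (h : ∀ g x y, σ ((ι g * x) ⊗ₜ y) = Coalgebra.counit (R := k) g * σ (x ⊗ₜ y)) (g : H) (x y : A) :
    σ' ((ι g * x) ⊗ₜ y) = Coalgebra.counit (R := k) g * σ' (x ⊗ₜ y) := by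
  let φ : (H ⊗[k] A) ⊗[k] A →ₗc[k] A ⊗[k] A := Coalgebra.TensorProduct.map
    ((Bialgebra.mulCoalgHom k A).comp (Coalgebra.TensorProduct.map ι (CoalgHom.id k A)))
    (CoalgHom.id k A)
  let ψ : (H ⊗[k] A) ⊗[k] A →ₗc[k] A ⊗[k] A := Coalgebra.TensorProduct.map
    ((Coalgebra.TensorProduct.lid k A).toCoalgHom.comp
      (Coalgebra.TensorProduct.map (Coalgebra.counitCoalgHom k H) (CoalgHom.id k A)))
    (CoalgHom.id k A)
  have hφ : ∀ g x y, φ ((g ⊗ₜ x) ⊗ₜ y) = (ι g * x) ⊗ₜ y := fun _ _ _ => rfl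
  have hψ : ∀ g x y, ψ ((g ⊗ₜ x) ⊗ₜ y) = (Coalgebra.counit (R := k) g • x) ⊗ₜ y :=
    fun _ _ _ => rfl
  have h1 : σ ∘ₗ φ.toLinearMap = σ ∘ₗ ψ.toLinearMap := by
    refine TensorProduct.ext_threefold fun g x y => ?_
    change σ (φ _) = σ (ψ _)
    rw [hφ, hψ, h, ← smul_tmul', map_smul, smul_eq_mul]
  have h2 := hσ.comp_eq_comp φ ψ (fun d => congr($h1 d)) ((g ⊗ₜ x) ⊗ₜ y)
  rwa [hφ, hψ, ← smul_tmul', map_smul, smul_eq_mul] at h2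

theorem IsConvInverse.mul_right
    (hσ : IsConvInverse Coalgebra.comul Coalgebra.counit (LinearMap.mul' k k) 1 σ σ')
    (h : ∀ g x y, σ (x ⊗ₜ (y * ι g)) = Coalgebra.counit (R := k) g * σ (x ⊗ₜ y)) (g : H) (x y : A) :
    σ' (x ⊗ₜ (y * ι g)) = Coalgebra.counit (R := k) g * σ' (x ⊗ₜ y) := by
  let φ : A ⊗[k] (A ⊗[k] H) →ₗc[k] A ⊗[k] A := Coalgebra.TensorProduct.map (CoalgHom.id k A)
    ((Bialgebra.mulCoalgHom k A).comp (Coalgebra.TensorProduct.map (CoalgHom.id k A) ι))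
  let ψ : A ⊗[k] (A ⊗[k] H) →ₗc[k] A ⊗[k] A := Coalgebra.TensorProduct.map (CoalgHom.id k A)
    ((Coalgebra.TensorProduct.rid k k A).toCoalgHom.comp
      (Coalgebra.TensorProduct.map (CoalgHom.id k A) (Coalgebra.counitCoalgHom k H)))
  have hφ : ∀ g x y, φ (x ⊗ₜ (y ⊗ₜ g)) = x ⊗ₜ (y * ι g) := fun _ _ _ => rfl
  have hψ : ∀ g x y, ψ (x ⊗ₜ (y ⊗ₜ g)) = x ⊗ₜ (Coalgebra.counit (R := k) g • y) :=
    fun _ _ _ => rfl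
  have h1 : σ ∘ₗ φ.toLinearMap = σ ∘ₗ ψ.toLinearMap := by
    refine TensorProduct.ext' fun x z => ?_
    change σ (φ _) = σ (ψ _)
    induction z using TensorProduct.induction_on with
    | zero => simp
    | add z z' hx hy => simp only [tmul_add, map_add, hx, hy]
    | tmul y g => rw [hφ, hψ, h, tmul_smul, map_smul, smul_eq_mul]
  have h2 := hσ.comp_eq_comp φ ψ (fun d => congr($h1 d)) (x ⊗ₜ (y ⊗ₜ g))
  rwa [hφ, hψ, tmul_smul, map_smul, smul_eq_mul] at h2

theorem IsConvInverse.mul_mid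
    (hσ : IsConvInverse Coalgebra.comul Coalgebra.counit (LinearMap.mul' k k) 1 σ σ')
    (h : ∀ g x y, σ ((x * ι g) ⊗ₜ y) = σ (x ⊗ₜ (ι g * y))) (g : H) (x y : A) :
    σ' ((x * ι g) ⊗ₜ y) = σ' (x ⊗ₜ (ι g * y)) := by
  let φ : (A ⊗[k] H) ⊗[k] A →ₗc[k] A ⊗[k] A := Coalgebra.TensorProduct.map
    ((Bialgebra.mulCoalgHom k A).comp (Coalgebra.TensorProduct.map (CoalgHom.id k A) ι))
    (CoalgHom.id k A)
  let ψ : (A ⊗[k] H) ⊗[k] A →ₗc[k] A ⊗[k] A := (Coalgebra.TensorProduct.map (CoalgHom.id k A)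
    ((Bialgebra.mulCoalgHom k A).comp (Coalgebra.TensorProduct.map ι (CoalgHom.id k A)))).comp
    (Coalgebra.TensorProduct.assoc k k A H A).toCoalgHom
  have hφ : ∀ g x y, φ ((x ⊗ₜ g) ⊗ₜ y) = (x * ι g) ⊗ₜ y := fun _ _ _ => rfl
  have hψ : ∀ g x y, ψ ((x ⊗ₜ g) ⊗ₜ y) = x ⊗ₜ (ι g * y) := fun _ _ _ => rfl
  have h1 : σ ∘ₗ φ.toLinearMap = σ ∘ₗ ψ.toLinearMap := by
    refine TensorProduct.ext_threefold fun x g y => ?_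
    change σ (φ _) = σ (ψ _)
    rw [hφ, hψ, h]
  have h3 : ∀ d, σ (φ d) = σ (ψ d) := fun d => LinearMap.congr_fun h1 d
  have h2 := hσ.comp_eq_comp φ ψ h3 ((x ⊗ₜ g) ⊗ₜ y)
  rwa [hφ, hψ] at h2

theorem crossedMul_tmul (σ : A ⊗[k] A →ₗ[k] k) (x y : A) :
    crossedMul k A σ (x ⊗ₜ y) = TensorProduct.lid k A
      (TensorProduct.map σ (LinearMap.mul' k A) (TensorProduct.tensorTensorTensorComm k A A A A
        (Coalgebra.comul x ⊗ₜ Coalgebra.comul y))) := rfl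

/-- In the coproduct of `ι g * x` invariance turns the leg `g₍₁₎` inside `σ` into `ε(g₍₁₎)`, which
leaves `ι g` in front of the product. -/
theorem crossedMul_mul_left
    (h : ∀ g x y, σ ((ι g * x) ⊗ₜ y) = Coalgebra.counit (R := k) g * σ (x ⊗ₜ y)) (g : H) (x y : A) :
    crossedMul k A σ ((ι g * x) ⊗ₜ y) = ι g * crossedMul k A σ (x ⊗ₜ y) := by
  have hg : TensorProduct.lid k H (LinearMap.rTensor H Coalgebra.counit
    (Coalgebra.comul (R := k) g)) = g := by simp
  conv_rhs => rw [← hg]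
  rw [crossedMul_tmul, crossedMul_tmul, Bialgebra.comul_mul, ← CoalgHomClass.map_comp_comul_apply]
  generalize Coalgebra.comul (R := k) g = G
  generalize Coalgebra.comul (R := k) x = X
  generalize Coalgebra.comul (R := k) y = Y
  induction X using TensorProduct.induction_on with
  | zero => simp
  | add x y hx hy => simp only [map_add, add_tmul, mul_add, hx, hy]
  | tmul x x' =>
  induction Y using TensorProduct.induction_on with
  | zero => simp
  | add x y hx hy => simp only [map_add, tmul_add, mul_add, hx, hy]
  | tmul y y' =>
  induction G using TensorProduct.induction_on with
  | zero => simp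
  | add x y hx hy => simp only [map_add, add_mul, add_tmul, hx, hy]
  | tmul g g' => simp [h, mul_assoc, smul_smul, mul_comm]

/-- Where `σ` is trivial the deformed product is the original one. This and `crossedMul_right` tie
cocycles in `Z'` to the condition on sections in `C'`. -/
theorem crossedMul_left (h : ∀ g x, σ (ι g ⊗ₜ x) =
    Coalgebra.counit (R := k) g * Coalgebra.counit (R := k) x) (g : H) (x : A) :
    crossedMul k A σ (ι g ⊗ₜ x) = ι g * x := by
  have hg : TensorProduct.lid k H (LinearMap.rTensor H Coalgebra.counit
    (Coalgebra.comul (R := k) g)) = g := by simp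
  have hx : TensorProduct.lid k A (LinearMap.rTensor A Coalgebra.counit
    (Coalgebra.comul (R := k) x)) = x := by simp
  conv_rhs => rw [← hg, ← hx]
  rw [crossedMul_tmul, ← CoalgHomClass.map_comp_comul_apply]
  generalize Coalgebra.comul (R := k) g = G
  generalize Coalgebra.comul (R := k) x = X
  induction X using TensorProduct.induction_on with
  | zero => simp
  | add x y hx hy => simp only [map_add, tmul_add, mul_add, hx, hy]
  | tmul x x' =>
  induction G using TensorProduct.induction_on with
  | zero => simp
  | add x y hx hy => simp only [map_add, add_mul, add_tmul, hx, hy]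
  | tmul g g' => simp [h, smul_smul, mul_comm]

theorem crossedMul_right (h : ∀ g x, σ (x ⊗ₜ ι g) =
    Coalgebra.counit (R := k) g * Coalgebra.counit (R := k) x) (g : H) (x : A) :
    crossedMul k A σ (x ⊗ₜ ι g) = x * ι g := by
  have hg : TensorProduct.lid k H (LinearMap.rTensor H Coalgebra.counit
    (Coalgebra.comul (R := k) g)) = g := by simp
  have hx : TensorProduct.lid k A (LinearMap.rTensor A Coalgebra.counit
    (Coalgebra.comul (R := k) x)) = x := by simp
  conv_rhs => rw [← hg, ← hx]
  rw [crossedMul_tmul, ← CoalgHomClass.map_comp_comul_apply]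
  generalize Coalgebra.comul (R := k) g = G
  generalize Coalgebra.comul (R := k) x = X
  induction X using TensorProduct.induction_on with
  | zero => simp
  | add x y hx hy => simp only [map_add, add_tmul, add_mul, hx, hy]
  | tmul x x' =>
  induction G using TensorProduct.induction_on with
  | zero => simp
  | add x y hx hy => simp only [map_add, mul_add, tmul_add, hx, hy]
  | tmul g g' => simp [h, smul_smul, mul_comm]

end Invariance

/-! ### Invariance of functionals on `R # H` under `H` -/

section BosonizationInvariance

variable (k : Type*) (H : Type*) (R : Type*) [Field k] [Ring H] [HopfAlgebra k H]
  [Ring R] [Algebra k R] [Coalgebra k R] [Module H R] [IsScalarTower k H R]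
  [YetterDrinfeld k H R] [YDHopf k H R]

/-- The inclusion `h ↦ 1 ⊗ h` as a coalgebra map. -/
def inclHCoalg : H →ₗc[k] Bosonization k H R :=
  { toLinearMap := (Bosonization.inclH k H R).toLinearMap
    counit_comp := by
      ext h
      change Coalgebra.counit (R := k) (1 : R) * Coalgebra.counit h = _
      rw [YDHopf.counit_one (k := k) (H := H), one_mul]
    map_comp_comul := by
      ext h
      change TensorProduct.map (TensorProduct.mk k R H 1) (TensorProduct.mk k R H 1)
        (Coalgebra.comul h) = smashCoact k H Coalgebra.comul ((1 : R) ⊗ₜ[k] h)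
      rw [smashCoact_tmul, YDHopf.comul_one (k := k) (H := H)]
      generalize Coalgebra.comul (R := k) h = X
      induction X using TensorProduct.induction_on with
      | zero => simp
      | add x x' hx hy => simp only [map_add, tmul_add, hx, hy]
      | tmul a b => simp [braid_tmul, YDHopf.coact_one] }

theorem inclHCoalg_apply (h : H) : inclHCoalg k H R h = Bosonization.tmul 1 h := rfl

theorem inclHCoalg_one : inclHCoalg k H R 1 = 1 := rfl

theorem counit_inclHCoalg (h : H) :
    Coalgebra.counit (R := k) (inclHCoalg k H R h) = Coalgebra.counit (R := k) h :=
  CoalgHomClass.counit_comp_apply _ _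

theorem tmul_mul_inclHCoalg (r : R) (g h : H) :
    Bosonization.tmul r g * inclHCoalg k H R h = Bosonization.tmul r (g * h) := by
  rw [← Bosonization.tmul_mul_one_tmul, mul_assoc, ← Bosonization.tmul_mul_one_tmul k H R r (g * h)]
  exact congrArg _ (map_mul (Bosonization.inclH k H R) g h).symm

variable {k H} in
theorem inclHCoalg_mul_tmul (r : R) (g h : H) (P : Finset (H × H))
    (hP : Coalgebra.comul (R := k) h = ∑ i ∈ P, i.1 ⊗ₜ[k] i.2) :
    inclHCoalg k H R h * Bosonization.tmul r g =
      ∑ i ∈ P, (Bosonization.tmul (i.1 • r) (i.2 * g) : Bosonization k H R) := by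
  rw [inclHCoalg_apply, Bosonization.tmul_mul_tmul k H R 1 r h g P hP]
  simp

variable {k} in
theorem sum_counit_right {C : Type*} [AddCommGroup C] [Module k C] [Coalgebra k C] {c : C}
    {P : Finset (C × C)} (hP : Coalgebra.comul (R := k) c = ∑ i ∈ P, i.1 ⊗ₜ[k] i.2) :
    ∑ i ∈ P, Coalgebra.counit (R := k) i.2 • i.1 = c := by
  have := congr(TensorProduct.rid k C $(Coalgebra.lTensor_counit_comul (R := k) c))
  simpa [hP] using this

variable {k H R} (π : R ⊗[k] R →ₗ[k] k)

theorem Phi_mul_right (g : H) (x y : Bosonization k H R) :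
    Phi k H R π (x ⊗ₜ (y * inclHCoalg k H R g)) =
      Coalgebra.counit (R := k) g * Phi k H R π (x ⊗ₜ y) := by
  induction x using Bosonization.induction with
  | zero => simp
  | add x x' hx hy => simp only [add_tmul, map_add, mul_add, hx, hy]
  | tmul r a =>
  induction y using Bosonization.induction with
  | zero => simp
  | add x x' hx hy => simp only [tmul_add, map_add, mul_add, add_mul, hx, hy]
  | tmul s b =>
  rw [tmul_mul_inclHCoalg, Phi_tmul, Phi_tmul, Bialgebra.counit_mul]
  ring

/-- The `H`-part of the first argument of `Φ(π)` acts on the second argument, so elements of `H` may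
cross the tensor sign. This holds for every functional `π`. -/
theorem Phi_mul_mid (g : H) (x y : Bosonization k H R) :
    Phi k H R π ((x * inclHCoalg k H R g) ⊗ₜ y) = Phi k H R π (x ⊗ₜ (inclHCoalg k H R g * y)) := by
  induction x using Bosonization.induction with
  | zero => simp
  | add x x' hx hy => simp only [add_tmul, map_add, add_mul, hx, hy]
  | tmul r a =>
  induction y using Bosonization.induction with
  | zero => simp
  | add x x' hx hy => simp only [tmul_add, map_add, mul_add, hx, hy]
  | tmul s b =>
  obtain ⟨P, hP⟩ := TensorProduct.exists_finset (Coalgebra.comul (R := k) g)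
  rw [tmul_mul_inclHCoalg, inclHCoalg_mul_tmul R s b g P hP, Phi_tmul, tmul_sum, map_sum]
  conv_lhs => rw [← sum_counit_right hP]
  simp only [Phi_tmul, Finset.mul_sum, Finset.sum_smul, tmul_sum, map_sum, Finset.sum_mul,
    Bialgebra.counit_mul, mul_smul_comm, smul_assoc, tmul_smul, map_smul, smul_eq_mul, mul_smul]
  refine Finset.sum_congr rfl fun i _ => ?_
  ring

/-- Since `(1 ⊗ g)(r ⊗ a) = g₍₁₎ • r ⊗ g₍₂₎ a`, left multiplication by `g` becomes the diagonal
action on `r ⊗ a • s`. -/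
theorem Phi_mul_left_iff : (∀ (g : H) (x y : Bosonization k H R),
      Phi k H R π ((inclHCoalg k H R g * x) ⊗ₜ y) =
        Coalgebra.counit (R := k) g * Phi k H R π (x ⊗ₜ y)) ↔
    ∀ (h : H) x, π (diagAct k H R R h x) = Coalgebra.counit (R := k) h * π x := by
  have key : ∀ (g a b : H) (r s : R), Phi k H R π ((inclHCoalg k H R g * Bosonization.tmul r a) ⊗ₜ
      Bosonization.tmul s b) =
      π (diagAct k H R R g (r ⊗ₜ (a • s))) * Coalgebra.counit (R := k) b := by
    intro g a b r s
    obtain ⟨P, hP⟩ := TensorProduct.exists_finset (Coalgebra.comul (R := k) g)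
    rw [inclHCoalg_mul_tmul R r a g P hP, sum_tmul, map_sum, diagAct_eq, hP]
    simp [Phi_tmul, Finset.sum_mul, mul_smul]
  constructor
  · intro h g x
    induction x using TensorProduct.induction_on with
    | zero => simp
    | add x x' hx hy => simp only [map_add, mul_add, hx, hy]
    | tmul r s =>
    have := h g (Bosonization.tmul r 1) (Bosonization.tmul s 1)
    rw [key, Phi_tmul] at this
    simpa using this
  · intro h g x y
    induction x using Bosonization.induction with
    | zero => simp
    | add x x' hx hy => simp only [add_tmul, map_add, mul_add, hx, hy]
    | tmul r a =>
    induction y using Bosonization.induction with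
    | zero => simp
    | add x x' hx hy => simp only [tmul_add, map_add, mul_add, hx, hy]
    | tmul s b => rw [key, h, Phi_tmul, mul_assoc]

variable (k H R) in
/-- The restriction of a functional on `(R # H) ⊗ (R # H)` to `R ⊗ R`. -/
def restrictR (σ : Bosonization k H R ⊗[k] Bosonization k H R →ₗ[k] k) : R ⊗[k] R →ₗ[k] k :=
  σ ∘ₗ TensorProduct.map (Bosonization.inclR k H R).toLinearMap
    (Bosonization.inclR k H R).toLinearMap

theorem restrictR_tmul (σ : Bosonization k H R ⊗[k] Bosonization k H R →ₗ[k] k) (r s : R) :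
    restrictR k H R σ (r ⊗ₜ s) = σ (Bosonization.tmul r 1 ⊗ₜ Bosonization.tmul s 1) := rfl

theorem restrictR_Phi : restrictR k H R (Phi k H R π) = π := by
  refine TensorProduct.ext' fun r s => ?_
  rw [restrictR_tmul, Phi_tmul]
  simp

/-- Write `r ⊗ a = (r ⊗ 1)(1 ⊗ a)`, move `a` to the second argument by balancing, and remove the
`H`-factors remaining on the right by right invariance: only values on `R ⊗ R` survive. -/
theorem Phi_restrictR {σ : Bosonization k H R ⊗[k] Bosonization k H R →ₗ[k] k}
    (hm : ∀ g x y, σ ((x * inclHCoalg k H R g) ⊗ₜ y) = σ (x ⊗ₜ (inclHCoalg k H R g * y)))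
    (hr : ∀ g x y, σ (x ⊗ₜ (y * inclHCoalg k H R g)) =
      Coalgebra.counit (R := k) g * σ (x ⊗ₜ y)) : Phi k H R (restrictR k H R σ) = σ := by
  refine Bosonization.hom_ext fun r s a b => ?_
  obtain ⟨P, hP⟩ := TensorProduct.exists_finset (Coalgebra.comul (R := k) a)
  have h1 : ∀ (r : R) (a : H), (Bosonization.tmul r a : Bosonization k H R) =
      Bosonization.tmul r 1 * inclHCoalg k H R a := fun r a =>
    (Bosonization.tmul_mul_one_tmul k H R r a).symm
  rw [Phi_tmul, restrictR_tmul, h1 s b, hr, h1 r a, hm, inclHCoalg_mul_tmul R s 1 a P hP, mul_comm]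
  congr 1
  have h2 : (Bosonization.tmul (a • s) 1 : Bosonization k H R) =
      ∑ i ∈ P, Coalgebra.counit (R := k) i.2 • Bosonization.tmul (i.1 • s) 1 := by
    conv_lhs => rw [← sum_counit_right hP]
    change (_ ⊗ₜ[k] _ : R ⊗[k] H) = _
    simp only [Finset.sum_smul, sum_tmul, smul_assoc, ← smul_tmul']
    rfl
  rw [h2, tmul_sum, map_sum, tmul_sum, map_sum]
  refine Finset.sum_congr rfl fun i _ => ?_
  rw [mul_one, h1 (i.1 • s) i.2, hr, tmul_smul, map_smul, smul_eq_mul]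

end BosonizationInvariance

/-! ### The bijection `Φ` between braided cocycles and `Z'` -/

section PhiBijection

variable {k : Type*} {H : Type*} {R : Type*} [Field k] [Ring H] [HopfAlgebra k H]
  [Ring R] [Algebra k R] [Coalgebra k R] [Module H R] [IsScalarTower k H R]
  [YetterDrinfeld k H R] [YDHopf k H R]

theorem crossedMul_Phi_tmul (π : R ⊗[k] R →ₗ[k] k) (r s : R) (h g : H) (P : Finset (H × H))
    (hP : Coalgebra.comul (R := k) h = ∑ i ∈ P, i.1 ⊗ₜ[k] i.2) :
    crossedMul k (Bosonization k H R) (Phi k H R π)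
      (Bosonization.tmul r h ⊗ₜ Bosonization.tmul s g) =
      ∑ i ∈ P, Bosonization.tmul (braidedCrossedMul k H R π (r ⊗ₜ (i.1 • s))) (i.2 * g) := by
  rw [crossedMul_Phi]
  refine (smashMul_tmul (braidedCrossedMul k H R π) r s h g).trans ?_
  rw [hP, map_sum]
  rfl

theorem crossedMul_Phi_tmul_one (π : R ⊗[k] R →ₗ[k] k) (r s : R) :
    crossedMul k (Bosonization k H R) (Phi k H R π)
      (Bosonization.tmul r 1 ⊗ₜ Bosonization.tmul s 1) =
      Bosonization.tmul (braidedCrossedMul k H R π (r ⊗ₜ s)) 1 := by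
  rw [crossedMul_Phi_tmul π r s 1 1 {(1, 1)}
    (by simp [Bialgebra.comul_one, Algebra.TensorProduct.one_def])]
  simp

theorem projR_tmul (r : R) (h : H) : Bosonization.projR k H R (Bosonization.tmul r h) =
    Coalgebra.counit (R := k) h • r := rfl

theorem tmul_one_injective :
    Function.Injective fun r : R => (Bosonization.tmul r 1 : Bosonization k H R) := by
  intro r s h
  simpa [projR_tmul] using congr(Bosonization.projR k H R $h)

/-- The deformed multiplication of `R` is `H`-linear. -/
theorem smul_braidedCrossedMul {π : R ⊗[k] R →ₗ[k] k}
    (hπ : ∀ (h : H) x, π (diagAct k H R R h x) = Coalgebra.counit (R := k) h * π x)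
    (h : H) (x : R ⊗[k] R) : h • braidedCrossedMul k H R π x =
      braidedCrossedMul k H R π (diagAct k H R R h x) := by
  induction x using TensorProduct.induction_on with
  | zero => simp
  | add x x' hx hy => simp only [map_add, smul_add, hx, hy]
  | tmul r s =>
  obtain ⟨P, hP⟩ := TensorProduct.exists_finset (Coalgebra.comul (R := k) h)
  -- The deformed product of `R # H` commutes with left multiplication by `1 ⊗ h`; projecting this
  -- identity to `R` gives linearity of the deformed product of `R`.
  have h1 := crossedMul_mul_left (inclHCoalg k H R) ((Phi_mul_left_iff (H := H) π).mpr hπ) h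
    (Bosonization.tmul r 1) (Bosonization.tmul s 1)
  rw [crossedMul_Phi_tmul_one, inclHCoalg_mul_tmul R _ _ h P hP,
    inclHCoalg_mul_tmul R _ _ h P hP, sum_tmul, map_sum] at h1
  have h2 : ∀ a b : H, Bosonization.projR k H R (crossedMul k (Bosonization k H R) (Phi k H R π)
      (Bosonization.tmul (a • r) b ⊗ₜ Bosonization.tmul s 1)) =
      braidedCrossedMul k H R π ((a • r) ⊗ₜ (b • s)) := by
    intro a b
    obtain ⟨Q, hQ⟩ := TensorProduct.exists_finset (Coalgebra.comul (R := k) b)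
    rw [crossedMul_Phi_tmul π _ _ _ _ Q hQ]
    conv_rhs => rw [← sum_counit_right hQ]
    simp only [map_sum, projR_tmul, mul_one, Finset.sum_smul, tmul_sum, smul_assoc, tmul_smul,
      map_smul]
  have h3 := congr(Bosonization.projR k H R $h1)
  simp only [map_sum, h2, projR_tmul, mul_one] at h3
  have h4 : h • braidedCrossedMul k H R π (r ⊗ₜ s) = ∑ i ∈ P, Coalgebra.counit (R := k) i.2 •
      i.1 • braidedCrossedMul k H R π (r ⊗ₜ s) := by
    conv_lhs => rw [← sum_counit_right hP]
    simp only [Finset.sum_smul, smul_assoc]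
  rw [h4, ← h3, diagAct_eq, hP]
  simp

/-- For arguments `r ⊗ a`, `s ⊗ b`, `t ⊗ c`, the identity is the braided one at `(r, a₍₁₎ • s, a₍₂₎
b • t)` times `ε(c)`. The right-hand side takes this form because the deformed product of `R` is
`H`-linear. -/
theorem isCocycle_Phi {π : R ⊗[k] R →ₗ[k] k} (h : IsBraidedCocycle k H R π) :
    IsCocycle k (Bosonization k H R) (Phi k H R π) where
  invertible := by
    obtain ⟨π', -, hπ'⟩ := h.invertible
    exact ⟨Phi k H R π', (isConvInverse_Phi_iff k H R π π').mpr hπ'⟩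
  cocycle x y z := by
    induction x using Bosonization.induction with
    | zero => simp
    | add x x' hx hy => simp only [add_tmul, map_add, hx, hy]
    | tmul r a =>
    induction y using Bosonization.induction with
    | zero => simp
    | add x x' hx hy => simp only [tmul_add, add_tmul, map_add, hx, hy]
    | tmul s b =>
    induction z using Bosonization.induction with
    | zero => simp
    | add x x' hx hy => simp only [tmul_add, map_add, hx, hy]
    | tmul t c =>
    obtain ⟨P, hP⟩ := TensorProduct.exists_finset (Coalgebra.comul (R := k) a)
    obtain ⟨Q, hQ⟩ := TensorProduct.exists_finset (Coalgebra.comul (R := k) b)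
    have h1 : ∑ i ∈ Q, Phi k H R π (Bosonization.tmul r a ⊗ₜ
        Bosonization.tmul (braidedCrossedMul k H R π (s ⊗ₜ (i.1 • t))) (i.2 * c)) =
        π (r ⊗ₜ (a • braidedCrossedMul k H R π (s ⊗ₜ (b • t)))) *
          Coalgebra.counit (R := k) c := by
      conv_rhs => rw [← sum_counit_right hQ]
      simp only [Phi_tmul, Finset.sum_smul, tmul_sum, map_sum, Finset.smul_sum, Finset.sum_mul,
        Bialgebra.counit_mul, smul_assoc, tmul_smul, map_smul, smul_eq_mul, smul_comm a]
      exact Finset.sum_congr rfl fun i _ => by ring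
    rw [crossedMul_Phi_tmul π r s a b P hP, crossedMul_Phi_tmul π s t b c Q hQ, tmul_sum, map_sum,
      h1, smul_braidedCrossedMul h.linear, diagAct_eq, hP, sum_tmul, map_sum]
    simp only [Phi_tmul, map_sum, TensorProduct.map_tmul, LinearMap.flip_apply,
      AlgHom.toLinearMap_apply, Algebra.lsmul_coe, tmul_sum, ← h.cocycle, Finset.sum_mul, mul_smul]
  normalized := by
    rw [Bosonization.one_def, Phi_tmul, one_smul, h.normalized, Bialgebra.counit_one, one_mul]

theorem Phi_prime (π : R ⊗[k] R →ₗ[k] k) (r r' : R) (h h' : H) :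
    Phi k H R π (Bosonization.tmul r h ⊗ₜ Bosonization.tmul r' h') =
      Phi k H R π (Bosonization.tmul r 1 ⊗ₜ Bosonization.tmul (h • r') 1) *
        Coalgebra.counit (R := k) h' := by
  simp [Phi_tmul]

theorem Phi_restrictR_of_prime {σ : Bosonization k H R ⊗[k] Bosonization k H R →ₗ[k] k}
    (h : ∀ (r r' : R) (h h' : H), σ (Bosonization.tmul r h ⊗ₜ Bosonization.tmul r' h') =
      σ (Bosonization.tmul r 1 ⊗ₜ Bosonization.tmul (h • r') 1) * Coalgebra.counit (R := k) h') :
    Phi k H R (restrictR k H R σ) = σ := by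
  refine Bosonization.hom_ext fun r s a b => ?_
  rw [Phi_tmul, restrictR_tmul, h r s a b]

theorem IsCocycle.inclH_tmul {σ : Bosonization k H R ⊗[k] Bosonization k H R →ₗ[k] k}
    (h : IsCocycle k (Bosonization k H R) σ)
    (hm : ∀ g x y, σ ((x * inclHCoalg k H R g) ⊗ₜ y) = σ (x ⊗ₜ (inclHCoalg k H R g * y)))
    (g : H) (x : Bosonization k H R) : σ (inclHCoalg k H R g ⊗ₜ x) =
      Coalgebra.counit (R := k) g * Coalgebra.counit (R := k) x := by
  have := hm g 1 x
  rw [one_mul, h.one_tmul, Bialgebra.counit_mul, counit_inclHCoalg] at this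
  exact this

theorem IsCocycle.tmul_inclH {σ : Bosonization k H R ⊗[k] Bosonization k H R →ₗ[k] k}
    (h : IsCocycle k (Bosonization k H R) σ)
    (hr : ∀ g x y, σ (x ⊗ₜ (y * inclHCoalg k H R g)) =
      Coalgebra.counit (R := k) g * σ (x ⊗ₜ y))
    (g : H) (x : Bosonization k H R) : σ (x ⊗ₜ inclHCoalg k H R g) =
      Coalgebra.counit (R := k) g * Coalgebra.counit (R := k) x := by
  have := hr g x 1
  rwa [one_mul, h.tmul_one] at this

/-- Left invariance is automatic for a balanced cocycle: `ι g * x` is also the deformed product, and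
the cocycle identity moves `x` to the second argument, where `σ(ι g, -)` is trivial. -/
theorem IsCocycle.inclH_mul {σ : Bosonization k H R ⊗[k] Bosonization k H R →ₗ[k] k}
    (h : IsCocycle k (Bosonization k H R) σ)
    (hm : ∀ g x y, σ ((x * inclHCoalg k H R g) ⊗ₜ y) = σ (x ⊗ₜ (inclHCoalg k H R g * y)))
    (g : H) (x y : Bosonization k H R) : σ ((inclHCoalg k H R g * x) ⊗ₜ y) =
      Coalgebra.counit (R := k) g * σ (x ⊗ₜ y) := by
  rw [← crossedMul_left _ (h.inclH_tmul hm), h.cocycle, h.inclH_tmul hm, counit_crossedMul]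

/-- Linearity is left invariance of `Φ(π)`, and the braided cocycle identity is the ordinary one on
elements `r ⊗ 1`. -/
theorem isBraidedCocycle_of_isCocycle_Phi {π : R ⊗[k] R →ₗ[k] k}
    (h : IsCocycle k (Bosonization k H R) (Phi k H R π)) : IsBraidedCocycle k H R π where
  linear := (Phi_mul_left_iff (H := H) π).mp (h.inclH_mul (Phi_mul_mid (H := H) π))
  invertible := by
    obtain ⟨σ', hσ'⟩ := h.invertible
    -- The inverse `σ'` inherits balancing and right invariance, so it is `Φ` of its own
    -- restriction; this restriction is the inverse of `π`.
    have h1 := Phi_restrictR (hσ'.mul_mid _ (Phi_mul_mid (H := H) π))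
      (hσ'.mul_right _ (Phi_mul_right (H := H) π))
    refine ⟨restrictR k H R σ', (Phi_mul_left_iff (H := H) _).mp ?_, ?_⟩
    · rw [h1]
      exact hσ'.mul_left _ (h.inclH_mul (Phi_mul_mid (H := H) π))
    · rwa [← isConvInverse_Phi_iff, h1]
  cocycle x y z := by
    have := h.cocycle (Bosonization.tmul x 1) (Bosonization.tmul y 1) (Bosonization.tmul z 1)
    rw [crossedMul_Phi_tmul_one, crossedMul_Phi_tmul_one, Phi_tmul, Phi_tmul] at this
    simpa using this
  normalized := by
    have := h.normalized
    rw [Bosonization.one_def, Phi_tmul] at this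
    simpa using this

theorem isConvInverse_linear {π π' : R ⊗[k] R →ₗ[k] k}
    (hπ : ∀ (h : H) x, π (diagAct k H R R h x) = Coalgebra.counit (R := k) h * π x)
    (h : IsConvInverse (comulSq k H R) (counitSq k R) (LinearMap.mul' k k) 1 π π') (g : H)
    (x : R ⊗[k] R) : π' (diagAct k H R R g x) = Coalgebra.counit (R := k) g * π' x :=
  (Phi_mul_left_iff (H := H) π').mp (((isConvInverse_Phi_iff k H R π π').mpr h).mul_left _
    ((Phi_mul_left_iff (H := H) π).mpr hπ)) g x

variable (k H R) in
theorem Phi_bijOn : Set.BijOn (Phi k H R) {π | IsBraidedCocycle k H R π}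
    (CocyclesPrime k H R) := by
  refine ⟨fun π hπ => ⟨isCocycle_Phi hπ, Phi_prime π⟩, fun π _ π' _ h => ?_, fun σ hσ => ?_⟩
  · rw [← restrictR_Phi (H := H) π, h, restrictR_Phi]
  · have h := Phi_restrictR_of_prime hσ.2
    refine ⟨restrictR k H R σ, isBraidedCocycle_of_isCocycle_Phi ?_, h⟩
    rw [h]
    exact hσ.1

end PhiBijection

/-! ### The correspondence between `Z'` and `C'` -/

section AlphaPrime

variable (k : Type u) (H : Type v) (R : Type w) [Field k] [Ring H] [HopfAlgebra k H]
  [Ring R] [Algebra k R] [Coalgebra k R] [Module H R] [IsScalarTower k H R]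
  [YetterDrinfeld k H R] [YDHopf k H R]

theorem alpha_mapsTo_prime : Set.MapsTo (alpha k (Bosonization k H R)) (CocyclesPrime k H R)
    (CleftClassesPrime k H R) := by
  rintro σ ⟨hσ, hp⟩
  have e := Phi_restrictR_of_prime hp
  have hm := Phi_mul_mid (H := H) (restrictR k H R σ)
  have hr := Phi_mul_right (H := H) (restrictR k H R σ)
  rw [e] at hm hr
  refine ⟨crossedData σ, crossedData_isCleft hσ, fun r h h' h'' => ?_, rfl⟩
  change inclHCoalg k H R h * Bosonization.tmul r h' * inclHCoalg k H R h'' =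
    crossedMul k (Bosonization k H R) σ (crossedMul k (Bosonization k H R) σ
      (inclHCoalg k H R h ⊗ₜ Bosonization.tmul r h') ⊗ₜ inclHCoalg k H R h'')
  rw [crossedMul_left _ (hσ.inclH_tmul hm), crossedMul_right _ (hσ.tmul_inclH hr)]

/-- For surjectivity, the condition on the section says that products with `1 ⊗ h` on either side
are not deformed. With the cocycle identity this makes `σ` balanced and right invariant, hence a
value of `Φ`. -/
theorem alpha_bijOn_prime : Set.BijOn (alpha k (Bosonization k H R)) (CocyclesPrime k H R)
    (CleftClassesPrime k H R) := by
  refine ⟨alpha_mapsTo_prime k H R, alpha_injective.injOn, ?_⟩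
  rintro _ ⟨X, hX, hp, rfl⟩
  obtain ⟨σ, hσ, h⟩ := exists_cocycle_of_isCleft hX
  refine ⟨σ, ⟨hσ, ?_⟩, h⟩
  obtain ⟨e, h1, h2, -, h4⟩ := Quotient.exact h
  replace h1 : ∀ a b : Bosonization k H R, e (crossedMul k (Bosonization k H R) σ (a ⊗ₜ b)) =
    X.mul (e a ⊗ₜ e b) := h1
  replace h4 : ∀ x : Bosonization k H R, e x = X.sec x := h4
  have key : ∀ (h h'' : H) (x : Bosonization k H R),
      inclHCoalg k H R h * x * inclHCoalg k H R h'' =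
      crossedMul k (Bosonization k H R) σ (crossedMul k (Bosonization k H R) σ
        (inclHCoalg k H R h ⊗ₜ x) ⊗ₜ inclHCoalg k H R h'') := by
    intro h h'' x
    induction x using Bosonization.induction with
    | zero => simp
    | add x y hx hy => simp only [mul_add, add_mul, tmul_add, add_tmul, map_add, hx, hy]
    | tmul r h' =>
    apply e.injective
    rw [h1, h1]
    refine (h4 _).trans ((hp r h h' h'').trans ?_)
    rw [h4, h4, h4]
    rfl
  have hl : ∀ h x, inclHCoalg k H R h * x =
      crossedMul k (Bosonization k H R) σ (inclHCoalg k H R h ⊗ₜ x) := by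
    intro h x
    have := key h 1 x
    rwa [inclHCoalg_one, mul_one, crossedMul_tmul_one hσ.tmul_one] at this
  have hr : ∀ h x, x * inclHCoalg k H R h =
      crossedMul k (Bosonization k H R) σ (x ⊗ₜ inclHCoalg k H R h) := by
    intro h x
    have := key 1 h x
    rwa [inclHCoalg_one, one_mul, crossedMul_one_tmul hσ.one_tmul] at this
  have hr' : ∀ g x, σ (x ⊗ₜ inclHCoalg k H R g) =
      Coalgebra.counit (R := k) x * Coalgebra.counit (R := k) g := by
    intro g x
    rw [← counit_crossedMul, ← hr, Bialgebra.counit_mul, counit_inclHCoalg]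
  -- Products with `ι g` are replaced by deformed ones, to which the cocycle identity applies. For
  -- right invariance, `σ(x, y · ι g)` becomes `σ(x · y, ι g)` with deformed products; this equals
  -- `σ(x, y) ε(g)` by `hr'`.
  have h5 := Phi_restrictR (σ := σ) (fun g x y => by rw [hr, hl, hσ.cocycle]) (fun g x y => by
    rw [hr, ← hσ.cocycle, hr', counit_crossedMul, mul_comm])
  rw [← h5]
  exact Phi_prime _

end AlphaPrime

/-! ### Linearity of convolution inverses over `H` -/

section LinearInverse

variable {k : Type*} {H : Type*} [Field k] [Ring H] [HopfAlgebra k H]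
  {B C : Type*} [AddCommGroup B] [Module k B] [Module H B] [IsScalarTower k H B]
  [AddCommGroup C] [Module k C] [Module H C] [IsScalarTower k H C] [Coalgebra k C]

theorem sum_counit_left {C : Type*} [AddCommGroup C] [Module k C] [Coalgebra k C] {c : C}
    {P : Finset (C × C)}
    (hP : Coalgebra.comul (R := k) c = ∑ i ∈ P, i.1 ⊗ₜ[k] i.2) :
    ∑ i ∈ P, Coalgebra.counit (R := k) i.1 • i.2 = c := by
  have := congr(TensorProduct.lid k C $(Coalgebra.rTensor_counit_comul (R := k) c))
  simpa [hP] using this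

theorem gal_diagAct {m : B ⊗[k] B →ₗ[k] B} {f : C →ₗ[k] B}
    (hm : ∀ (h : H) x, h • m x = m (diagAct k H B B h x)) (hf : ∀ (h : H) x, f (h • x) = h • f x)
    (hC : ∀ (h : H) (c : C), Coalgebra.comul (R := k) (h • c) =
      diagAct k H C C h (Coalgebra.comul c)) (h : H) (x : B ⊗[k] C) :
    gal m f (diagAct k H B C h x) = diagAct k H B C h (gal m f x) := by
  induction x using TensorProduct.induction_on with
  | zero => simp
  | add x y hx hy => simp only [map_add, hx, hy]
  | tmul b c =>
  obtain ⟨P, hP⟩ := TensorProduct.exists_finset (Coalgebra.comul (R := k) h)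
  rw [diagAct_eq, gal_tmul, hP, map_sum, map_sum]
  simp only [TensorProduct.map_tmul, LinearMap.flip_apply, AlgHom.toLinearMap_apply,
    Algebra.lsmul_coe, gal_tmul, hC]
  generalize Coalgebra.comul (R := k) c = X
  induction X using TensorProduct.induction_on with
  | zero => simp
  | add x y hx hy => simp only [map_add, Finset.sum_add_distrib, hx, hy]
  | tmul x y =>
  let F : H ⊗[k] (H ⊗[k] H) →ₗ[k] B ⊗[k] C := LinearMap.rTensor C m ∘ₗ
    (TensorProduct.assoc k B B C).symm.toLinearMap ∘ₗ
      TensorProduct.map ((Algebra.lsmul k k B).toLinearMap.flip b)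
        (TensorProduct.map ((Algebra.lsmul k k B).toLinearMap.flip (f x))
          ((Algebra.lsmul k k C).toLinearMap.flip y))
  trans F (LinearMap.lTensor H Coalgebra.comul (Coalgebra.comul h))
  · rw [hP, map_sum, map_sum]
    refine Finset.sum_congr rfl fun i _ => ?_
    rw [diagAct_eq, LinearMap.lTensor_tmul]
    generalize Coalgebra.comul (R := k) i.2 = Z
    induction Z using TensorProduct.induction_on with
    | zero => simp
    | add x y hx hy => simp only [map_add, tmul_add, hx, hy]
    | tmul p q => simp [F, hf]
  · rw [← Coalgebra.coassoc_apply, LinearMap.rTensor_tmul, diagAct_eq]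
    generalize Coalgebra.comul (R := k) h = Z
    induction Z using TensorProduct.induction_on with
    | zero => simp
    | add x y hx hy => simp only [map_add, hx, hy]
    | tmul p q =>
    simp only [TensorProduct.map_tmul, LinearMap.rTensor_tmul, LinearMap.flip_apply,
      AlgHom.toLinearMap_apply, Algebra.lsmul_coe, LinearMap.comp_apply, TensorProduct.mk_apply, hm,
      diagAct_eq]
    generalize Coalgebra.comul (R := k) p = Z
    induction Z using TensorProduct.induction_on with
    | zero => simp
    | add x y hx hy => simp only [map_add, add_tmul, hx, hy]
    | tmul p q => simp [F]

/-- The convolution inverse of an `H`-linear map is `H`-linear. -/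
theorem IsConvInverse.smul {m : B ⊗[k] B →ₗ[k] B} {u : B} {f g : C →ₗ[k] B}
    (h : IsConvInverse Coalgebra.comul Coalgebra.counit m u f g)
    (hma : ∀ a b c, m (m (a ⊗ₜ b) ⊗ₜ c) = m (a ⊗ₜ m (b ⊗ₜ c)))
    (hu : ∀ b, m (b ⊗ₜ u) = b) (hu' : ∀ b, m (u ⊗ₜ b) = b)
    (hm : ∀ (h : H) x, h • m x = m (diagAct k H B B h x))
    (hum : ∀ h : H, h • u = Coalgebra.counit (R := k) h • u)
    (hf : ∀ (h : H) x, f (h • x) = h • f x)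
    (hC : ∀ (h : H) (c : C), Coalgebra.comul (R := k) (h • c) =
      diagAct k H C C h (Coalgebra.comul c))
    (hε : ∀ (h : H) (c : C), Coalgebra.counit (R := k) (h • c) =
      Coalgebra.counit (R := k) h * Coalgebra.counit (R := k) c) (a : H) (c : C) :
    g (a • c) = a • g c := by
  have h1 : ∀ y : B ⊗[k] C, TensorProduct.rid k B (LinearMap.lTensor B Coalgebra.counit
      (diagAct k H B C a y)) =
      a • TensorProduct.rid k B (LinearMap.lTensor B Coalgebra.counit y) := by
    intro y
    induction y using TensorProduct.induction_on with
    | zero => simp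
    | add x y hx hy => simp only [map_add, smul_add, hx, hy]
    | tmul b c =>
    obtain ⟨P, hP⟩ := TensorProduct.exists_finset (Coalgebra.comul (R := k) a)
    rw [diagAct_eq, hP]
    conv_rhs => rw [← sum_counit_right hP]
    simp only [map_sum, TensorProduct.map_tmul, LinearMap.lTensor_tmul, LinearMap.flip_apply,
      AlgHom.toLinearMap_apply, Algebra.lsmul_coe, hε, TensorProduct.rid_tmul, Finset.sum_smul,
      smul_assoc, mul_smul, smul_comm _ (Coalgebra.counit (R := k) c), Finset.smul_sum]
  -- The unit is `H`-invariant, so the diagonal action reaches only the second factor.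
  have h2 : u ⊗ₜ[k] (a • c) = diagAct k H B C a (u ⊗ₜ c) := by
    obtain ⟨P, hP⟩ := TensorProduct.exists_finset (Coalgebra.comul (R := k) a)
    have := sum_counit_left hP
    rw [diagAct_eq, hP]
    conv_lhs => rw [← this]
    simp only [map_sum, TensorProduct.map_tmul, LinearMap.flip_apply,
      AlgHom.toLinearMap_apply, Algebra.lsmul_coe, hum, Finset.sum_smul, tmul_sum,
      smul_assoc, smul_tmul]
  have hl := gal_injective_of_conv m u f g hma hu h.right
  have hr := gal_injective_of_conv m u g f hma hu h.left
  -- `gal m g` is the inverse of the `H`-linear bijection `gal m f`, hence `H`-linear.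
  have h3 : gal m g (diagAct k H B C a (u ⊗ₜ c)) = diagAct k H B C a (gal m g (u ⊗ₜ c)) := by
    rw [← hl (diagAct k H B C a (gal m g (u ⊗ₜ c))), gal_diagAct hm hf hC, hr]
  rw [← counit_gal m u g hu', h2, h3, h1, counit_gal m u g hu']

end LinearInverse

theorem counit_mul'_eq_counitSq {k R : Type*} [Field k] [Ring R] [Algebra k R] [Coalgebra k R]
    (h : ∀ r s : R, Coalgebra.counit (R := k) (r * s) =
      Coalgebra.counit (R := k) r * Coalgebra.counit (R := k) s) (c : R ⊗[k] R) :
    Coalgebra.counit (R := k) (LinearMap.mul' k R c) = counitSq k R c := by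
  induction c using TensorProduct.induction_on with
  | zero => simp
  | add x y hx hy => simp only [map_add, hx, hy]
  | tmul r s => exact h r s

/-! ### The deformations of `R` as cleft objects -/

section BraidedCleft

variable {k : Type u} {H : Type v} {R : Type w} [Field k] [Ring H] [HopfAlgebra k H]
  [Ring R] [Algebra k R] [Coalgebra k R] [Module H R] [IsScalarTower k H R]
  [YetterDrinfeld k H R]

variable (H) in
/-- The cleft object `k #_π R` with section `id`. -/
def braidedData (π : R ⊗[k] R →ₗ[k] k) : BraidedCleftData k H R where
  carrier := R
  mul := braidedCrossedMul k H R π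
  one := 1
  coact := Coalgebra.comul
  sec := LinearMap.id

theorem braidedAlpha_eq (π : R ⊗[k] R →ₗ[k] k) : braidedAlpha k H R π = ⟦braidedData H π⟧ := rfl

variable [YDHopf k H R]

theorem comul_mul_braided (c : R ⊗[k] R) :
    TensorProduct.map (LinearMap.mul' k R) (LinearMap.mul' k R) (comulSq k H R c) =
      Coalgebra.comul (LinearMap.mul' k R c) := by
  induction c using TensorProduct.induction_on with
  | zero => simp
  | add x y hx hy => simp only [map_add, hx, hy]
  | tmul r s => exact (YDHopf.comul_mul r s).symm

theorem comul_braidedCrossedMul (π : R ⊗[k] R →ₗ[k] k) (c : R ⊗[k] R) :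
    Coalgebra.comul (braidedCrossedMul k H R π c) =
      TensorProduct.map (braidedCrossedMul k H R π) (LinearMap.mul' k R) (comulSq k H R c) := by
  obtain ⟨C, hC, -⟩ := exists_coalgebra_braided k H R
  refine comul_deform π (Δ := comulSq k H R) (fun c => ?_) comul_mul_braided c
  have := C.coassoc
  rw [hC] at this
  exact congr($this c)

theorem counit_braidedCrossedMul (π : R ⊗[k] R →ₗ[k] k) (c : R ⊗[k] R) :
    Coalgebra.counit (braidedCrossedMul k H R π c) = π c := by
  obtain ⟨C, hC, hC'⟩ := exists_coalgebra_braided k H R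
  refine counit_deform (Δ := comulSq k H R) (ε := counitSq k R) π (fun c => ?_)
    (counit_mul'_eq_counitSq (YDHopf.counit_mul (H := H))) c
  have := C.lTensor_counit_comp_comul
  rw [hC, hC'] at this
  rw [show LinearMap.lTensor _ (counitSq k R) (comulSq k H R c) = c ⊗ₜ 1 from congr($this c)]
  simp

theorem braidedAlpha_injective : Function.Injective (braidedAlpha k H R) := by
  intro σ τ h
  obtain ⟨e, -, h1, -, -, h4⟩ := Quotient.exact h
  change R ≃ₗ[k] R at e
  replace h4 : ∀ x : R, e x = x := h4
  replace h1 : ∀ a b : R, e (braidedCrossedMul k H R σ (a ⊗ₜ b)) =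
    braidedCrossedMul k H R τ (e a ⊗ₜ e b) := h1
  refine TensorProduct.ext' fun a b => ?_
  rw [← counit_braidedCrossedMul (H := H), ← counit_braidedCrossedMul (H := H),
    ← h4 (braidedCrossedMul k H R σ _), h1, h4, h4]

/-- The map `r ↦ r ⊗ 1` embeds the deformed `R` multiplicatively into `R # H` deformed by `Φ(π)`,
where associativity is the classical statement. The unit laws are obtained in the same way. -/
theorem braidedCrossedMul_assoc {π : R ⊗[k] R →ₗ[k] k} (h : IsBraidedCocycle k H R π) (a b c : R) :
    braidedCrossedMul k H R π (braidedCrossedMul k H R π (a ⊗ₜ b) ⊗ₜ c) =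
      braidedCrossedMul k H R π (a ⊗ₜ braidedCrossedMul k H R π (b ⊗ₜ c)) := by
  apply tmul_one_injective (k := k) (H := H)
  simp only [← crossedMul_Phi_tmul_one]
  exact crossedMul_assoc (isCocycle_Phi h).cocycle _ _ _

theorem braidedCrossedMul_one {π : R ⊗[k] R →ₗ[k] k} (h : IsBraidedCocycle k H R π) (a : R) :
    braidedCrossedMul k H R π (a ⊗ₜ 1) = a := by
  apply tmul_one_injective (k := k) (H := H)
  simp only [← crossedMul_Phi_tmul_one]
  exact crossedMul_tmul_one (isCocycle_Phi h).tmul_one _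

theorem one_braidedCrossedMul {π : R ⊗[k] R →ₗ[k] k} (h : IsBraidedCocycle k H R π) (a : R) :
    braidedCrossedMul k H R π (1 ⊗ₜ a) = a := by
  apply tmul_one_injective (k := k) (H := H)
  simp only [← crossedMul_Phi_tmul_one]
  exact crossedMul_one_tmul (isCocycle_Phi h).one_tmul _

theorem braidedData_isCleft {π : R ⊗[k] R →ₗ[k] k} (h : IsBraidedCocycle k H R π) :
    (braidedData H π).IsCleft where
  smul_mul :=
    have h' := smul_braidedCrossedMul h.linear
    h'
  smul_one :=
    have h : ∀ a : H, a • (1 : R) = Coalgebra.counit (R := k) a • (1 : R) := YDHopf.smul_one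
    h
  coact_smul :=
    have h : ∀ (a : H) (r : R), Coalgebra.comul (R := k) (a • r) =
      diagAct k H R R a (Coalgebra.comul r) := YDHopf.comul_smul
    h
  sec_smul _ _ := rfl
  mul_assoc :=
    have h' := braidedCrossedMul_assoc h
    h'
  one_mul :=
    have h' := one_braidedCrossedMul h
    h'
  mul_one :=
    have h' := braidedCrossedMul_one h
    h'
  coassoc :=
    have h : ∀ a : R, TensorProduct.assoc k R R R (LinearMap.rTensor R Coalgebra.comul
      (Coalgebra.comul a)) = LinearMap.lTensor R Coalgebra.comul (Coalgebra.comul a) :=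
      Coalgebra.coassoc_apply
    h
  counit_coact :=
    have h : ∀ a : R, TensorProduct.rid k R (LinearMap.lTensor R Coalgebra.counit
      (Coalgebra.comul a)) = a := by simp
    h
  coact_mul :=
    have h : ∀ a b : R, Coalgebra.comul (braidedCrossedMul k H R π (a ⊗ₜ b)) =
        braidedMul k H R (braidedCrossedMul k H R π) (Coalgebra.comul a ⊗ₜ Coalgebra.comul b) :=
      fun a b => comul_braidedCrossedMul π _
    h
  coact_one :=
    have h : Coalgebra.comul (R := k) (1 : R) = 1 ⊗ₜ 1 := YDHopf.comul_one (H := H)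
    h
  one_ne_zero :=
    have h : (1 : R) ≠ 0 := one_ne_zero_of_counit_one (k := k) (YDHopf.counit_one (H := H))
    h
  coinvariants :=
    have h : ∀ a : R, Coalgebra.comul (R := k) a = a ⊗ₜ 1 ↔ ∃ c : k, a = c • 1 :=
      comul_eq_tmul_one_iff (YDHopf.comul_one (H := H))
    h
  sec_coact := comul_eq_rTensor_id (A := R)
  sec_one := rfl
  sec_invertible := by
    obtain ⟨π', -, hπ'⟩ := h.invertible
    -- This produces a merely linear inverse; `IsConvInverse.smul` then supplies its `H`-linearity.
    obtain ⟨g, hg⟩ := deform_exists_isConvInverse (exists_coalgebra_braided k H R)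
      (YDHopf.antipode_inv (H := H)) hπ' (braidedCrossedMul_assoc h) (braidedCrossedMul_one h)
      (one_braidedCrossedMul h)
    exact ⟨g, hg.smul (H := H) (braidedCrossedMul_assoc h) (braidedCrossedMul_one h)
      (one_braidedCrossedMul h) (smul_braidedCrossedMul h.linear) YDHopf.smul_one
      (fun _ _ => rfl) YDHopf.comul_smul YDHopf.counit_smul, hg⟩

end BraidedCleft

/-! ### Associativity of the braided product on `E ⊗ R` -/

section BraidedMulAssoc

variable {k : Type*} {H : Type*} {R : Type*} [Field k] [Ring H] [HopfAlgebra k H]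
  [Ring R] [Algebra k R] [Module H R] [IsScalarTower k H R] [YetterDrinfeld k H R]
  {E : Type*} [AddCommGroup E] [Module k E] [Module H E] [IsScalarTower k H E]

theorem braidedMul_tmul (m : E ⊗[k] E →ₗ[k] E) (x y : E) (r s : R) :
    braidedMul k H R m ((x ⊗ₜ r) ⊗ₜ (y ⊗ₜ s)) =
      TensorProduct.map (m ∘ₗ TensorProduct.mk k E E x ∘ₗ (Algebra.lsmul k k E).toLinearMap.flip y)
        ((LinearMap.mul k R).flip s) (YetterDrinfeld.coact (k := k) (H := H) r) := by
  simp only [braidedMul, LinearMap.comp_apply, mid_tmul, braid_tmul]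
  generalize YetterDrinfeld.coact (k := k) (H := H) r = X
  induction X using TensorProduct.induction_on with
  | zero => simp
  | add x y hx hy => simp only [map_add, hx, hy]
  | tmul p q => simp

/-- Braiding past a product in `R` uses that the coaction is multiplicative; braiding past a product
in `E` uses that the coaction is coassociative and `m` is `H`-linear. `E` itself needs no coaction
of `H`. -/
theorem braidedMul_assoc {m : E ⊗[k] E →ₗ[k] E}
    (hR : ∀ x : R ⊗[k] R, YetterDrinfeld.coact (k := k) (H := H) (LinearMap.mul' k R x) =
      LinearMap.lTensor H (LinearMap.mul' k R) (codiag k H R R x))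
    (hm : ∀ a b c, m (m (a ⊗ₜ b) ⊗ₜ c) = m (a ⊗ₜ m (b ⊗ₜ c)))
    (hs : ∀ (h : H) x, h • m x = m (diagAct k H E E h x)) (x y z : E ⊗[k] R) :
    braidedMul k H R m (braidedMul k H R m (x ⊗ₜ y) ⊗ₜ z) =
      braidedMul k H R m (x ⊗ₜ braidedMul k H R m (y ⊗ₜ z)) := by
  induction x using TensorProduct.induction_on with
  | zero => simp
  | add x y hx hy => simp only [map_add, add_tmul, hx, hy]
  | tmul x r =>
  induction y using TensorProduct.induction_on with
  | zero => simp
  | add x y hx hy => simp only [map_add, add_tmul, tmul_add, hx, hy]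
  | tmul y s =>
  induction z using TensorProduct.induction_on with
  | zero => simp
  | add x y hx hy => simp only [map_add, tmul_add, hx, hy]
  | tmul z t =>
  obtain ⟨P, hP⟩ := TensorProduct.exists_finset (YetterDrinfeld.coact (k := k) (H := H) r)
  have hc : ∀ q : R, YetterDrinfeld.coact (k := k) (H := H) (q * s) =
      LinearMap.lTensor H (LinearMap.mul' k R)
        (LinearMap.rTensor (R ⊗[k] R) (LinearMap.mul' k H)
          (TensorProduct.tensorTensorTensorComm k H R H R
            (YetterDrinfeld.coact q ⊗ₜ YetterDrinfeld.coact s))) := fun q => hR (q ⊗ₜ s)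
  rw [braidedMul_tmul, braidedMul_tmul, hP, map_sum, sum_tmul, map_sum]
  simp only [TensorProduct.map_tmul, braidedMul_tmul, LinearMap.flip_apply, LinearMap.mul_apply',
    hc]
  generalize YetterDrinfeld.coact (k := k) (H := H) s = S
  induction S using TensorProduct.induction_on with
  | zero => simp
  | add x y hx hy => simp only [map_add, tmul_add, Finset.sum_add_distrib, hx, hy]
  | tmul s' s₀ =>
  let F : H ⊗[k] (H ⊗[k] R) →ₗ[k] E ⊗[k] R :=
    LinearMap.rTensor R (m ∘ₗ TensorProduct.mk k E E x ∘ₗ m) ∘ₗ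
      (TensorProduct.assoc k E E R).symm.toLinearMap ∘ₗ
        TensorProduct.map ((Algebra.lsmul k k E).toLinearMap.flip y)
          (TensorProduct.map ((Algebra.lsmul k k E).toLinearMap.flip (s' • z))
            ((LinearMap.mul k R).flip (s₀ * t)))
  trans F (LinearMap.lTensor H YetterDrinfeld.coact (YetterDrinfeld.coact r))
  · rw [hP, map_sum, map_sum]
    refine Finset.sum_congr rfl fun i _ => ?_
    rw [LinearMap.lTensor_tmul]
    generalize YetterDrinfeld.coact (k := k) (H := H) i.2 = Z
    induction Z using TensorProduct.induction_on with
    | zero => simp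
    | add x y hx hy => simp only [map_add, add_tmul, tmul_add, hx, hy]
    | tmul p q => simp [F, hm, mul_assoc]
  · rw [← YetterDrinfeld.coassoc, TensorProduct.map_tmul, braidedMul_tmul]
    generalize YetterDrinfeld.coact (k := k) (H := H) r = Z
    induction Z using TensorProduct.induction_on with
    | zero => simp
    | add x y hx hy => simp only [map_add, hx, hy]
    | tmul p q =>
    simp only [TensorProduct.map_tmul, LinearMap.rTensor_tmul, LinearMap.flip_apply,
      AlgHom.toLinearMap_apply, Algebra.lsmul_coe, LinearMap.comp_apply, TensorProduct.mk_apply, hs,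
      diagAct_eq]
    generalize Coalgebra.comul (R := k) p = Z
    induction Z using TensorProduct.induction_on with
    | zero => simp
    | add x y hx hy => simp only [map_add, add_tmul, tmul_add, hx, hy]
    | tmul p q => simp [F]

end BraidedMulAssoc

/-! ### Braided cocycles and cleft objects, and the bijection `Ψ` -/

section BraidedAlpha

variable {k : Type u} {H : Type v} {R : Type w} [Field k] [Ring H] [HopfAlgebra k H]
  [Ring R] [Algebra k R] [Coalgebra k R] [Module H R] [IsScalarTower k H R]
  [YetterDrinfeld k H R] [YDHopf k H R]

/-- The general results used for the flip, now with `τ` the braiding; what is added is `H`-linearity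
of `π` and of its inverse. -/
theorem exists_braidedCocycle_of_isCleft {X : BraidedCleftData k H R} (h : X.IsCleft) :
    ∃ π, IsBraidedCocycle k H R π ∧ braidedAlpha k H R π = ⟦X⟧ := by
  obtain ⟨g, -, hg⟩ := h.sec_invertible
  have h1 : ∀ a : X.carrier, braid k H R X.carrier (1 ⊗ₜ a) = a ⊗ₜ 1 := by
    intro a
    rw [braid_tmul, YDHopf.coact_one]
    simp
  have h2 : ∀ r : R, braid k H R X.carrier (r ⊗ₜ X.one) = X.one ⊗ₜ r := by
    intro r
    rw [braid_tmul]
    conv_rhs => rw [← YetterDrinfeld.counit_coact (k := k) (H := H) r]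
    generalize YetterDrinfeld.coact (k := k) (H := H) r = Z
    induction Z using TensorProduct.induction_on with
    | zero => simp
    | add x y hx hy => simp only [map_add, tmul_add, hx, hy]
    | tmul p q => simp [h.smul_one, smul_tmul]
  -- Naturality of the braiding with respect to the `H`-linear section.
  have h3 : ∀ r b : R, braid k H R X.carrier (r ⊗ₜ X.sec b) =
      LinearMap.rTensor R X.sec (braid k H R R (r ⊗ₜ b)) := by
    intro r b
    rw [braid_tmul, braid_tmul]
    generalize YetterDrinfeld.coact (k := k) (H := H) r = Z
    induction Z using TensorProduct.induction_on with
    | zero => simp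
    | add x y hx hy => simp only [map_add, hx, hy]
    | tmul p q => simp [h.sec_smul]
  have hb : Function.Bijective X.sec := section_bijective (braid k H R X.carrier) X.mul X.one
    X.coact X.sec g h.mul_assoc h.one_mul h.mul_one h1 h2
    (braidedMul_assoc YDHopf.coact_mul h.mul_assoc h.smul_mul) h.coassoc h.counit_coact h.coact_mul
    h.coact_one h.one_ne_zero h.coinvariants h.sec_coact hg
  obtain ⟨π, h4, h5, h6, π', h7⟩ := exists_deform (τE := braid k H R X.carrier)
    (exists_coalgebra_braided k H R) (YDHopf.antipode_inv (H := H))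
    (counit_mul'_eq_counitSq (YDHopf.counit_mul (H := H))) (YDHopf.counit_one (H := H)) h.mul_assoc
    h.mul_one h.coact_mul h.sec_coact h.sec_one h3 hg hb
  replace h4 : ∀ c, X.sec (braidedCrossedMul k H R π c) = X.mul (TensorProduct.map X.sec X.sec c) :=
    fun c => congr($(TensorProduct.ext' (g := X.sec ∘ₗ braidedCrossedMul k H R π)
      (h := X.mul ∘ₗ TensorProduct.map X.sec X.sec) h4) c)
  have hd : ∀ (a : H) c, TensorProduct.map X.sec X.sec (diagAct k H R R a c) =
      diagAct k H X.carrier X.carrier a (TensorProduct.map X.sec X.sec c) := by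
    intro a c
    induction c using TensorProduct.induction_on with
    | zero => simp
    | add x y hx hy => simp only [map_add, hx, hy]
    | tmul r s =>
    rw [TensorProduct.map_tmul, diagAct_eq, diagAct_eq]
    generalize Coalgebra.comul (R := k) a = Z
    induction Z using TensorProduct.induction_on with
    | zero => simp
    | add x y hx hy => simp only [map_add, hx, hy]
    | tmul p q => simp [h.sec_smul]
  -- `π` is the counit of the deformed product, and that product is `H`-linear because the bijection
  -- `X.sec` carries it to the product of `X`.
  have h8 : ∀ (a : H) x, π (diagAct k H R R a x) = Coalgebra.counit (R := k) a * π x := by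
    intro a x
    rw [← counit_braidedCrossedMul (H := H), ← counit_braidedCrossedMul (H := H),
      ← YDHopf.counit_smul]
    congr 1
    apply hb.1
    rw [h4, hd, ← h.smul_mul, ← h4, h.sec_smul]
  refine ⟨π, ⟨h8, ⟨π', isConvInverse_linear h8 h7, h7⟩, h5, h6⟩, ?_⟩
  rw [braidedAlpha_eq]
  exact Quotient.sound ⟨LinearEquiv.ofBijective X.sec hb, h.sec_smul, fun a b => h4 (a ⊗ₜ b),
    h.sec_one, h.sec_coact, fun _ => rfl⟩

variable (k H R)

theorem braidedAlpha_bijOn : Set.BijOn (braidedAlpha k H R) {π | IsBraidedCocycle k H R π}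
    (BraidedCleftClasses k H R) := by
  refine ⟨fun π hπ => ⟨braidedData H π, braidedData_isCleft hπ, rfl⟩,
    braidedAlpha_injective.injOn, ?_⟩
  rintro _ ⟨X, hX, rfl⟩
  obtain ⟨π, hπ, h⟩ := exists_braidedCocycle_of_isCleft hX
  exact ⟨π, hπ, h⟩

/-- Both representatives live on `R ⊗ H`, with the same unit, coaction and section, so the identity
is an isomorphism as soon as the products agree, which is `crossedMul_Phi`. -/
theorem Psi_braidedAlpha (π : R ⊗[k] R →ₗ[k] k) :
    Psi k H R (braidedAlpha k H R π) = alpha k (Bosonization k H R) (Phi k H R π) := by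
  refine Quotient.sound ⟨LinearEquiv.refl k (R ⊗[k] H), fun a b => ?_, rfl, fun a => ?_,
    fun x => ?_⟩
  · exact congr($((crossedMul_Phi k H R π).symm) (a ⊗ₜ b))
  · exact comul_eq_rTensor_id (A := Bosonization k H R) a
  · exact congr($(LinearMap.rTensor_id (R := k) H R) x)

/-- In the commutative square the other three sides are bijections, so on cleft classes `Ψ` is `α ∘
Φ ∘ α_R⁻¹`. -/
theorem Psi_bijOn : Set.BijOn (Psi k H R) (BraidedCleftClasses k H R)
    (CleftClassesPrime k H R) := by
  have h := (alpha_bijOn_prime k H R).comp (Phi_bijOn k H R)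
  have h1 := braidedAlpha_bijOn k H R
  have h2 : ∀ π, Psi k H R (braidedAlpha k H R π) =
    (alpha k (Bosonization k H R) ∘ Phi k H R) π := Psi_braidedAlpha k H R
  refine ⟨?_, ?_, ?_⟩
  · intro c hc
    obtain ⟨π, hπ, rfl⟩ := h1.surjOn hc
    rw [h2]
    exact h.mapsTo hπ
  · intro c hc c' hc' e
    obtain ⟨π, hπ, rfl⟩ := h1.surjOn hc
    obtain ⟨π', hπ', rfl⟩ := h1.surjOn hc'
    rw [h2, h2] at e
    rw [h.injOn hπ hπ' e]
  · intro c hc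
    obtain ⟨π, hπ, rfl⟩ := h.surjOn hc
    exact ⟨_, h1.mapsTo hπ, h2 π⟩

end BraidedAlpha

end

end YDCleft

theorem mainTheorem5 (k : Type u) (H : Type v) (R : Type w) [Field k] [Ring H] [HopfAlgebra k H]
    [Ring R] [Algebra k R] [Coalgebra k R] [Module H R] [IsScalarTower k H R]
    [YDCleft.YetterDrinfeld k H R] [YDCleft.YDHopf k H R] :
    Set.BijOn (YDCleft.Phi k H R)
      {π | YDCleft.IsBraidedCocycle k H R π} (YDCleft.CocyclesPrime k H R) ∧
    Set.BijOn (YDCleft.Psi k H R)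
      (YDCleft.BraidedCleftClasses k H R) (YDCleft.CleftClassesPrime k H R) ∧
    Set.BijOn (YDCleft.braidedAlpha k H R)
      {π | YDCleft.IsBraidedCocycle k H R π} (YDCleft.BraidedCleftClasses k H R) ∧
    Set.BijOn (YDCleft.alpha k (YDCleft.Bosonization k H R))
      {σ | YDCleft.IsCocycle k (YDCleft.Bosonization k H R) σ}
      (YDCleft.CleftClasses k (YDCleft.Bosonization k H R)) ∧
    Set.BijOn (YDCleft.alpha k (YDCleft.Bosonization k H R))
      (YDCleft.CocyclesPrime k H R) (YDCleft.CleftClassesPrime k H R) ∧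
    ∀ π, YDCleft.IsBraidedCocycle k H R π →
      YDCleft.Psi k H R (YDCleft.braidedAlpha k H R π) =
        YDCleft.alpha k (YDCleft.Bosonization k H R) (YDCleft.Phi k H R π) := by
  exact ⟨YDCleft.Phi_bijOn k H R, YDCleft.Psi_bijOn k H R, YDCleft.braidedAlpha_bijOn k H R,
    YDCleft.alpha_bijOn, YDCleft.alpha_bijOn_prime k H R,
    fun π _ => YDCleft.Psi_braidedAlpha k H R π⟩
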